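/- **Setup.** Let $d\ge 1$, $\sigma>0$, $\lambda\ge 0$. Let $\{P_\theta:\theta\in\Theta\}$, $\Theta\subseteq\mathbb R^d$ convex and open, be a parametric family on a measurable space $\mathcal X$ where $P_\theta$ has density $f(\cdot;\theta)>0$ with respect to a common base measure $\nu_{\mathcal X}$, let $R$ be a twice differentiable function on $\Theta$, and assume that $\theta\mapsto\mathcal L(\theta;x)=-\log f(x;\theta)+R(\theta)$ is twice continuously differentiable on $\Theta$ for every $x$. Put $\mathcal L(\theta;x,w)=\mathcal L(\theta;x)+\sigma w^\top\theta$. A point $\theta\in\Theta$ with support $S(\theta)=\{j:\theta_j\ne0\}$ is a *strict second-order stationary point (SSOSP)* of the problem $\min_{\theta\in\Theta}\{\mathcal L(\theta;x,w)+\lambda\|\theta\|_1\}$ if $\nabla_\theta\mathcal L(\theta;x,w)+\lambda s=0$ for some $s$ with $s_j=\mathrm{sign}(\theta_j)$ for $j\in S(\theta)$ and $s_j\in[-1,1]$ otherwise, and the principal submatrix $\nabla^2_\theta\mathcal L(\theta;x,w)_{S(\theta)}$ is positive definite. Let $\hat\theta:\mathcal X\times\mathbb R^d\to\Theta$ be any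 measurable function (the solver), and $\hat g(x,w)=\nabla_\theta\mathcal L(\hat\theta(x,w);x,w)$. For $\theta\in\Theta$, $g\in\mathbb R^d$ let $$p_\theta(x\mid\theta,g)\propto f(x;\theta)\exp\Big\{-\frac{\|g-\nabla_\theta\mathcal L(\theta;x)\|^2}{2\sigma^2/d}\Big\}\det\big(\nabla^2_\theta\mathcal L(\theta;x)_{S(\theta)}\big)\mathbf 1_{x\in\mathcal X_{\theta,g}}$$ be a density with respect to $\nu_{\mathcal X}$, where $\mathcal X_{\theta,g}$ is the set of $x$ such that for some $w$, $\theta=\hat\theta(x,w)$ is an SSOSP and $g=\nabla_\theta\mathcal L(\theta;x,w)$. Let $\tilde P_M(\cdot;x,\theta,g)$ be a Markov kernel into $\mathcal X^M$ such that, for all $\theta\in\Theta$ and $g$ for which $p_\theta(\cdot\mid\theta,g)$ is well defined (the right-hand side has finite positive integral), if $X\sim p_\theta(\cdot\mid\theta,g)$ and $(\tilde X^{(1)},\dots,\tilde X^{(M)})\mid X\sim\tilde P_M(\cdot;X,\theta,g)$ then $(X,\tilde X^{(1)},\dots,\tilde X^{(M)})$ is exchangeable (for instance, i.i.d. sampling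 from $p_\theta(\cdot\mid\theta,g)$). The *$\ell_1$-penalized aCSS procedure* observes $X\sim P_{\theta_0}$, draws an independent $W\sim\mathcal N(0,\frac1d\mathbf I_d)$, computes $\hat\theta=\hat\theta(X,W)$, $\hat g=\hat g(X,W)$, and draws $(\tilde X^{(1)},\dots,\tilde X^{(M)})\sim\tilde P_M(\cdot;X,\hat\theta,\hat g)$ if $\hat\theta$ is an SSOSP, and sets $\tilde X^{(1)}=\dots=\tilde X^{(M)}=X$ otherwise. Let $d_{\mathrm{exch}}$ denote the infimum of the total variation distance to exchangeable laws, and $\mathrm{pval}_T=\frac1{M+1}\big(1+\sum_{m=1}^M\mathbf 1\{T(\tilde X^{(m)})\ge T(X)\}\big)$. We say that *the error bound $B$ holds at $\theta_0$* if, when $X\sim P_{\theta_0}$, $d_{\mathrm{exch}}(X,\tilde X^{(1)},\dots,\tilde X^{(M)})\le B$ and $\mathbb P(\mathrm{pval}_T\le\alpha)\le\alpha+B$ for every measurable $T:\mathcal X\to\mathbb R$ and every $\alpha\in[0,1]$. **Theorem.** (1) *General models.* Let $r\ge0$, $\epsilon$, $\delta$ be real functions on $\Theta$ such that for every $\theta_0\in\Theta$: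 (a) with probability at least $1-\delta(\theta_0)$ under $(X,W)\sim P_{\theta_0}\times\mathcal N(0,\frac1d\mathbf I_d)$, $\hat\theta(X,W)$ is an SSOSP and $\|\hat\theta(X,W)-\theta_0\|\le r(\theta_0)$; (b) with $H(\theta;x)=-\nabla^2_\theta\log f(x;\theta)$ and $\mathbb B(\theta_0,r(\theta_0))$ the closed ball, the expectation $H(\theta)=\mathbb E_{\theta_0}[H(\theta;X)]$ exists for all $\theta\in\mathbb B(\theta_0,r(\theta_0))\cap\Theta$, and $$\mathbb E_{\theta_0}\Big[\sup_{\theta\in\mathbb B(\theta_0,r(\theta_0))\cap\Theta}r(\theta_0)^2\big(\lambda_{\max}(H(\theta)-H(\theta;X))\big)_+\Big]\le\epsilon(\theta_0),$$ $$\log\mathbb E_{\theta_0}\Big[\exp\Big\{\sup_{\theta\in\mathbb B(\theta_0,r(\theta_0))\cap\Theta}r(\theta_0)^2\big(\lambda_{\max}(H(\theta;X)-H(\theta))\big)_+\Big\}\Big]\le\epsilon(\theta_0).$$ Then for every $\theta_0\in\Theta$ the error bound $3\sigma r(\theta_0)+\epsilon(\theta_0)+\delta(\theta_0)$ holds at $\theta_0$.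 (2) *Sparse structure.* Under the assumptions of (1), let $v_1,\dots,v_p\in\mathbb R^d$, let $\|w\|_{v,0}$ be the least $|S|$, $S\subseteq[p]$, with $w\in\mathrm{span}\{v_i\}_{i\in S}$ ($+\infty$ if there is none), and $h_v(k)=\mathbb E_{Z\sim\mathcal N(0,\mathbf I_d)}\big[\max_{|S|\le k}\|\mathcal P_{v_S}Z\|^2\big]$, where $\mathcal P_{v_S}$ is the orthogonal projection onto $\mathrm{span}\{v_i\}_{i\in S}$. If $\mathbb P\{\|\hat\theta(X,W)-\theta_0\|_{v,0}\le k\}\ge1-\tilde\delta$ under $(X,W)\sim P_{\theta_0}\times\mathcal N(0,\frac1d\mathbf I_d)$, then the error bound $3\sigma r(\theta_0)\sqrt{h_v(k)/d}+\epsilon(\theta_0)+\delta(\theta_0)+\tilde\delta$ holds at $\theta_0$. (3) *Gaussian linear model.* Let $P_\theta=\mathcal N(Z\theta,\nu^2\mathbf I_n)$, $\theta\in\Theta=\mathbb R^d$, with known $Z\in\mathbb R^{n\times d}$ and $\nu>0$ (densities with respect to Lebesgue measure). Let $R$ be twice differentiable on $\mathbb R^d$ with $\frac1{\nu^2}Z^\top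 Z+\nabla^2R(\theta)\succ c\mathbf I_d$ for all $\theta$, for some $c>0$, and let $\hat\theta(x,w)$ be the minimizer of $\mathcal L(\theta;x,w)+\lambda\|\theta\|_1$ over $\theta\in\mathbb R^d$. If $r\ge0$ and $\mathbb P\{\|\hat\theta(X,W)-\theta_0\|\le r\}\ge1-\delta$ under $(X,W)\sim P_{\theta_0}\times\mathcal N(0,\frac1d\mathbf I_d)$, then the error bound $\frac{\sigma}{2\sqrt d}\,r+\delta$ holds at $\theta_0$. -/

import Mathlib

open MeasureTheory ProbabilityTheory Set
open scoped ENNReal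

noncomputable section

/-- The parameter space `ℝ^d` with the Euclidean norm. -/
abbrev Vec (d : ℕ) : Type := EuclideanSpace ℝ (Fin d)

/-! ### Distance to exchangeability and p-values -/

/-- Total variation distance `sup_A |μ(A) - ρ(A)|` over measurable sets `A`. -/
def tvDistance {Y : Type*} [MeasurableSpace Y] (μ ρ : Measure Y) : ℝ :=
  ⨆ A : {A : Set Y // MeasurableSet A}, |μ.real A.1 - ρ.real A.1|

/-- The law `μ` of a random vector `(B_0, …, B_{k-1})` is exchangeable. -/
def IsExchangeableLaw {X : Type*} [MeasurableSpace X] {k : ℕ} (μ : Measure (Fin k → X)) : Prop :=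
  ∀ π : Equiv.Perm (Fin k), μ.map (fun z i => z (π i)) = μ

/-- Distance to exchangeability of a random vector with law `μ`. -/
def dExch {X : Type*} [MeasurableSpace X] {k : ℕ} (μ : Measure (Fin k → X)) : ℝ :=
  ⨅ ρ : {ρ : Measure (Fin k → X) // IsProbabilityMeasure ρ ∧ IsExchangeableLaw ρ},
    tvDistance μ ρ.1

open Classical in
/-- The p-value of the vector `z = (x, x̃⁽¹⁾, …, x̃⁽ᴹ⁾)` for the statistic `T`. -/
def pval {X : Type*} {M : ℕ} (T : X → ℝ) (z : Fin (M + 1) → X) : ℝ :=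
  (1 / ((M : ℝ) + 1)) * (1 + ∑ m : Fin M, if T (z 0) ≤ T (z m.succ) then 1 else 0)

/-- The law `μ` of `(X, X̃⁽¹⁾, …, X̃⁽ᴹ⁾)` is within `B` of exchangeability, and the excess Type I
error of every test based on the p-value is at most `B`. -/
def ErrorBound {X : Type*} [MeasurableSpace X] {M : ℕ} (μ : Measure (Fin (M + 1) → X))
    (B : ℝ) : Prop :=
  dExch μ ≤ B ∧
  ∀ T : X → ℝ, Measurable T → ∀ α ∈ Icc (0 : ℝ) 1, μ.real {z | pval T z ≤ α} ≤ α + B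

/-- The law of `(x, x̃⁽¹⁾, …, x̃⁽ᴹ⁾)` when `x̃` has law `q`. -/
def consLaw {X : Type*} [MeasurableSpace X] {M : ℕ} (x : X) (q : Measure (Fin M → X)) :
    Measure (Fin (M + 1) → X) :=
  q.map (fun z => (Fin.cons x z : Fin (M + 1) → X))

/-! ### Sparsity with respect to a family of vectors -/

/-- `‖w‖_{v,0}`: the least number of the vectors `v i` whose span contains `w` (`⊤` if none). -/
def vSparsity {d p : ℕ} (v : Fin p → Vec d) (w : Vec d) : ℕ∞ :=
  ⨅ (S : Finset (Fin p)) (_ : w ∈ Submodule.span ℝ (v '' (S : Set (Fin p)))), (S.card : ℕ∞)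

/-- `h_v(k) = E[max_{|S| ≤ k} ‖P_{v_S} Z‖²]` for `Z ~ N(0, I_d)`. -/
def effectiveDim {d p : ℕ} (v : Fin p → Vec d) (k : ℕ) : ℝ :=
  ∫ z, ⨆ S : {S : Finset (Fin p) // S.card ≤ k},
    ‖(Submodule.span ℝ (v '' (S.1 : Set (Fin p)))).starProjection z‖ ^ 2 ∂(stdGaussian (Vec d))

/-! ### Hessians, largest eigenvalues, perturbation noise -/

/-- The Hessian matrix of `F` at `θ`. -/
def hessian {d : ℕ} (F : Vec d → ℝ) (θ : Vec d) : Matrix (Fin d) (Fin d) ℝ :=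
  Matrix.of fun i j =>
    fderiv ℝ (fderiv ℝ F) θ (EuclideanSpace.single i 1) (EuclideanSpace.single j 1)

/-- The largest eigenvalue of a (symmetric) matrix. -/
def lambdaMax {d : ℕ} (A : Matrix (Fin d) (Fin d) ℝ) : ℝ := sSup (spectrum ℝ A)

/-- The principal submatrix `A_{S(θ)}` on the support `S(θ) = {j | θ_j ≠ 0}`. -/
def suppSubmatrix {d : ℕ} (θ : Vec d) (A : Matrix (Fin d) (Fin d) ℝ) :
    Matrix {j : Fin d // θ j ≠ 0} {j : Fin d // θ j ≠ 0} ℝ :=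
  A.submatrix Subtype.val Subtype.val

/-- `N(0, (1/d) I_d)`, the law of `d^{-1/2} Z` with `Z ~ N(0, I_d)`. -/
def noiseLaw (d : ℕ) : Measure (Vec d) :=
  (stdGaussian (Vec d)).map (fun z => (√(d : ℝ))⁻¹ • z)

/-! ### The `ℓ¹`-penalized aCSS procedure -/

/-- The data entering the `ℓ¹`-penalized aCSS procedure (no properties are imposed here). -/
structure PenalizedModel (d : ℕ) (X : Type*) [MeasurableSpace X] where
  /-- base measure on the sample space -/
  base : Measure X
  /-- parameter space -/
  Θ : Set (Vec d)
  /-- densities `f x θ = f(x; θ)` with respect to the base measure -/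
  f : X → Vec d → ℝ
  /-- regularizer -/
  R : Vec d → ℝ
  /-- scale of the perturbation -/
  σ : ℝ
  /-- weight of the `ℓ¹` penalty -/
  lam : ℝ
  /-- output of the solver on input `(x, w)` -/
  θhat : X → Vec d → Vec d

namespace PenalizedModel

variable {d : ℕ} {X : Type*} [MeasurableSpace X] (D : PenalizedModel d X)

/-- The distribution `P_θ`. -/
def P (θ : Vec d) : Measure X := D.base.withDensity fun x => ENNReal.ofReal (D.f x θ)

/-- `𝓛(θ; x) = -log f(x; θ) + R(θ)`. -/
def loss (x : X) (θ : Vec d) : ℝ := -Real.log (D.f x θ) + D.R θ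

/-- `𝓛(θ; x, w) = 𝓛(θ; x) + σ wᵀθ`. -/
def perturbedLoss (x : X) (w θ : Vec d) : ℝ := D.loss x θ + D.σ * inner ℝ w θ

/-- The `ℓ¹`-penalized objective `𝓛(θ; x, w) + λ ‖θ‖₁`. -/
def objective (x : X) (w θ : Vec d) : ℝ := D.perturbedLoss x w θ + D.lam * ∑ j, |θ j|

/-- Regularity of the family and of the regularizer. -/
structure Regular : Prop where
  convex : Convex ℝ D.Θ
  isOpen : IsOpen D.Θ
  measurable_f : ∀ θ ∈ D.Θ, Measurable fun x => D.f x θ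
  f_pos : ∀ θ ∈ D.Θ, ∀ x, 0 < D.f x θ
  isProbabilityMeasure : ∀ θ ∈ D.Θ, IsProbabilityMeasure (D.P θ)
  differentiable_R : DifferentiableOn ℝ D.R D.Θ
  twice_differentiable_R : DifferentiableOn ℝ (fderiv ℝ D.R) D.Θ
  contDiff_loss : ∀ x, ContDiffOn ℝ 2 (D.loss x) D.Θ

/-- The solver is a measurable function into the parameter space. -/
def MeasurableSolver : Prop :=
  Measurable (fun q : X × Vec d => D.θhat q.1 q.2) ∧ ∀ x w, D.θhat x w ∈ D.Θ

/-- `θ` is a strict second-order stationary point of the `ℓ¹`-penalized problem with input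
`(x, w)`: the KKT conditions, and positive definiteness of the Hessian on the support of `θ`. -/
def IsSSOSP (x : X) (w θ : Vec d) : Prop :=
  θ ∈ D.Θ ∧
  (∃ s : Vec d, gradient (D.perturbedLoss x w) θ + D.lam • s = 0 ∧
    ∀ j, (θ j ≠ 0 → s j = Real.sign (θ j)) ∧ (θ j = 0 → s j ∈ Icc (-1 : ℝ) 1)) ∧
  (suppSubmatrix θ (hessian (D.perturbedLoss x w) θ)).PosDef

/-- `ĝ(x, w) = ∇_θ 𝓛(θ̂(x, w); x, w)`. -/
def ghat (x : X) (w : Vec d) : Vec d := gradient (D.perturbedLoss x w) (D.θhat x w)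

/-- The set `𝓧_{θ,g}` of the `x` such that, for some `w`, `θ = θ̂(x, w)` is an SSOSP and
`g = ∇𝓛(θ; x, w)`. -/
def feasibleSet (θ g : Vec d) : Set X :=
  {x | ∃ w, θ = D.θhat x w ∧ D.IsSSOSP x w θ ∧ g = gradient (D.perturbedLoss x w) θ}

/-- The unnormalized plug-in conditional density `p_θ(· | θ, g)`. -/
def unnormDensity (θ g : Vec d) : X → ℝ :=
  (D.feasibleSet θ g).indicator fun x =>
    D.f x θ * Real.exp (-(‖g - gradient (D.loss x) θ‖ ^ 2 / (2 * D.σ ^ 2 / d))) *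
      (suppSubmatrix θ (hessian (D.loss x) θ)).det

/-- The total mass of the unnormalized density. -/
def normConst (θ g : Vec d) : ℝ≥0∞ :=
  ∫⁻ x, ENNReal.ofReal (D.unnormDensity θ g x) ∂D.base

/-- The distribution `p_θ(· | θ, g)`, meaningful when `0 < normConst θ g < ∞`. -/
def condLaw (θ g : Vec d) : Measure X :=
  (D.normConst θ g)⁻¹ • D.base.withDensity fun x => ENNReal.ofReal (D.unnormDensity θ g x)

/-- The requirement on the sampling mechanism `P̃_M(· ; x, θ, g)`: whenever `p_θ(· | θ, g)` is well
defined, `X ~ p_θ(· | θ, g)` and `X̃ | X ~ P̃_M(· ; X, θ, g)` make `(X, X̃)` exchangeable. -/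
def ValidSampler {M : ℕ} (κ : Kernel (X × Vec d × Vec d) (Fin M → X)) : Prop :=
  ∀ θ ∈ D.Θ, ∀ g, D.normConst θ g ≠ 0 → D.normConst θ g ≠ ∞ →
    IsExchangeableLaw ((D.condLaw θ g).bind fun x => consLaw x (κ (x, θ, g)))

open Classical in
/-- Conditional law of the copies given the data `x` and the noise `w`: a draw from
`P̃_M(· ; x, θ̂, ĝ)` if the solver returned an SSOSP, and `M` repetitions of `x` otherwise. -/
def copyLaw {M : ℕ} (κ : Kernel (X × Vec d × Vec d) (Fin M → X)) (x : X) (w : Vec d) :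
    Measure (Fin M → X) :=
  if D.IsSSOSP x w (D.θhat x w) then κ (x, D.θhat x w, D.ghat x w)
  else Measure.dirac fun _ => x

/-- The joint law of `(X, W)`, with `X ~ P_{θ₀}` and `W ~ N(0, (1/d) I_d)` independent. -/
def dataLaw (θ₀ : Vec d) : Measure (X × Vec d) := (D.P θ₀).prod (noiseLaw d)

/-- The joint law of `(X, X̃⁽¹⁾, …, X̃⁽ᴹ⁾)` produced by the procedure when `X ~ P_{θ₀}`. -/
def acssLaw {M : ℕ} (κ : Kernel (X × Vec d × Vec d) (Fin M → X)) (θ₀ : Vec d) :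
    Measure (Fin (M + 1) → X) :=
  (D.dataLaw θ₀).bind fun q => consLaw q.1 (D.copyLaw κ q.1 q.2)

/-- With probability at least `1 - δ`, the solver returns an SSOSP within distance `r` of `θ₀`. -/
def AccurateSSOSP (θ₀ : Vec d) (r δ : ℝ) : Prop :=
  1 - δ ≤ (D.dataLaw θ₀).real
    {q | D.IsSSOSP q.1 q.2 (D.θhat q.1 q.2) ∧ ‖D.θhat q.1 q.2 - θ₀‖ ≤ r}

/-- `H(θ; x) = -∇²_θ log f(x; θ)`. -/
def hessNLL (θ : Vec d) (x : X) : Matrix (Fin d) (Fin d) ℝ :=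
  hessian (fun η => -Real.log (D.f x η)) θ

/-- `H(θ) = E_{θ₀}[H(θ; X)]`, entrywise. -/
def meanHess (θ₀ θ : Vec d) : Matrix (Fin d) (Fin d) ℝ :=
  Matrix.of fun i j => ∫ x, D.hessNLL θ x i j ∂(D.P θ₀)

/-- Concentration of the Hessian on the closed ball of radius `r` about `θ₀`. The expectations are
those of `[0, ∞]`-valued functions, and `log E ≤ ε` is written `E ≤ exp ε`. -/
structure HessianConcentration (θ₀ : Vec d) (r ε : ℝ) : Prop where
  integrable : ∀ θ ∈ Metric.closedBall θ₀ r ∩ D.Θ, ∀ i j,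
    Integrable (fun x => D.hessNLL θ x i j) (D.P θ₀)
  lower : ∫⁻ x, ⨆ θ ∈ Metric.closedBall θ₀ r ∩ D.Θ,
      ENNReal.ofReal (r ^ 2 * max (lambdaMax (D.meanHess θ₀ θ - D.hessNLL θ x)) 0) ∂(D.P θ₀)
    ≤ ENNReal.ofReal ε
  upper : ∫⁻ x, ⨆ θ ∈ Metric.closedBall θ₀ r ∩ D.Θ,
      ENNReal.ofReal
        (Real.exp (r ^ 2 * max (lambdaMax (D.hessNLL θ x - D.meanHess θ₀ θ)) 0)) ∂(D.P θ₀)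
    ≤ ENNReal.ofReal (Real.exp ε)

end PenalizedModel

/-- The Gaussian linear model `X ~ N(Zθ, ν² I_n)`, `θ ∈ ℝ^d`, with its Lebesgue density. -/
def gaussianModel {n d : ℕ} (Z : Matrix (Fin n) (Fin d) ℝ) (ν : ℝ) (R : Vec d → ℝ) (σ lam : ℝ)
    (θhat : Vec n → Vec d → Vec d) : PenalizedModel d (Vec n) where
  base := volume
  Θ := Set.univ
  f x θ := (√(2 * Real.pi * ν ^ 2))⁻¹ ^ n *
    Real.exp (-(‖x - WithLp.toLp 2 (Z.mulVec θ.ofLp)‖ ^ 2 / (2 * ν ^ 2)))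
  R := R
  σ := σ
  lam := lam
  θhat := θhat

end

open MeasureTheory ProbabilityTheory Set
open scoped ENNReal

noncomputable section

/-! Change of variables. At a stationary point θ with support S the pair (θ, g) has d free
coordinates: θ on S and g off S, since g on S must be -λ times the signs of θ. For fixed x the noise
is recovered as w = σ⁻¹(g - ∇𝓛(θ; x)), and the map from these coordinates to w has Jacobian σ⁻ᵈ det
∇²𝓛(θ; x)_S in absolute value. Summing the change of variables over all S gives the joint law of (X,
θ̂, ĝ) on the SSOSP event (`setLIntegral_dataLaw`): at fixed (θ, g), the density of X is
proportional to f(x; θ₀)/f(x; θ) · p_θ(x | θ, g).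

Tilting. Weight the joint law by τ = f(X; θ̂)/f(X; θ₀) · exp k(θ̂, ĝ). For every function k, the
conditional law of X becomes exactly p_θ(· | θ, g), so the sampler makes the tilted law exchangeable
(`setLIntegral_tilt_permute`). Comparing the two laws, with Z the tilted mass of the good event E
plus the probability of its complement, bounds the error by the integral of (1 - τ/Z)₊ over E plus
P(Eᶜ) (`errorBound_of_tilt`). It remains to choose k so that τ is nearly constant.

General and sparse models. Expand 𝓛(·; X) at θ̂ up to θ₀ and write ∇𝓛(θ̂; X) = ĝ - σW. The function
k absorbs the term in ĝ, the regularizer and the mean of the second-order remainder, because all of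
these depend on (θ̂, ĝ) only. What is left is τ = exp(centred remainder - σ⟨W, θ₀ - θ̂⟩)
(`tilt_taylorExponent`). The remainder is controlled by concentration of the Hessian, with a factor
1/2 from Taylor's formula. The inner product is at most r N(W) for a seminorm N: the Euclidean norm
in general, the largest norm of a projection onto a k-sparse span in the sparse case. If η² bounds E
N(W)², then E exp(σrN(W)) ≤ exp(2σrη) as long as σrη ≤ 1/3 (`lintegral_exp_seminorm_le`); this
follows from moment bounds obtained from the rotation invariance of Gaussian measures. Bounding Z
costs 2σrη + ε/2 and the remaining expectation costs σrη + ε/2, which adds up to 3σrη + ε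
(`errorBound_of_seminorm`).

Gaussian linear model. The Hessian does not depend on x, and strict convexity makes the feasible set
all of the sample space or empty. At fixed (θ, g) the density of X is therefore a Gaussian weight
exp(-q), and replacing θ₀ by θ changes q by an affine function, that is, translates the weight up to
a constant. With k removing that constant (`tilt_shiftExponent`), the error is the total variation
distance between a Gaussian and its translate. A Hellinger estimate bounds it by half the
Mahalanobis length of the translation (`lintegral_exp_sub_shift_le`), which is at most σr/√d
(`shift_norm_le`). -/

/-! ### Exchangeability and p-values -/

section Exchangeability

variable {X : Type*} {M : ℕ}

open Classical in
/-- The normalized rank of the `i`-th coordinate, counted from the largest. -/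
def rankFraction (T : X → ℝ) (z : Fin (M + 1) → X) (i : Fin (M + 1)) : ℝ :=
  (1 / ((M : ℝ) + 1)) * ((Finset.univ.filter fun j => T (z i) ≤ T (z j)).card : ℝ)

lemma rankFraction_zero (T : X → ℝ) (z : Fin (M + 1) → X) : rankFraction T z 0 = pval T z := by
  classical
  simp only [rankFraction, pval]
  congr 1
  rw [Finset.card_filter, Fin.sum_univ_succ]
  simp only [le_refl, ↓reduceIte]
  push_cast
  congr 1

lemma rankFraction_comp_perm (T : X → ℝ) (z : Fin (M + 1) → X) (π : Equiv.Perm (Fin (M + 1)))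
    (i : Fin (M + 1)) : rankFraction T (fun j => z (π j)) i = rankFraction T z (π i) := by
  classical
  simp only [rankFraction]
  congr 2
  refine Finset.card_bij (fun j _ => π j) ?_ ?_ ?_
  · intro j hj; simpa using hj
  · intro a _ b _ h; exact π.injective h
  · intro b hb
    exact ⟨π.symm b, by simpa using hb, by simp⟩

/-- Among the indices whose rank fraction is at most α, take one with the smallest value of T. All
the others have values at least as large, so they are counted in its rank, which is at most α(M +
1). Ties do no harm. -/
lemma card_rankFraction_le (T : X → ℝ) (z : Fin (M + 1) → X) {α : ℝ} (hα : 0 ≤ α)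
    [DecidablePred fun i => rankFraction T z i ≤ α] :
    ((Finset.univ.filter fun i => rankFraction T z i ≤ α).card : ℝ) ≤ α * (M + 1) := by
  classical
  set I := Finset.univ.filter fun i => rankFraction T z i ≤ α with hI
  rcases I.eq_empty_or_nonempty with h | h
  · rw [h]; simp; positivity
  · obtain ⟨i, hi, hmin⟩ := I.exists_min_image (fun i => T (z i)) h
    have hle : rankFraction T z i ≤ α := by simpa [hI] using hi
    have hsub : I ⊆ Finset.univ.filter fun j => T (z i) ≤ T (z j) := by
      intro j hj; simpa using hmin j hj
    have hc : (I.card : ℝ) ≤ ((Finset.univ.filter fun j => T (z i) ≤ T (z j)).card : ℝ) := by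
      exact_mod_cast Finset.card_le_card hsub
    have hM : (0 : ℝ) < (M : ℝ) + 1 := by positivity
    simp only [rankFraction] at hle
    rw [one_div, inv_mul_le_iff₀ hM] at hle
    refine hc.trans (le_trans (le_of_eq ?_) (hle.trans_eq (mul_comm _ _)))
    congr!

variable [MeasurableSpace X]

lemma measurable_rankFraction {T : X → ℝ} (hT : Measurable T) (i : Fin (M + 1)) :
    Measurable fun z : Fin (M + 1) → X => rankFraction T z i := by
  classical
  simp only [rankFraction, Finset.card_filter]
  push_cast
  refine Measurable.const_mul (Finset.measurable_sum _ fun j _ => ?_) _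
  exact Measurable.ite (measurableSet_le (by fun_prop) (by fun_prop)) measurable_const
    measurable_const

/-- The p-value of an exchangeable vector is super-uniform. -/
lemma IsExchangeableLaw.measureReal_pval_le {ρ : Measure (Fin (M + 1) → X)}
    [IsProbabilityMeasure ρ] (hρ : IsExchangeableLaw ρ) {T : X → ℝ} (hT : Measurable T) {α : ℝ}
    (hα : 0 ≤ α) : ρ.real {z | pval T z ≤ α} ≤ α := by
  classical
  have hms : ∀ i, MeasurableSet {z : Fin (M + 1) → X | rankFraction T z i ≤ α} := fun i =>
    measurableSet_le (measurable_rankFraction hT i) measurable_const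
  have heq : ∀ i, ρ.real {z | rankFraction T z i ≤ α} = ρ.real {z | pval T z ≤ α} := by
    intro i
    -- Swapping coordinates 0 and i shows that all rank fractions have the law of the p-value; the
    -- pointwise count then gives (M + 1) P(pval ≤ α) ≤ α(M + 1).
    have h := hρ (Equiv.swap 0 i)
    have hm : Measurable fun (z : Fin (M + 1) → X) (j : Fin (M + 1)) =>
        z ((Equiv.swap 0 i) j) := measurable_pi_lambda _ fun j => measurable_pi_apply _
    rw [← h]
    simp only [← rankFraction_zero]
    rw [map_measureReal_apply hm (hms 0), h]
    simp only [preimage_ofPred_eq, rankFraction_comp_perm, Equiv.swap_apply_left]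
  have hsum : ∑ i : Fin (M + 1), ρ.real {z | rankFraction T z i ≤ α} ≤ α * (M + 1) := by
    have h1 : ∀ i : Fin (M + 1), ρ.real {z | rankFraction T z i ≤ α}
        = ∫ z, {z | rankFraction T z i ≤ α}.indicator (fun _ => (1 : ℝ)) z ∂ρ := by
      intro i; rw [integral_indicator (hms i)]; simp
    simp_rw [h1]
    rw [← integral_finsetSum]
    · calc _ ≤ ∫ _z, α * ((M : ℝ) + 1) ∂ρ := by
            refine integral_mono_of_nonneg (.of_forall fun z => ?_) (integrable_const _)
              (.of_forall fun z => ?_)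
            · exact Finset.sum_nonneg fun i _ => indicator_nonneg (by simp) _
            · refine le_trans (le_of_eq ?_) (card_rankFraction_le T z hα)
              rw [Finset.card_filter]
              push_cast
              refine Finset.sum_congr rfl fun i _ => ?_
              simp [indicator_apply]
        _ = _ := by simp
    · intro i _
      exact (integrable_const _).indicator (hms i)
  simp only [heq, Finset.sum_const, Finset.card_univ, Fintype.card_fin, nsmul_eq_mul] at hsum
  push_cast at hsum
  have hM : (0 : ℝ) < (M : ℝ) + 1 := by positivity
  nlinarith

/-- Applying the one-sided inequality to the complement of A gives the other side, because both
measures have mass one. -/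
lemma tvDistance_le {Y : Type*} [MeasurableSpace Y] {μ ρ : Measure Y} [IsProbabilityMeasure μ]
    [IsProbabilityMeasure ρ] {B : ℝ} (h : ∀ A, MeasurableSet A → μ.real A ≤ ρ.real A + B) :
    tvDistance μ ρ ≤ B := by
  have : Nonempty {A : Set Y // MeasurableSet A} := ⟨⟨∅, MeasurableSet.empty⟩⟩
  refine ciSup_le fun A => ?_
  have h1 := h A.1 A.2
  have h2 := h A.1ᶜ A.2.compl
  rw [probReal_compl_eq_one_sub A.2, probReal_compl_eq_one_sub A.2] at h2
  rw [abs_le]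
  constructor <;> linarith

lemma tvDistance_nonneg {Y : Type*} [MeasurableSpace Y] (μ ρ : Measure Y) :
    0 ≤ tvDistance μ ρ :=
  Real.iSup_nonneg fun _ => abs_nonneg _

/-- One-sided closeness to some exchangeable law gives the error bound. -/
lemma errorBound_of_exchangeable {μ ρ : Measure (Fin (M + 1) → X)} [IsProbabilityMeasure μ]
    [IsProbabilityMeasure ρ] (hρ : IsExchangeableLaw ρ) {B : ℝ}
    (h : ∀ A, MeasurableSet A → μ.real A ≤ ρ.real A + B) : ErrorBound μ B := by
  refine ⟨(ciInf_le ⟨0, ?_⟩ ⟨ρ, inferInstance, hρ⟩).trans (tvDistance_le h), ?_⟩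
  · rintro _ ⟨ρ', rfl⟩
    exact tvDistance_nonneg _ _
  · intro T hT α hα
    have hm : MeasurableSet {z : Fin (M + 1) → X | pval T z ≤ α} := by
      simp only [← rankFraction_zero]
      exact measurableSet_le (measurable_rankFraction hT 0) measurable_const
    linarith [h _ hm, hρ.measureReal_pval_le hT hα.1]

lemma isExchangeableLaw_dirac_const {k : ℕ} (x : X) :
    IsExchangeableLaw (Measure.dirac (fun _ : Fin k => x)) := by
  intro π
  exact Measure.map_dirac' (measurable_pi_lambda _ fun j => measurable_pi_apply _) _

/-- A point mass at a constant vector is exchangeable, and any law is within 1 of it. This disposes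
of the regime where the claimed bound is vacuous. -/
lemma ErrorBound.of_one_le {μ : Measure (Fin (M + 1) → X)} [IsProbabilityMeasure μ] {B : ℝ}
    (hB : 1 ≤ B) : ErrorBound μ B := by
  obtain ⟨z, -⟩ := nonempty_of_measure_ne_zero
    (show μ univ ≠ 0 by simp)
  refine errorBound_of_exchangeable (isExchangeableLaw_dirac_const (z 0)) fun A _ => ?_
  linarith [measureReal_le_one (μ := μ) (s := A),
    measureReal_nonneg (μ := Measure.dirac (fun _ : Fin (M + 1) => z 0)) (s := A)]

end Exchangeability

/-! ### Moments of seminorms of Gaussian vectors -/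

section GaussianSeminorm

variable {E : Type*} [NormedAddCommGroup E] [NormedSpace ℝ E] [MeasurableSpace E] [BorelSpace E]
  [SecondCountableTopology E] [CompleteSpace E] {μ : Measure E} [IsGaussian μ] {N : Seminorm ℝ E}

lemma integrable_seminorm_pow (hN : Continuous N) (k : ℕ) :
    Integrable (fun z => N z ^ k) μ := by
  obtain ⟨C, hC0, hC⟩ := N.bound_of_continuous_normedSpace hN
  have h : Integrable (fun z : E => ‖z‖ ^ k) μ :=
    (IsGaussian.memLp_id μ k (by simp)).integrable_norm_pow'
  refine (h.const_mul (C ^ k)).mono' (by fun_prop) (.of_forall fun z => ?_)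
  rw [Real.norm_of_nonneg (pow_nonneg (apply_nonneg N z) k), ← mul_pow]
  exact pow_le_pow_left₀ (apply_nonneg N z) (hC z) k

/-- Recursive inequality for the moments of a seminorm of a centered Gaussian vector, from the
invariance of `μ ⊗ μ` under rotation by `π / 4`. -/
lemma two_mul_moment_le (hμ : ∀ L : StrongDual ℝ E, ∫ z, L z ∂μ = 0) (hN : Continuous N) (k : ℕ) :
    2 * ∫ z, N z ^ (k + 1) ∂μ ≤ ((√2 ^ (k + 1))⁻¹ *
      ∑ j ∈ Finset.range (k + 1 + 1), (∫ z, N z ^ j ∂μ) * (∫ z, N z ^ (k + 1 - j) ∂μ) *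
        ((k + 1).choose j : ℝ)) + (∫ z, N z ∂μ) * ∫ z, N z ^ k ∂μ := by
  have hint := integrable_seminorm_pow (μ := μ) hN
  have hrot := IsGaussian.map_rotation_eq_self_of_forall_strongDual_eq_zero hμ (Real.pi / 4)
  set G : E × E → ℝ := fun p => ((√2)⁻¹ * (N p.1 + N p.2)) ^ (k + 1) with hG
  have hGexp : ∀ p, G p = (√2 ^ (k + 1))⁻¹ * ∑ j ∈ Finset.range (k + 1 + 1),
      N p.1 ^ j * N p.2 ^ (k + 1 - j) * ((k + 1).choose j : ℝ) := by
    intro p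
    rw [hG]; simp only; rw [mul_pow, add_pow, inv_pow]
  have hGi : Integrable G (μ.prod μ) := by
    rw [show G = _ from funext hGexp]
    refine Integrable.const_mul (integrable_finsetSum _ fun j _ => ?_) _
    exact ((hint j).mul_prod (hint _)).mul_const _
  have hGint : ∫ p, G p ∂(μ.prod μ) = (√2 ^ (k + 1))⁻¹ *
      ∑ j ∈ Finset.range (k + 1 + 1), (∫ z, N z ^ j ∂μ) * (∫ z, N z ^ (k + 1 - j) ∂μ) *
        ((k + 1).choose j : ℝ) := by
    simp_rw [hGexp]
    rw [integral_const_mul, integral_finsetSum]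
    · congr 1
      refine Finset.sum_congr rfl fun j _ => ?_
      rw [integral_mul_const, integral_prod_mul (fun z => N z ^ j) fun z => N z ^ (k + 1 - j)]
    · intro j _
      exact ((hint j).mul_prod (hint _)).mul_const _
  have hcont : Continuous G := by fun_prop
  have hGi' : Integrable (fun p => G (ContinuousLinearMap.rotation (Real.pi / 4) p))
      (μ.prod μ) := by
    rw [← hrot] at hGi
    exact hGi.comp_measurable (ContinuousLinearMap.continuous _).measurable
  have hGr : ∫ p, G p ∂(μ.prod μ)
      = ∫ p, G (ContinuousLinearMap.rotation (Real.pi / 4) p) ∂(μ.prod μ) := by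
    conv_lhs => rw [← hrot]
    rw [integral_map (ContinuousLinearMap.continuous _).measurable.aemeasurable
      hcont.aestronglyMeasurable]
  have hs : (√2)⁻¹ * (√2)⁻¹ = (1 / 2 : ℝ) := by
    rw [← mul_inv, Real.mul_self_sqrt (by norm_num)]; norm_num
  have hs2 : √2 / 2 = (√2)⁻¹ := by
    rw [eq_comm, inv_eq_iff_eq_inv, inv_div, eq_div_iff (by positivity)]
    exact Real.mul_self_sqrt (by norm_num)
  have hrotval : ∀ p : E × E, G (ContinuousLinearMap.rotation (Real.pi / 4) p)
      = ((N (p.1 + p.2) + N (p.2 - p.1)) / 2) ^ (k + 1) := by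
    intro p
    simp only [hG, ContinuousLinearMap.rotation_apply, Real.cos_pi_div_four, Real.sin_pi_div_four,
      hs2]
    rw [← smul_add, neg_smul, neg_add_eq_sub, ← smul_sub, map_smul_eq_mul, map_smul_eq_mul,
      Real.norm_of_nonneg (by positivity), ← mul_add, ← mul_assoc, hs]
    congr 1; ring
  -- With a = N p.1 and b = N p.2, the left side is max(a, b)^(k+1) + min(a, b)^(k+1). The triangle
  -- inequality puts both a and b below the mean of N(p.1 + p.2) and N(p.2 - p.1), which handles the
  -- maximum. The minimum is bounded by a · bᵏ, whose expectation factorizes by independence.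
  have hmax : ∀ p : E × E, N p.1 ^ (k + 1) + N p.2 ^ (k + 1)
      ≤ G (ContinuousLinearMap.rotation (Real.pi / 4) p) + N p.1 * N p.2 ^ k := by
    intro p
    rw [hrotval]
    have h1 : N p.1 ≤ (N (p.1 + p.2) + N (p.2 - p.1)) / 2 := by
      have := map_sub_le_add N (p.1 + p.2) (p.2 - p.1)
      rw [show p.1 + p.2 - (p.2 - p.1) = (2 : ℝ) • p.1 by rw [two_smul]; abel,
        map_smul_eq_mul] at this
      norm_num at this; linarith
    have h2 : N p.2 ≤ (N (p.1 + p.2) + N (p.2 - p.1)) / 2 := by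
      have := map_add_le_add N (p.1 + p.2) (p.2 - p.1)
      rw [show p.1 + p.2 + (p.2 - p.1) = (2 : ℝ) • p.2 by rw [two_smul]; abel,
        map_smul_eq_mul] at this
      norm_num at this; linarith
    have h1' := pow_le_pow_left₀ (apply_nonneg N p.1) h1 (k + 1)
    have h2' := pow_le_pow_left₀ (apply_nonneg N p.2) h2 (k + 1)
    rcases le_total (N p.1) (N p.2) with h | h
    · have := mul_le_mul_of_nonneg_left (pow_le_pow_left₀ (apply_nonneg N p.1) h k)
        (apply_nonneg N p.1)
      rw [← pow_succ'] at this
      linarith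
    · have := mul_le_mul_of_nonneg_right h (pow_nonneg (apply_nonneg N p.2) k)
      rw [← pow_succ'] at this
      linarith
  have hm := integral_mono
    ((((hint (k + 1)).comp_fst μ).add ((hint (k + 1)).comp_snd μ)))
    (hGi'.add ((hint 1).mul_prod (hint k) |>.congr (.of_forall fun p => by simp))) hmax
  have e1 : ∫ p : E × E, N p.1 ^ (k + 1) + N p.2 ^ (k + 1) ∂(μ.prod μ)
      = 2 * ∫ z, N z ^ (k + 1) ∂μ := by
    rw [integral_add ((hint (k + 1)).comp_fst μ) ((hint (k + 1)).comp_snd μ),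
      integral_fun_fst (fun z => N z ^ (k + 1)), integral_fun_snd (fun z => N z ^ (k + 1))]
    simp; ring
  have e2 : ∫ p : E × E, G (ContinuousLinearMap.rotation (Real.pi / 4) p) + N p.1 * N p.2 ^ k
      ∂(μ.prod μ) = ∫ p, G p ∂(μ.prod μ) + (∫ z, N z ∂μ) * ∫ z, N z ^ k ∂μ := by
    rw [integral_add hGi' ((hint 1).mul_prod (hint k) |>.congr (.of_forall fun p => by simp)),
      ← hGr, integral_prod_mul (fun z => N z) fun z => N z ^ k]
  rw [← hGint, ← e1, ← e2]
  exact hm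

/-- The variance of N is nonnegative. -/
lemma moment_one_le (hN : Continuous N) {η : ℝ} (hη : 0 ≤ η) (h2 : ∫ z, N z ^ 2 ∂μ ≤ η ^ 2) :
    ∫ z, N z ∂μ ≤ η := by
  have hi1 : Integrable (fun z => N z) μ := by
    simpa using integrable_seminorm_pow (μ := μ) hN 1
  have hi2 := integrable_seminorm_pow (μ := μ) hN 2
  set m := ∫ z, N z ∂μ with hm
  have h : 0 ≤ ∫ z, (N z - m) ^ 2 ∂μ := integral_nonneg fun z => sq_nonneg _
  have e : ∫ z, (N z - m) ^ 2 ∂μ = ∫ z, N z ^ 2 ∂μ - m ^ 2 := by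
    have : ∀ z, (N z - m) ^ 2 = N z ^ 2 - 2 * m * N z + m ^ 2 := fun z => by ring
    simp_rw [this]
    rw [integral_add (f := fun z => N z ^ 2 - 2 * m * N z) (hi2.sub (hi1.const_mul _))
      (integrable_const _), integral_sub hi2 (hi1.const_mul _), integral_const_mul, ← hm]
    simp; ring
  exact le_of_sq_le_sq (by linarith) hη

/-- Numerical input for the moment induction, which closes at order k + 3 exactly when (k + 4)/√2^(k
+ 3) ≤ 5/3. -/
lemma three_fifths_mul_le_sqrt_two_pow (k : ℕ) : (3 / 5 : ℝ) * (k + 4) ≤ √2 ^ (k + 3) := by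
  have hs : (7 / 5 : ℝ) ≤ √2 := Real.le_sqrt_of_sq_le (by norm_num)
  induction k with
  | zero =>
    have h2 : √2 ^ 2 = (2 : ℝ) := Real.sq_sqrt (by norm_num)
    calc (3 / 5 : ℝ) * ((0 : ℕ) + 4) ≤ 2 * (7 / 5) := by norm_num
      _ ≤ √2 ^ 2 * √2 := by rw [h2]; linarith
      _ = √2 ^ (0 + 3) := by ring
  | succ k ih =>
    have hk : (0 : ℝ) ≤ k := k.cast_nonneg
    calc (3 / 5 : ℝ) * ((k + 1 : ℕ) + 4) ≤ (3 / 5 * (k + 4)) * (7 / 5) := by push_cast; linarith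
      _ ≤ √2 ^ (k + 3) * √2 := by gcongr
      _ = √2 ^ (k + 1 + 3) := by ring

/-- The moments of a seminorm of a centered Gaussian vector grow at most factorially, with rate
given by the second moment. -/
lemma moment_le_factorial (hμ : ∀ L : StrongDual ℝ E, ∫ z, L z ∂μ = 0) (hN : Continuous N) {η : ℝ}
    (hη : 0 ≤ η) (h2 : ∫ z, N z ^ 2 ∂μ ≤ η ^ 2) (k : ℕ) :
    ∫ z, N z ^ k ∂μ ≤ (k.factorial : ℝ) * η ^ k := by
  have h1 := moment_one_le hN hη h2
  have hpos : ∀ k, 0 ≤ ∫ z, N z ^ k ∂μ := fun k =>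
    integral_nonneg fun z => pow_nonneg (apply_nonneg N z) k
  induction k using Nat.strong_induction_on with
  | _ k ih =>
  match k, ih with
  | 0, _ => simp
  | 1, _ => simpa using h1
  | 2, _ => simp only [Nat.factorial]; push_cast; nlinarith [sq_nonneg η]
  | k + 3, ih =>
    have hstep := two_mul_moment_le hμ hN (k + 2)
    set m : ℕ → ℝ := fun j => ∫ z, N z ^ j ∂μ with hm
    set K : ℝ := ((k + 3).factorial : ℝ) * η ^ (k + 3) with hK
    have hK0 : 0 ≤ K := by positivity
    -- The two extreme terms of the binomial sum contain the unknown moment itself. For each of the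
    -- k + 2 middle terms the induction hypothesis applies to both factors, and the binomial
    -- coefficient turns the product of factorials into (k + 3)!.
    have hsum : ∑ j ∈ Finset.range (k + 2 + 1 + 1), m j * m (k + 2 + 1 - j) *
        ((k + 2 + 1).choose j : ℝ) ≤ 2 * m (k + 3) + (k + 2) * K := by
      rw [Finset.sum_range_succ, Finset.sum_range_succ']
      have hmid : ∑ j ∈ Finset.range (k + 2), m (j + 1) * m (k + 2 + 1 - (j + 1)) *
          ((k + 2 + 1).choose (j + 1) : ℝ) ≤ ∑ _j ∈ Finset.range (k + 2), K := by
        refine Finset.sum_le_sum fun j hj => ?_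
        have hj' := Finset.mem_range.1 hj
        have ha := ih (j + 1) (by omega)
        have hb := ih (k + 2 + 1 - (j + 1)) (by omega)
        calc _ ≤ ((j + 1).factorial * η ^ (j + 1)) * ((k + 2 + 1 - (j + 1)).factorial *
              η ^ (k + 2 + 1 - (j + 1))) * ((k + 2 + 1).choose (j + 1) : ℝ) := by
              gcongr
          _ = (((k + 2 + 1).choose (j + 1) * (j + 1).factorial *
              (k + 2 + 1 - (j + 1)).factorial : ℕ) : ℝ) *
              (η ^ (j + 1) * η ^ (k + 2 + 1 - (j + 1))) := by push_cast; ring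
          _ = K := by
              rw [Nat.choose_mul_factorial_mul_factorial (by omega), ← pow_add,
                show j + 1 + (k + 2 + 1 - (j + 1)) = k + 3 by omega]
      have h0 : m 0 = 1 := by simp [hm]
      rw [Finset.sum_const, Finset.card_range, nsmul_eq_mul] at hmid
      simp only [Nat.sub_zero, Nat.sub_self, Nat.choose_zero_right, Nat.choose_self, h0,
        Nat.cast_one, mul_one, one_mul]
      simp only [Nat.cast_add, Nat.cast_ofNat] at hmid
      have e : m (k + 2 + 1) = m (k + 3) := rfl
      linarith
    have hs := three_fifths_mul_le_sqrt_two_pow k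
    set s : ℝ := (√2 ^ (k + 2 + 1))⁻¹ with hsdef
    have hs0 : 0 < s := by positivity
    have hsb : s * (k + 4) ≤ 5 / 3 := by
      rw [hsdef, inv_mul_le_iff₀ (by positivity)]; linarith
    have hprod : (∫ z, N z ∂μ) * m (k + 2) ≤ K / (k + 3) := by
      have := ih (k + 2) (by omega)
      calc _ ≤ η * ((k + 2).factorial * η ^ (k + 2)) := by gcongr
        _ = K / (k + 3) := by
          rw [hK, Nat.factorial_succ (k + 2)]; push_cast; field_simp; ring
    have hK3 : K / (k + 3) ≤ K / 3 := by gcongr; linarith [k.cast_nonneg (α := ℝ)]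
    have hfin : 2 * m (k + 3) ≤ s * (2 * m (k + 3) + (k + 2) * K) + K / 3 := by
      refine hstep.trans (add_le_add (mul_le_mul_of_nonneg_left hsum hs0.le) (hprod.trans hK3))
    have hs1 : s * 4 ≤ 5 / 3 := by
      refine le_trans ?_ hsb
      gcongr; linarith [k.cast_nonneg (α := ℝ)]
    -- Moving the unknown moment to the left leaves the coefficient s(k + 2) + 1/3 in front of K; it
    -- is at most 2 - 2s precisely because s(k + 4) ≤ 5/3.
    have hlin : (2 - 2 * s) * m (k + 3) ≤ (2 - 2 * s) * K := by
      have := mul_le_mul_of_nonneg_right hsb hK0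
      nlinarith
    exact le_of_mul_le_mul_left hlin (by linarith)

/-- Exponential moments of a seminorm of a centered Gaussian vector. -/
lemma lintegral_exp_seminorm_le (hμ : ∀ L : StrongDual ℝ E, ∫ z, L z ∂μ = 0) (hN : Continuous N)
    {η : ℝ} (hη : 0 ≤ η) (h2 : ∫ z, N z ^ 2 ∂μ ≤ η ^ 2) {t : ℝ} (ht : 0 ≤ t) (htη : t * η ≤ 1 / 3) :
    ∫⁻ z, ENNReal.ofReal (Real.exp (t * N z)) ∂μ ≤ ENNReal.ofReal (Real.exp (2 * (t * η))) := by
  have hexp : ∀ z, ENNReal.ofReal (Real.exp (t * N z))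
      = ∑' k : ℕ, ENNReal.ofReal ((t * N z) ^ k / k.factorial) := by
    intro z
    have h0 : 0 ≤ t * N z := mul_nonneg ht (apply_nonneg N z)
    have hs := NormedSpace.expSeries_div_hasSum_exp (t * N z)
    rw [← Real.exp_eq_exp_ℝ] at hs
    rw [← hs.tsum_eq, ENNReal.ofReal_tsum_of_nonneg (fun k => by positivity) hs.summable]
  simp_rw [hexp]
  have hcN : Continuous N := hN
  rw [lintegral_tsum fun k => by fun_prop]
  have h0 : 0 ≤ t * η := mul_nonneg ht hη
  have hgeom := hasSum_geometric_of_lt_one h0 (by linarith)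
  -- The factorial in the moment bound cancels the one in the exponential series, which leaves a
  -- geometric series. Finally 1/(1 - y) ≤ 1 + 2y ≤ exp(2y) for 0 ≤ y ≤ 1/3.
  calc _ ≤ ∑' k : ℕ, ENNReal.ofReal ((t * η) ^ k) := by
        refine ENNReal.tsum_le_tsum fun k => ?_
        rw [← ofReal_integral_eq_lintegral_ofReal]
        · refine ENNReal.ofReal_le_ofReal ?_
          simp_rw [mul_pow, mul_div_assoc]
          rw [integral_const_mul, integral_div]
          refine mul_le_mul_of_nonneg_left ?_ (by positivity)
          rw [div_le_iff₀ (by positivity), mul_comm]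
          exact moment_le_factorial hμ hN hη h2 k
        · simp_rw [mul_pow]
          exact ((integrable_seminorm_pow hN k).const_mul _).div_const _
        · exact .of_forall fun z => div_nonneg
            (pow_nonneg (mul_nonneg ht (apply_nonneg N z)) k) (by positivity)
    _ = ENNReal.ofReal (1 - t * η)⁻¹ := by
        rw [← ENNReal.ofReal_tsum_of_nonneg (fun k => by positivity) hgeom.summable,
          hgeom.tsum_eq]
    _ ≤ _ := by
        refine ENNReal.ofReal_le_ofReal (le_trans ?_ (Real.add_one_le_exp _))
        rw [inv_le_iff_one_le_mul₀ (by linarith)]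
        nlinarith

end GaussianSeminorm

/-! ### The noise law -/

section Noise

variable {d : ℕ}

instance isProbabilityMeasure_noiseLaw : IsProbabilityMeasure (noiseLaw d) :=
  Measure.isProbabilityMeasure_map (by fun_prop)

lemma noiseLaw_eq_map_clm :
    noiseLaw d = (stdGaussian (Vec d)).map ((√(d : ℝ))⁻¹ • ContinuousLinearMap.id ℝ (Vec d)) := by
  rfl

instance isGaussian_noiseLaw : IsGaussian (noiseLaw d) := by
  rw [noiseLaw_eq_map_clm]; infer_instance

lemma integral_strongDual_noiseLaw (L : StrongDual ℝ (Vec d)) : ∫ z, L z ∂(noiseLaw d) = 0 := by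
  rw [noiseLaw, integral_map (by fun_prop) (by fun_prop)]
  simp only [map_smul, smul_eq_mul]
  rw [integral_const_mul, integral_strongDual_stdGaussian, mul_zero]

lemma integral_exp_neg_mul_sq_norm_pos {V : Type*} [NormedAddCommGroup V] [InnerProductSpace ℝ V]
    [FiniteDimensional ℝ V] [MeasurableSpace V] [BorelSpace V] {b : ℝ} (hb : 0 < b) :
    0 < ∫ v : V, Real.exp (-b * ‖v‖ ^ 2) := by
  rw [GaussianFourier.integral_rexp_neg_mul_sq_norm hb]
  exact Real.rpow_pos_of_pos (div_pos Real.pi_pos hb) _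

lemma integrable_exp_neg_mul_sq_norm {V : Type*} [NormedAddCommGroup V] [InnerProductSpace ℝ V]
    [FiniteDimensional ℝ V] [MeasurableSpace V] [BorelSpace V] {b : ℝ} (hb : 0 < b) :
    Integrable fun v : V => Real.exp (-b * ‖v‖ ^ 2) :=
  .of_integral_ne_zero (integral_exp_neg_mul_sq_norm_pos hb).ne'

/-- Both sides have the same characteristic function. The value of the constant is never needed: it
cancels in every later comparison of integrals. -/
lemma exists_noiseLaw_eq_withDensity (hd : 1 ≤ d) : ∃ c : ℝ, 0 < c ∧
    noiseLaw d = volume.withDensity fun w => ENNReal.ofReal (c * Real.exp (-(d / 2) * ‖w‖ ^ 2)) := by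
  have hb : (0 : ℝ) < d / 2 := by positivity
  have hpos := integral_exp_neg_mul_sq_norm_pos (V := Vec d) hb
  have hint := integrable_exp_neg_mul_sq_norm (V := Vec d) hb
  set I := ∫ v : Vec d, Real.exp (-(d / 2) * ‖v‖ ^ 2) with hI
  refine ⟨I⁻¹, inv_pos.2 hpos, ?_⟩
  have hfin : IsFiniteMeasure (volume.withDensity fun w : Vec d =>
      ENNReal.ofReal (I⁻¹ * Real.exp (-(d / 2) * ‖w‖ ^ 2))) :=
    isFiniteMeasure_withDensity_ofReal (hint.const_mul _).2
  refine Measure.ext_of_charFun (funext fun t => ?_)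
  rw [noiseLaw, charFun_map_smul, charFun_stdGaussian, charFun_apply,
    integral_withDensity_eq_integral_toReal_smul (by fun_prop) (.of_forall fun w => by simp)]
  have h1 : ∀ w : Vec d, (ENNReal.ofReal (I⁻¹ * Real.exp (-(d / 2) * ‖w‖ ^ 2))).toReal •
      Complex.exp (inner ℝ w t * Complex.I) = (I⁻¹ : ℂ) *
        Complex.exp (-((d / 2 : ℝ) : ℂ) * ‖w‖ ^ 2 + Complex.I * inner ℝ t w) := by
    intro w
    rw [ENNReal.toReal_ofReal (mul_nonneg (inv_nonneg.2 hpos.le) (Real.exp_nonneg _)),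
      Complex.exp_add, Complex.real_smul, real_inner_comm]
    push_cast
    rw [mul_comm Complex.I]
    ring
  simp_rw [h1]
  rw [integral_const_mul, GaussianFourier.integral_cexp_neg_mul_sq_norm_add (by simpa using hb)]
  have hIc : (I : ℂ) = (Real.pi / ((d / 2 : ℝ) : ℂ)) ^ (Module.finrank ℝ (Vec d) / 2 : ℂ) := by
    rw [hI, GaussianFourier.integral_rexp_neg_mul_sq_norm hb, Complex.ofReal_cpow (by positivity)]
    push_cast; rfl
  rw [← hIc, ← mul_assoc, inv_mul_cancel₀ (by exact_mod_cast hpos.ne'), one_mul]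
  congr 1
  rw [← Complex.ofReal_pow, norm_smul, mul_pow, Real.norm_of_nonneg (by positivity), inv_pow,
    Real.sq_sqrt (by positivity)]
  have hd' : (d : ℂ) ≠ 0 := by exact_mod_cast (by omega : d ≠ 0)
  push_cast
  rw [Complex.I_sq]
  field_simp
  ring

lemma integral_seminorm_sq_noiseLaw (N : Seminorm ℝ (Vec d)) (hN : Continuous N) :
    ∫ w, N w ^ 2 ∂(noiseLaw d) = (∫ z, N z ^ 2 ∂(stdGaussian (Vec d))) / d := by
  rw [noiseLaw, integral_map (by fun_prop) (by fun_prop)]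
  simp only [map_smul_eq_mul, mul_pow]
  rw [integral_const_mul, Real.norm_of_nonneg (by positivity), inv_pow, Real.sq_sqrt (by positivity)]
  ring

lemma integral_norm_sq_stdGaussian : ∫ z, ‖z‖ ^ 2 ∂(stdGaussian (Vec d)) = d := by
  have h : ∀ i : Fin d, ∫ z : Vec d, z i ^ 2 ∂(stdGaussian (Vec d)) = 1 := by
    intro i
    have hv := variance_dual_stdGaussian (E := Vec d) (innerSL ℝ (EuclideanSpace.single i (1 : ℝ)))
    rw [variance_of_integral_eq_zero (by fun_prop)
      (integral_strongDual_stdGaussian _)] at hv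
    simpa [EuclideanSpace.inner_single_left] using hv
  simp_rw [EuclideanSpace.norm_sq_eq, Real.norm_eq_abs, sq_abs]
  rw [integral_finsetSum]
  · simp [h]
  · intro i _
    refine .of_integral_ne_zero (by rw [h]; simp)

end Noise

/-! ### Joint measurability -/

section JointMeasurability

open Filter Topology

variable {d : ℕ} {X Y : Type*} [MeasurableSpace X] [MeasurableSpace Y]

/-- Carathéodory functions on an open set of parameters, extended by zero, are jointly
measurable. -/
lemma measurable_indicator_of_continuousOn {Θ : Set (Vec d)} (hΘ : MeasurableSet Θ)
    {F : X → Vec d → ℝ} (hm : ∀ θ ∈ Θ, Measurable fun x => F x θ)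
    (hc : ∀ x, ContinuousOn (F x) Θ) :
    Measurable fun p : X × Vec d => Θ.indicator (F p.1) p.2 := by
  have h1 : Measurable (Function.uncurry fun (θ : Θ) x => F x θ) :=
    measurable_uncurry_of_continuous_of_measurable
      (fun x => (hc x).domRestrict) fun θ => hm θ θ.2
  have hs : MeasurableSet {p : X × Vec d | p.2 ∈ Θ} := measurable_snd hΘ
  refine measurable_of_restrict_of_restrict_compl hs ?_ ?_
  · have h2 : Measurable fun p : {p : X × Vec d | p.2 ∈ Θ} =>
        ((⟨p.1.2, p.2⟩ : Θ), p.1.1) := by fun_prop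
    convert h1.comp h2 using 1
    ext p
    exact indicator_of_mem (s := Θ) (f := F p.1.1) p.2
  · convert measurable_const (a := (0 : ℝ)) using 1
    ext p
    exact indicator_of_notMem (s := Θ) (f := F p.1.1) p.2

/-- Directional derivatives in the parameter are jointly measurable. -/
lemma measurable_indicator_fderiv {Θ : Set (Vec d)} (hΘ : IsOpen Θ) {F : X → Vec d → ℝ}
    (hm : Measurable fun p : X × Vec d => Θ.indicator (F p.1) p.2)
    (hF : ∀ x, DifferentiableOn ℝ (F x) Θ) (v : Vec d) :
    Measurable fun p : X × Vec d => Θ.indicator (fun θ => fderiv ℝ (F p.1) θ v) p.2 := by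
  have hs : MeasurableSet {p : X × Vec d | p.2 ∈ Θ} := measurable_snd hΘ.measurableSet
  -- Difference quotients with step 1/(n + 1). For fixed p with p.2 in the open set Θ, the shifted
  -- point lies in Θ for all large n, so the extension by zero does not affect the limit.
  set A : ℕ → X × Vec d → ℝ := fun n p => ({p : X × Vec d | p.2 ∈ Θ}).indicator (fun p =>
    ((n : ℝ) + 1) * (Θ.indicator (F p.1) (p.2 + ((n : ℝ) + 1)⁻¹ • v) - Θ.indicator (F p.1) p.2)) p
  refine measurable_of_tendsto_metrizable (f := A) (fun n => ?_) (tendsto_pi_nhds.2 fun p => ?_)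
  · refine Measurable.indicator (Measurable.const_mul (Measurable.sub ?_ hm) _) hs
    exact hm.comp (measurable_fst.prodMk (measurable_snd.add_const _))
  · by_cases hp : p.2 ∈ Θ
    · have hd : HasFDerivAt (F p.1) (fderiv ℝ (F p.1) p.2) p.2 :=
        ((hF p.1).differentiableAt (hΘ.mem_nhds hp)).hasFDerivAt
      have hl := hd.lim v (c := fun n : ℕ => (n : ℝ) + 1) (l := atTop) ?_
      · rw [indicator_of_mem hp]
        refine hl.congr' ?_
        have hev : ∀ᶠ n : ℕ in atTop, p.2 + ((n : ℝ) + 1)⁻¹ • v ∈ Θ := by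
          have : Tendsto (fun n : ℕ => p.2 + ((n : ℝ) + 1)⁻¹ • v) atTop (𝓝 p.2) := by
            have h0 : Tendsto (fun n : ℕ => ((n : ℝ) + 1)⁻¹) atTop (𝓝 0) := by
              simpa using tendsto_one_div_add_atTop_nhds_zero_nat (𝕜 := ℝ)
            simpa using (h0.smul_const v).const_add p.2
          exact this.eventually (hΘ.mem_nhds hp)
        filter_upwards [hev] with n hn
        simp only [A]
        rw [indicator_of_mem (show p ∈ {p : X × Vec d | p.2 ∈ Θ} from hp), indicator_of_mem hn,
          indicator_of_mem hp, smul_eq_mul]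
      · have : Tendsto (fun n : ℕ => (n : ℝ) + 1) atTop atTop :=
          tendsto_atTop_add_const_right _ _ tendsto_natCast_atTop_atTop
        exact tendsto_norm_atTop_atTop.comp this
    · rw [indicator_of_notMem hp]
      refine tendsto_const_nhds.congr fun n => ?_
      simp only [A]
      rw [indicator_of_notMem (show p ∉ {p : X × Vec d | p.2 ∈ Θ} from hp)]

lemma isClosed_setOf_posSemidef (n : Type*) [Fintype n] :
    IsClosed {A : n → n → ℝ | (Matrix.of A).PosSemidef} := by
  simp only [Matrix.posSemidef_iff_dotProduct_mulVec, ofPred_and, ofPred_forall]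
  refine IsClosed.inter ?_ (isClosed_iInter fun x => ?_)
  · simp only [Matrix.IsHermitian.ext_iff, ofPred_forall]
    refine isClosed_iInter fun i => isClosed_iInter fun j => isClosed_eq ?_ ?_
    · simp; fun_prop
    · simp; fun_prop
  · refine isClosed_le continuous_const ?_
    simp only [Matrix.mulVec, dotProduct, Matrix.of_apply]
    fun_prop

/-- Positive definite means positive semidefinite, which is a closed condition, together with a
nonzero determinant. -/
lemma measurableSet_posDef {n : Type*} [Fintype n] [DecidableEq n] {H : Y → Matrix n n ℝ}
    (hH : ∀ i j, Measurable fun y => H y i j) : MeasurableSet {y | (H y).PosDef} := by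
  have h : {y | (H y).PosDef} = {y | (H y).PosSemidef} ∩ {y | (H y).det ≠ 0} := by
    ext y
    constructor
    · intro hy
      exact ⟨hy.posSemidef, hy.det_pos.ne'⟩
    · rintro ⟨h1, h2⟩
      exact h1.posDef_iff_det_ne_zero.2 h2
  rw [h]
  refine MeasurableSet.inter ?_ ?_
  · have hm : Measurable fun y => (fun i j => H y i j) :=
      measurable_pi_lambda _ fun i => measurable_pi_lambda _ fun j => hH i j
    exact hm (isClosed_setOf_posSemidef n).measurableSet
  · have : Measurable fun y => (H y).det := by
      simp only [Matrix.det_apply]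
      refine Finset.measurable_sum _ fun σ _ => ?_
      exact Measurable.const_smul (Finset.measurable_prod _ fun i _ => hH _ _) _
    exact (this (measurableSet_singleton 0)).compl

/-- The index type of the support submatrix varies with θ. Reindexing by a fixed finite set S allows
measurability to be proved separately on each of the finitely many events where the support equals
S. -/
lemma posDef_suppSubmatrix_iff {θ : Vec d} {S : Finset (Fin d)} (hS : ∀ j, j ∈ S ↔ θ j ≠ 0)
    (A : Matrix (Fin d) (Fin d) ℝ) : (suppSubmatrix θ A).PosDef ↔
      (A.submatrix (Subtype.val : {j // j ∈ S} → Fin d) Subtype.val).PosDef := by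
  have e : A.submatrix (Subtype.val : {j // j ∈ S} → Fin d) Subtype.val
      = (suppSubmatrix θ A).submatrix (Equiv.subtypeEquivRight hS) (Equiv.subtypeEquivRight hS) := by
    ext i j; rfl
  have e' : suppSubmatrix θ A
      = (A.submatrix (Subtype.val : {j // j ∈ S} → Fin d) Subtype.val).submatrix
        (Equiv.subtypeEquivRight hS).symm (Equiv.subtypeEquivRight hS).symm := by
    ext i j; rfl
  constructor
  · intro h; rw [e]; exact h.submatrix (Equiv.injective _)
  · intro h; rw [e']; exact h.submatrix (Equiv.injective _)

lemma det_suppSubmatrix {θ : Vec d} {S : Finset (Fin d)} (hS : ∀ j, j ∈ S ↔ θ j ≠ 0)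
    (A : Matrix (Fin d) (Fin d) ℝ) : (suppSubmatrix θ A).det =
      (A.submatrix (Subtype.val : {j // j ∈ S} → Fin d) Subtype.val).det := by
  have e : A.submatrix (Subtype.val : {j // j ∈ S} → Fin d) Subtype.val
      = (suppSubmatrix θ A).submatrix (Equiv.subtypeEquivRight hS) (Equiv.subtypeEquivRight hS) := by
    ext i j; rfl
  rw [e, Matrix.det_submatrix_equiv_self]

lemma measurableSet_support_eq {t : Y → Vec d} (ht : Measurable t) (S : Finset (Fin d)) :
    MeasurableSet {y | ∀ j, j ∈ S ↔ t y j ≠ 0} := by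
  simp only [ofPred_forall]
  refine MeasurableSet.iInter fun j => ?_
  have h0 : MeasurableSet {y | t y j = 0} :=
    (measurableSet_singleton (0 : ℝ)).preimage (by fun_prop : Measurable fun y => t y j)
  by_cases hj : j ∈ S
  · simp only [hj, true_iff]; exact h0.compl
  · simpa [hj] using h0

lemma measurableSet_posDef_suppSubmatrix {t : Y → Vec d} (ht : Measurable t)
    {H : Y → Matrix (Fin d) (Fin d) ℝ} (hH : ∀ i j, Measurable fun y => H y i j) :
    MeasurableSet {y | (suppSubmatrix (t y) (H y)).PosDef} := by
  have h : {y | (suppSubmatrix (t y) (H y)).PosDef} = ⋃ S : Finset (Fin d),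
      ({y | ∀ j, j ∈ S ↔ t y j ≠ 0} ∩
        {y | ((H y).submatrix (Subtype.val : {j // j ∈ S} → Fin d) Subtype.val).PosDef}) := by
    ext y
    simp only [mem_iUnion, mem_inter_iff, mem_ofPred_eq]
    constructor
    · intro hy
      have hS : ∀ j, j ∈ Finset.univ.filter (fun j => t y j ≠ 0) ↔ t y j ≠ 0 := by simp
      exact ⟨_, hS, (posDef_suppSubmatrix_iff hS _).1 hy⟩
    · rintro ⟨S, hS, hy⟩
      exact (posDef_suppSubmatrix_iff hS _).2 hy
  rw [h]
  exact MeasurableSet.iUnion fun S => (measurableSet_support_eq ht S).inter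
    (measurableSet_posDef fun i j => hH _ _)

lemma measurable_det_suppSubmatrix {t : Y → Vec d} (ht : Measurable t)
    {H : Y → Matrix (Fin d) (Fin d) ℝ} (hH : ∀ i j, Measurable fun y => H y i j) :
    Measurable fun y => (suppSubmatrix (t y) (H y)).det := by
  have h : (fun y => (suppSubmatrix (t y) (H y)).det) = fun y => ∑ S : Finset (Fin d),
      {y | ∀ j, j ∈ S ↔ t y j ≠ 0}.indicator (fun y =>
        ((H y).submatrix (Subtype.val : {j // j ∈ S} → Fin d) Subtype.val).det) y := by
    ext y
    have hS : ∀ j, j ∈ Finset.univ.filter (fun j => t y j ≠ 0) ↔ t y j ≠ 0 := by simp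
    rw [Finset.sum_eq_single (Finset.univ.filter fun j => t y j ≠ 0)]
    · rw [indicator_of_mem (by exact hS), det_suppSubmatrix hS]
    · intro S _ hne
      refine indicator_of_notMem (fun h => hne ?_) _
      ext j
      exact (h j).trans (hS j).symm
    · simp
  rw [h]
  refine Finset.measurable_sum _ fun S _ => Measurable.indicator ?_ (measurableSet_support_eq ht S)
  simp only [Matrix.det_apply]
  refine Finset.measurable_sum _ fun σ _ => ?_
  exact Measurable.const_smul (Finset.measurable_prod _ fun i _ => hH _ _) _

end JointMeasurability

/-! ### Measurability of the ingredients of the procedure -/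

section Derivatives

open Filter Topology

variable {d : ℕ}

lemma gradient_apply (F : Vec d → ℝ) (θ : Vec d) (j : Fin d) :
    gradient F θ j = fderiv ℝ F θ (EuclideanSpace.single j 1) := by
  have h : inner ℝ (gradient F θ) (EuclideanSpace.single j (1 : ℝ))
      = fderiv ℝ F θ (EuclideanSpace.single j 1) := by
    rw [gradient, InnerProductSpace.toDual_symm_apply]
  rw [← h, EuclideanSpace.inner_single_right]
  simp

lemma fderiv_add_inner {F : Vec d → ℝ} {Θ : Set (Vec d)} (hΘ : IsOpen Θ)
    (hF : DifferentiableOn ℝ F Θ) (v : Vec d) {θ : Vec d} (hθ : θ ∈ Θ) :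
    fderiv ℝ (fun η => F η + inner ℝ v η) θ = fderiv ℝ F θ + innerSL ℝ v := by
  have h := ((hF.differentiableAt (hΘ.mem_nhds hθ)).hasFDerivAt).add (innerSL ℝ v).hasFDerivAt
  exact h.fderiv

lemma gradient_add_inner {F : Vec d → ℝ} {Θ : Set (Vec d)} (hΘ : IsOpen Θ)
    (hF : DifferentiableOn ℝ F Θ) (v : Vec d) {θ : Vec d} (hθ : θ ∈ Θ) :
    gradient (fun η => F η + inner ℝ v η) θ = gradient F θ + v := by
  ext j
  rw [gradient_apply, fderiv_add_inner hΘ hF v hθ, PiLp.add_apply, gradient_apply]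
  simp [EuclideanSpace.inner_single_right]

lemma hessian_add_inner {F : Vec d → ℝ} {Θ : Set (Vec d)} (hΘ : IsOpen Θ)
    (hF : DifferentiableOn ℝ F Θ) (v : Vec d) {θ : Vec d} (hθ : θ ∈ Θ) :
    hessian (fun η => F η + inner ℝ v η) θ = hessian F θ := by
  have h : fderiv ℝ (fun η => F η + inner ℝ v η) =ᶠ[𝓝 θ] fun η => fderiv ℝ F η + innerSL ℝ v := by
    filter_upwards [hΘ.mem_nhds hθ] with η hη
    exact fderiv_add_inner hΘ hF v hη
  ext i j
  simp only [hessian, Matrix.of_apply]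
  rw [h.fderiv_eq, fderiv_add_const]

lemma fderiv_fderiv_apply {F : Vec d → ℝ} {θ : Vec d} (h : DifferentiableAt ℝ (fderiv ℝ F) θ)
    (u v : Vec d) : fderiv ℝ (fun η => fderiv ℝ F η v) θ u = fderiv ℝ (fderiv ℝ F) θ u v := by
  have := h.hasFDerivAt.clm_apply (hasFDerivAt_const v θ)
  rw [this.fderiv]
  simp

end Derivatives

namespace PenalizedModel

variable {d : ℕ} {X : Type*} [MeasurableSpace X] {D : PenalizedModel d X}

variable (D) in
/-- A smoothness condition weaker than `Regular`: the loss is twice differentiable, and its second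
derivative need not be continuous. -/
structure TwiceDifferentiable : Prop where
  isOpen : IsOpen D.Θ
  measurable_f : ∀ θ ∈ D.Θ, Measurable fun x => D.f x θ
  f_pos : ∀ θ ∈ D.Θ, ∀ x, 0 < D.f x θ
  isProbabilityMeasure : ∀ θ ∈ D.Θ, IsProbabilityMeasure (D.P θ)
  continuousOn_R : ContinuousOn D.R D.Θ
  differentiableOn_loss : ∀ x, DifferentiableOn ℝ (D.loss x) D.Θ
  differentiableOn_fderiv_loss : ∀ x, DifferentiableOn ℝ (fderiv ℝ (D.loss x)) D.Θ

lemma Regular.twiceDifferentiable (h : D.Regular) : D.TwiceDifferentiable where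
  isOpen := h.isOpen
  measurable_f := h.measurable_f
  f_pos := h.f_pos
  isProbabilityMeasure := h.isProbabilityMeasure
  continuousOn_R := h.differentiable_R.continuousOn
  differentiableOn_loss x := (h.contDiff_loss x).differentiableOn (by norm_num)
  differentiableOn_fderiv_loss x :=
    ((h.contDiff_loss x).fderiv_of_isOpen h.isOpen (m := 1) (by norm_num)).differentiableOn
      (by norm_num)

lemma f_eq_exp {x : X} {θ : Vec d} (h : 0 < D.f x θ) :
    D.f x θ = Real.exp (D.R θ - D.loss x θ) := by
  simp [loss, Real.exp_log h]

namespace TwiceDifferentiable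

variable (hD : D.TwiceDifferentiable)
include hD

lemma measurable_loss :
    Measurable fun p : X × Vec d => D.Θ.indicator (D.loss p.1) p.2 :=
  measurable_indicator_of_continuousOn hD.isOpen.measurableSet
    (fun θ hθ => ((hD.measurable_f θ hθ).log.neg).add_const _)
    fun x => (hD.differentiableOn_loss x).continuousOn

lemma measurable_density :
    Measurable fun p : X × Vec d => D.Θ.indicator (D.f p.1) p.2 := by
  refine measurable_indicator_of_continuousOn hD.isOpen.measurableSet hD.measurable_f fun x => ?_
  refine ContinuousOn.congr (f := fun θ => Real.exp (D.R θ - D.loss x θ)) ?_ fun θ hθ =>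
    f_eq_exp (hD.f_pos θ hθ x)
  exact (hD.continuousOn_R.sub (hD.differentiableOn_loss x).continuousOn).rexp

lemma measurable_gradient :
    Measurable fun p : X × Vec d => D.Θ.indicator (gradient (D.loss p.1)) p.2 := by
  have h : ∀ j, Measurable fun p : X × Vec d => (D.Θ.indicator (gradient (D.loss p.1)) p.2) j := by
    intro j
    convert measurable_indicator_fderiv hD.isOpen hD.measurable_loss hD.differentiableOn_loss
      (EuclideanSpace.single j 1) using 2 with p
    by_cases hp : p.2 ∈ D.Θ
    · rw [indicator_of_mem hp, indicator_of_mem hp, gradient_apply]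
    · rw [indicator_of_notMem hp, indicator_of_notMem hp]; rfl
  exact (MeasurableEquiv.toLp 2 (Fin d → ℝ)).measurable.comp (measurable_pi_lambda _ h)

lemma measurable_sndDeriv (u v : Vec d) :
    Measurable fun p : X × Vec d =>
      D.Θ.indicator (fun θ => fderiv ℝ (fderiv ℝ (D.loss p.1)) θ u v) p.2 := by
  convert measurable_indicator_fderiv (F := fun x θ => fderiv ℝ (D.loss x) θ v) hD.isOpen
    (measurable_indicator_fderiv hD.isOpen hD.measurable_loss hD.differentiableOn_loss v)
    (fun x => ?_) u using 2 with p
  · by_cases hp : p.2 ∈ D.Θ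
    · rw [indicator_of_mem hp, indicator_of_mem hp, fderiv_fderiv_apply]
      exact (hD.differentiableOn_fderiv_loss p.1).differentiableAt (hD.isOpen.mem_nhds hp)
    · rw [indicator_of_notMem hp, indicator_of_notMem hp]
  · exact (hD.differentiableOn_fderiv_loss x).clm_apply (differentiableOn_const v)

lemma measurable_hessian (i j : Fin d) :
    Measurable fun p : X × Vec d => D.Θ.indicator (fun θ => hessian (D.loss p.1) θ i j) p.2 :=
  hD.measurable_sndDeriv _ _

lemma gradient_perturbedLoss (x : X) (w : Vec d) {θ : Vec d} (hθ : θ ∈ D.Θ) :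
    gradient (D.perturbedLoss x w) θ = gradient (D.loss x) θ + D.σ • w := by
  rw [← gradient_add_inner hD.isOpen (hD.differentiableOn_loss x) _ hθ]
  congr 1
  ext η
  simp [perturbedLoss, real_inner_smul_left]

lemma hessian_perturbedLoss (x : X) (w : Vec d) {θ : Vec d} (hθ : θ ∈ D.Θ) :
    hessian (D.perturbedLoss x w) θ = hessian (D.loss x) θ := by
  rw [← hessian_add_inner hD.isOpen (hD.differentiableOn_loss x) (D.σ • w) hθ]
  congr 1
  ext η
  simp [perturbedLoss, real_inner_smul_left]

end TwiceDifferentiable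

variable (D) in
/-- The first-order optimality conditions at `θ` for the gradient `g` of the smooth part. -/
def KKT (θ g : Vec d) : Prop :=
  ∀ j, (θ j ≠ 0 → g j = -(D.lam * Real.sign (θ j))) ∧ (θ j = 0 → |g j| ≤ D.lam)

/-- Eliminating the subgradient s leaves coordinatewise conditions on (θ, g), which are visibly
measurable and suit the chart coordinates. -/
lemma kkt_iff (hlam : 0 ≤ D.lam) (θ g : Vec d) :
    (∃ s : Vec d, g + D.lam • s = 0 ∧
      ∀ j, (θ j ≠ 0 → s j = Real.sign (θ j)) ∧ (θ j = 0 → s j ∈ Icc (-1 : ℝ) 1)) ↔ D.KKT θ g := by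
  constructor
  · rintro ⟨s, hs, hj⟩ j
    have h : g j + D.lam * s j = 0 := by
      have := congrArg (fun v : Vec d => v j) hs
      simpa using this
    refine ⟨fun h0 => ?_, fun h0 => ?_⟩
    · rw [← (hj j).1 h0]; linarith
    · have := (hj j).2 h0
      rw [show g j = -(D.lam * s j) by linarith, abs_neg, abs_mul, abs_of_nonneg hlam]
      exact mul_le_of_le_one_right hlam (abs_le.2 this)
  · intro h
    classical
    -- Off the support s = -g/λ is forced when λ > 0. When λ = 0 the condition reads g j = 0 and any
    -- value in [-1, 1] serves; 0 is taken.
    refine ⟨WithLp.toLp 2 fun j => if θ j ≠ 0 then Real.sign (θ j) else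
      if D.lam = 0 then 0 else -(g j / D.lam), ?_, fun j => ⟨fun h0 => ?_, fun h0 => ?_⟩⟩
    · ext j
      by_cases h0 : θ j = 0
      · have := (h j).2 h0
        by_cases hl : D.lam = 0
        · rw [hl] at this
          have h1 : g j = 0 := abs_eq_zero.1 (le_antisymm this (abs_nonneg _))
          simp [hl, h1]
        · simp [h0, hl]; field_simp; ring
      · simp [h0, (h j).1 h0]
    · simp [h0]
    · have := (h j).2 h0
      by_cases hl : D.lam = 0
      · simp [h0, hl]
      · have hl' : 0 < D.lam := lt_of_le_of_ne hlam (Ne.symm hl)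
        simp only [h0, hl, ne_eq, not_true_eq_false, if_false]
        rw [mem_Icc, ← abs_le, abs_neg, abs_div, abs_of_pos hl', div_le_one hl']
        exact this

lemma measurable_sign : Measurable Real.sign := by
  have : Real.sign = fun r => if r < 0 then (-1 : ℝ) else if 0 < r then 1 else 0 := by
    ext r; rfl
  rw [this]
  exact Measurable.ite measurableSet_Iio measurable_const
    (Measurable.ite measurableSet_Ioi measurable_const measurable_const)

lemma measurableSet_kkt : MeasurableSet {p : Vec d × Vec d | D.KKT p.1 p.2} := by
  have h1 : ∀ j, Measurable fun p : Vec d × Vec d => p.1 j := fun j => by fun_prop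
  have h2 : ∀ j, Measurable fun p : Vec d × Vec d => p.2 j := fun j => by fun_prop
  simp only [KKT, ofPred_forall, ofPred_and]
  refine MeasurableSet.iInter fun j => MeasurableSet.inter ?_ ?_
  · refine MeasurableSet.imp (measurableSet_eq_fun (h1 j) measurable_const).compl ?_
    exact measurableSet_eq_fun (h2 j) ((measurable_sign.comp (h1 j)).const_mul _).neg
  · exact MeasurableSet.imp (measurableSet_eq_fun (h1 j) measurable_const)
      (measurableSet_le (h2 j).abs measurable_const)

variable (D) in
/-- The noise vector for which `g` is the gradient of the perturbed loss at `θ`. -/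
def noiseOf (x : X) (θ g : Vec d) : Vec d := D.σ⁻¹ • (g - gradient (D.loss x) θ)

namespace TwiceDifferentiable

variable (hD : D.TwiceDifferentiable) (hlam : 0 ≤ D.lam) (hσ : 0 < D.σ)
include hD

include hlam in
lemma isSSOSP_iff (x : X) (w θ : Vec d) : D.IsSSOSP x w θ ↔ θ ∈ D.Θ ∧
    D.KKT θ (gradient (D.loss x) θ + D.σ • w) ∧
    (suppSubmatrix θ (hessian (D.loss x) θ)).PosDef := by
  rw [IsSSOSP, kkt_iff hlam]
  refine and_congr_right fun hθ => ?_
  rw [hD.gradient_perturbedLoss x w hθ, hD.hessian_perturbedLoss x w hθ]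

include hlam in
lemma measurableSet_isSSOSP :
    MeasurableSet {t : X × Vec d × Vec d | D.IsSSOSP t.1 t.2.1 t.2.2} := by
  have hp : Measurable fun t : X × Vec d × Vec d => (t.1, t.2.2) := by fun_prop
  have h : {t : X × Vec d × Vec d | D.IsSSOSP t.1 t.2.1 t.2.2} =
      {t | t.2.2 ∈ D.Θ} ∩ ({t | D.KKT t.2.2 (D.Θ.indicator (gradient (D.loss t.1)) t.2.2
        + D.σ • t.2.1)} ∩ {t | (suppSubmatrix t.2.2 (Matrix.of fun i j =>
          D.Θ.indicator (fun θ => hessian (D.loss t.1) θ i j) t.2.2)).PosDef}) := by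
    ext t
    simp only [mem_inter_iff, mem_ofPred_eq, hD.isSSOSP_iff hlam]
    refine and_congr_right fun hθ => ?_
    simp only [indicator_of_mem hθ]
    rfl
  rw [h]
  refine MeasurableSet.inter ?_ (MeasurableSet.inter ?_ ?_)
  · exact (measurable_snd.comp measurable_snd) hD.isOpen.measurableSet
  · refine measurableSet_kkt.preimage (f := fun t : X × Vec d × Vec d => (t.2.2,
      D.Θ.indicator (gradient (D.loss t.1)) t.2.2 + D.σ • t.2.1)) ?_
    exact (measurable_snd.comp measurable_snd).prodMk
      ((hD.measurable_gradient.comp hp).add (by fun_prop))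
  · exact measurableSet_posDef_suppSubmatrix (measurable_snd.comp measurable_snd)
      fun i j => (hD.measurable_hessian i j).comp hp

include hσ in
lemma eq_gradient_perturbedLoss_iff {x : X} {w θ g : Vec d} (hθ : θ ∈ D.Θ) :
    g = gradient (D.perturbedLoss x w) θ ↔ w = D.noiseOf x θ g := by
  rw [hD.gradient_perturbedLoss x w hθ, noiseOf, eq_inv_smul_iff₀ hσ.ne', eq_sub_iff_add_eq',
    eq_comm]

include hσ in
-- Since σ > 0 and the perturbation is linear, (x, θ, g) determines the noise, so the existential
-- over w in the feasible set has a single candidate.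
lemma mem_feasibleSet_iff {x : X} {θ g : Vec d} : x ∈ D.feasibleSet θ g ↔
    θ = D.θhat x (D.noiseOf x θ g) ∧ D.IsSSOSP x (D.noiseOf x θ g) θ := by
  constructor
  · rintro ⟨w, h1, h2, h3⟩
    rw [hD.eq_gradient_perturbedLoss_iff hσ h2.1] at h3
    rw [← h3]; exact ⟨h1, h2⟩
  · rintro ⟨h1, h2⟩
    exact ⟨_, h1, h2, (hD.eq_gradient_perturbedLoss_iff hσ h2.1).2 rfl⟩

include hlam hσ in
lemma measurableSet_feasible (hs : D.MeasurableSolver) :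
    MeasurableSet {t : X × Vec d × Vec d | t.1 ∈ D.feasibleSet t.2.1 t.2.2} := by
  set W : X × Vec d × Vec d → Vec d := fun t =>
    D.σ⁻¹ • (t.2.2 - D.Θ.indicator (gradient (D.loss t.1)) t.2.1) with hW
  have hp : Measurable fun t : X × Vec d × Vec d => (t.1, t.2.1) := by fun_prop
  have hWm : Measurable W := by
    have := hD.measurable_gradient.comp hp
    exact Measurable.const_smul ((measurable_snd.comp measurable_snd).sub this) D.σ⁻¹
  have h : {t : X × Vec d × Vec d | t.1 ∈ D.feasibleSet t.2.1 t.2.2} =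
      {t | t.2.1 ∈ D.Θ} ∩ ({t | t.2.1 = D.θhat t.1 (W t)} ∩
        {t | D.IsSSOSP t.1 (W t) t.2.1}) := by
    ext t
    simp only [mem_inter_iff, mem_ofPred_eq, hD.mem_feasibleSet_iff hσ]
    have key : t.2.1 ∈ D.Θ → D.noiseOf t.1 t.2.1 t.2.2 = W t := fun hθ => by
      rw [hW]; simp only [noiseOf, indicator_of_mem hθ]
    constructor
    · rintro ⟨h1, h2⟩
      have h3 := h2.1
      rw [key h3] at h1 h2
      exact ⟨h3, h1, h2⟩
    · rintro ⟨h3, h1, h2⟩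
      rw [key h3]
      exact ⟨h1, h2⟩
  rw [h]
  refine MeasurableSet.inter ?_ (MeasurableSet.inter ?_ ?_)
  · exact (measurable_fst.comp measurable_snd) hD.isOpen.measurableSet
  · exact measurableSet_eq_fun (measurable_fst.comp measurable_snd)
      (hs.1.comp (measurable_fst.prodMk hWm))
  · exact (hD.measurableSet_isSSOSP hlam).preimage
      (measurable_fst.prodMk (hWm.prodMk (measurable_fst.comp measurable_snd)))

include hlam hσ in
lemma measurable_unnormDensity (hs : D.MeasurableSolver) :
    Measurable fun t : X × Vec d × Vec d => D.unnormDensity t.2.1 t.2.2 t.1 := by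
  have hp : Measurable fun t : X × Vec d × Vec d => (t.1, t.2.1) := by fun_prop
  have h : (fun t : X × Vec d × Vec d => D.unnormDensity t.2.1 t.2.2 t.1) =
      {t : X × Vec d × Vec d | t.1 ∈ D.feasibleSet t.2.1 t.2.2}.indicator fun t =>
        D.Θ.indicator (D.f t.1) t.2.1 * Real.exp (-(‖t.2.2 -
          D.Θ.indicator (gradient (D.loss t.1)) t.2.1‖ ^ 2 / (2 * D.σ ^ 2 / d))) *
        (suppSubmatrix t.2.1 (Matrix.of fun i j =>
          D.Θ.indicator (fun θ => hessian (D.loss t.1) θ i j) t.2.1)).det := by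
    ext t
    by_cases ht : t.1 ∈ D.feasibleSet t.2.1 t.2.2
    · have hθ : t.2.1 ∈ D.Θ := ((hD.mem_feasibleSet_iff hσ).1 ht).2.1
      rw [unnormDensity, indicator_of_mem ht, indicator_of_mem (by exact ht)]
      simp only [indicator_of_mem hθ]
      rfl
    · rw [unnormDensity, indicator_of_notMem ht, indicator_of_notMem (by exact ht)]
  rw [h]
  refine Measurable.indicator ?_ (hD.measurableSet_feasible hlam hσ hs)
  have h1 : Measurable fun t : X × Vec d × Vec d => D.Θ.indicator (D.f t.1) t.2.1 :=
    hD.measurable_density.comp hp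
  have h2 : Measurable fun t : X × Vec d × Vec d =>
      D.Θ.indicator (gradient (D.loss t.1)) t.2.1 := hD.measurable_gradient.comp hp
  have h3 := measurable_det_suppSubmatrix (t := fun t : X × Vec d × Vec d => t.2.1)
    (measurable_fst.comp measurable_snd) (H := fun t => Matrix.of fun i j =>
          D.Θ.indicator (fun θ => hessian (D.loss t.1) θ i j) t.2.1)
    fun i j => (hD.measurable_hessian i j).comp hp
  fun_prop

end TwiceDifferentiable

end PenalizedModel

/-! ### Change of variables from the noise to the estimator and its gradient -/

section Charts

open Filter Topology

variable {d : ℕ}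

/-- The projection onto the coordinates in `S`. -/
def coordProj (S : Finset (Fin d)) : Vec d →L[ℝ] Vec d :=
  LinearMap.toContinuousLinearMap
    { toFun := fun u => WithLp.toLp 2 fun j => if j ∈ S then u j else 0
      map_add' := fun u v => by ext j; by_cases h : j ∈ S <;> simp [h]
      map_smul' := fun c u => by ext j; by_cases h : j ∈ S <;> simp [h] }

lemma coordProj_apply (S : Finset (Fin d)) (u : Vec d) (j : Fin d) :
    coordProj S u j = if j ∈ S then u j else 0 := rfl

/-- The gradient with coordinates `u` off `S`, and determined by the signs of `u` on `S`. -/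
def chartGrad (lam : ℝ) (S : Finset (Fin d)) (u : Vec d) : Vec d :=
  WithLp.toLp 2 fun j => if j ∈ S then -(lam * Real.sign (u j)) else u j

lemma chartGrad_apply (lam : ℝ) (S : Finset (Fin d)) (u : Vec d) (j : Fin d) :
    chartGrad lam S u j = if j ∈ S then -(lam * Real.sign (u j)) else u j := rfl

/-- The chart domain: the coordinates in `S` do not vanish. -/
def chartDomain (S : Finset (Fin d)) : Set (Vec d) := {u | ∀ j ∈ S, u j ≠ 0}

lemma measurableSet_chartDomain (S : Finset (Fin d)) : MeasurableSet (chartDomain S) := by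
  simp only [chartDomain, ofPred_forall]
  refine MeasurableSet.iInter fun j => MeasurableSet.iInter fun _ => ?_
  exact (measurableSet_eq_fun (by fun_prop : Measurable fun u : Vec d => u j)
    measurable_const).compl

lemma coordProj_support {S : Finset (Fin d)} {u : Vec d} (hu : u ∈ chartDomain S) (j : Fin d) :
    j ∈ S ↔ coordProj S u j ≠ 0 := by
  rw [coordProj_apply]
  by_cases h : j ∈ S
  · simp [h, hu j h]
  · simp [h]

lemma measurable_chartGrad (lam : ℝ) (S : Finset (Fin d)) : Measurable (chartGrad lam S) := by
  refine (MeasurableEquiv.toLp 2 (Fin d → ℝ)).measurable.comp (measurable_pi_lambda _ fun j => ?_)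
  have hj : Measurable fun u : Vec d => u j := by fun_prop
  by_cases h : j ∈ S
  · simp only [h, if_true]
    exact ((PenalizedModel.measurable_sign.comp hj).const_mul _).neg
  · simpa only [h, if_false] using hj

lemma chart_injective {S : Finset (Fin d)} {lam : ℝ} {u v : Vec d}
    (h1 : coordProj S u = coordProj S v) (h2 : chartGrad lam S u = chartGrad lam S v) : u = v := by
  ext j
  by_cases h : j ∈ S
  · simpa [coordProj_apply, h] using congrArg (fun w : Vec d => w j) h1
  · simpa [chartGrad_apply, h] using congrArg (fun w : Vec d => w j) h2

/-- Signs are locally constant where the coordinates in S do not vanish, so only the coordinates off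
S contribute to the derivative. -/
lemma hasFDerivAt_chartGrad {S : Finset (Fin d)} (lam : ℝ) {u : Vec d} (hu : u ∈ chartDomain S) :
    HasFDerivAt (chartGrad lam S) (coordProj Sᶜ) u := by
  rw [← hasFDerivWithinAt_univ, hasFDerivWithinAt_euclidean]
  intro j
  rw [hasFDerivWithinAt_univ]
  by_cases h : j ∈ S
  · have h0 : (fun v : Vec d => chartGrad lam S v j) =ᶠ[𝓝 u] fun _ => chartGrad lam S u j := by
      have hc : ContinuousAt (fun v : Vec d => v j) u := by fun_prop
      rcases lt_or_gt_of_ne (hu j h) with hlt | hgt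
      · filter_upwards [hc.eventually (Iio_mem_nhds hlt)] with v hv
        simp [chartGrad_apply, h, Real.sign_of_neg hlt, Real.sign_of_neg hv]
      · filter_upwards [hc.eventually (Ioi_mem_nhds hgt)] with v hv
        simp [chartGrad_apply, h, Real.sign_of_pos hgt, Real.sign_of_pos hv]
    have := (hasFDerivAt_const (𝕜 := ℝ) (chartGrad lam S u j) u).congr_of_eventuallyEq h0
    refine this.congr_fderiv ?_
    ext v
    change (0 : ℝ) = coordProj Sᶜ v j
    simp [coordProj_apply, h]
  · have h0 : (fun v : Vec d => chartGrad lam S v j) = fun v => coordProj Sᶜ v j := by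
      ext v; simp [chartGrad_apply, coordProj_apply, h]
    rw [h0]
    exact ((EuclideanSpace.proj (𝕜 := ℝ) j : Vec d →L[ℝ] ℝ).comp (coordProj Sᶜ)).hasFDerivAt

/-- The vector representing a linear form. -/
def dualVec (d : ℕ) : StrongDual ℝ (Vec d) →L[ℝ] Vec d :=
  LinearMap.toContinuousLinearMap
    { toFun := fun φ => WithLp.toLp 2 fun j => φ (EuclideanSpace.single j 1)
      map_add' := fun φ ψ => by ext j; simp
      map_smul' := fun c φ => by ext j; simp }

lemma dualVec_apply (φ : StrongDual ℝ (Vec d)) (j : Fin d) :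
    dualVec d φ j = φ (EuclideanSpace.single j 1) := rfl

lemma gradient_eq_dualVec (F : Vec d → ℝ) : gradient F = fun θ => dualVec d (fderiv ℝ F θ) := by
  ext θ j
  rw [gradient_apply, dualVec_apply]

lemma hasFDerivAt_gradient {F : Vec d → ℝ} {θ : Vec d} (h : DifferentiableAt ℝ (fderiv ℝ F) θ) :
    HasFDerivAt (gradient F) ((dualVec d).comp (fderiv ℝ (fderiv ℝ F) θ)) θ := by
  rw [gradient_eq_dualVec]
  exact (dualVec d).hasFDerivAt.comp θ h.hasFDerivAt

lemma abs_det_neg_transpose {n : Type*} [Fintype n] [DecidableEq n] (A : Matrix n n ℝ) :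
    |(-A.transpose).det| = |A.det| := by
  rw [Matrix.det_neg, Matrix.det_transpose, abs_mul, abs_pow, abs_neg, abs_one, one_pow, one_mul]

/-- The Jacobian determinant of the chart `u ↦ σ⁻¹ (g(u) - ∇F(θ(u)))`. -/
lemma abs_det_chart (F : Vec d → ℝ) (θ : Vec d) (S : Finset (Fin d)) {σ : ℝ} (hσ : 0 < σ) :
    |(σ⁻¹ • (coordProj Sᶜ - ((dualVec d).comp
        (fderiv ℝ (fderiv ℝ F) θ)).comp (coordProj S)) : Vec d →L[ℝ] Vec d).det| =
    (σ⁻¹) ^ d * |((hessian F θ).submatrix (Subtype.val : {j // j ∈ S} → Fin d) Subtype.val).det| := by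
  set A := (coordProj Sᶜ - ((dualVec d).comp
        (fderiv ℝ (fderiv ℝ F) θ)).comp (coordProj S) : Vec d →L[ℝ] Vec d) with hA
  have h1 : (σ⁻¹ • A).det = (σ⁻¹) ^ d * A.det := by
    rw [ContinuousLinearMap.det, ContinuousLinearMap.det, ContinuousLinearMap.toLinearMap_smul,
      LinearMap.det_smul]
    simp
  rw [h1, abs_mul, abs_of_nonneg (by positivity : 0 ≤ (σ⁻¹) ^ d)]
  congr 1
  set b := (EuclideanSpace.basisFun (Fin d) ℝ).toBasis with hb
  have h2 : A.det = (LinearMap.toMatrix b b (A : Vec d →ₗ[ℝ] Vec d)).det := by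
    rw [LinearMap.det_toMatrix]
  -- Columns indexed by S come from minus the Hessian, and the other columns are those of the
  -- identity. The matrix is thus block triangular, and only the Hessian block on S survives in the
  -- determinant.
  have hM : ∀ i j, LinearMap.toMatrix b b (A : Vec d →ₗ[ℝ] Vec d) i j =
      if j ∈ S then -hessian F θ j i else if i = j then 1 else 0 := by
    intro i j
    rw [LinearMap.toMatrix_apply]
    have hp : ∀ T : Finset (Fin d), coordProj T (EuclideanSpace.single j (1 : ℝ)) =
        if j ∈ T then EuclideanSpace.single j (1 : ℝ) else 0 := by
      intro T
      ext k
      rw [coordProj_apply]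
      by_cases hk : k = j
      · subst hk; by_cases h : k ∈ T <;> simp [h]
      · by_cases h : j ∈ T <;> simp [h, hk]
    simp only [hb, OrthonormalBasis.coe_toBasis, EuclideanSpace.basisFun_apply,
      OrthonormalBasis.coe_toBasis_repr_apply, EuclideanSpace.basisFun_repr]
    have e : (A (EuclideanSpace.single j 1)) i = (coordProj Sᶜ (EuclideanSpace.single j 1)) i
        - (fderiv ℝ (fderiv ℝ F) θ (coordProj S (EuclideanSpace.single j 1)))
          (EuclideanSpace.single i 1) := rfl
    refine Eq.trans e ?_
    rw [hp, hp]
    by_cases h : j ∈ S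
    · simp [h, hessian]
    · simp [h]
  rw [h2, Matrix.twoBlockTriangular_det' _ (fun j => j ∈ S)]
  · have hone : (LinearMap.toMatrix b b (A : Vec d →ₗ[ℝ] Vec d)).toSquareBlockProp
        (fun j => ¬ j ∈ S) = 1 := by
      ext i j
      rw [Matrix.toSquareBlockProp_def, Matrix.of_apply, hM, if_neg j.2, Matrix.one_apply]
      simp [Subtype.ext_iff]
    have hS : (LinearMap.toMatrix b b (A : Vec d →ₗ[ℝ] Vec d)).toSquareBlockProp
        (fun j => j ∈ S) = -((hessian F θ).submatrix (Subtype.val : {j // j ∈ S} → Fin d)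
          Subtype.val).transpose := by
      ext i j
      rw [Matrix.toSquareBlockProp_def, Matrix.of_apply, hM, if_pos j.2]
      rfl
    rw [hone, hS, Matrix.det_one, mul_one]
    convert abs_det_neg_transpose _ using 3
  · intro i hi j hj
    rw [hM, if_neg hj, if_neg]
    rintro rfl
    exact hj hi

end Charts

/-! ### The noise as a function of the chart coordinates -/

namespace PenalizedModel

variable {d : ℕ} {X : Type*} [MeasurableSpace X] {D : PenalizedModel d X}

namespace TwiceDifferentiable

variable (hD : D.TwiceDifferentiable) (hlam : 0 ≤ D.lam) (hσ : 0 < D.σ) (hs : D.MeasurableSolver)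
include hD

lemma hasFDerivAt_noiseOf (x : X) {S : Finset (Fin d)} {u : Vec d} (hu : u ∈ chartDomain S)
    (hθ : coordProj S u ∈ D.Θ) :
    HasFDerivAt (fun u => D.noiseOf x (coordProj S u) (chartGrad D.lam S u))
      (D.σ⁻¹ • (coordProj Sᶜ - ((dualVec d).comp
        (fderiv ℝ (fderiv ℝ (D.loss x)) (coordProj S u))).comp (coordProj S))) u := by
  have h1 := hasFDerivAt_gradient
    ((hD.differentiableOn_fderiv_loss x).differentiableAt (hD.isOpen.mem_nhds hθ))
  exact ((hasFDerivAt_chartGrad D.lam hu).sub (h1.comp u (coordProj S).hasFDerivAt)).const_smul D.σ⁻¹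

include hlam hσ in
-- Surjectivity of the chart: given w, take the coordinates of the estimator on S and those of its
-- gradient off S; stationarity then forces the gradient on S to be the one read off from the signs.
lemma image_noiseOf (x : X) (S : Finset (Fin d)) :
    (fun u => D.noiseOf x (coordProj S u) (chartGrad D.lam S u)) ''
      {u | u ∈ chartDomain S ∧ x ∈ D.feasibleSet (coordProj S u) (chartGrad D.lam S u)} =
    {w | D.IsSSOSP x w (D.θhat x w) ∧ ∀ j, j ∈ S ↔ D.θhat x w j ≠ 0} := by
  ext w
  constructor
  · rintro ⟨u, ⟨hu, hx⟩, rfl⟩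
    obtain ⟨h1, h2⟩ := (hD.mem_feasibleSet_iff hσ).1 hx
    simp only [mem_ofPred_eq, ← h1]
    exact ⟨h2, coordProj_support hu⟩
  · rintro ⟨h1, h2⟩
    have hθ := h1.1
    set θ := D.θhat x w with hθdef
    set g := gradient (D.perturbedLoss x w) θ with hg
    have hk := ((hD.isSSOSP_iff hlam x w θ).1 h1).2.1
    rw [← hD.gradient_perturbedLoss x w hθ, ← hg] at hk
    set u : Vec d := WithLp.toLp 2 fun j => if j ∈ S then θ j else g j with hu
    have hu' : ∀ j, u j = if j ∈ S then θ j else g j := fun j => rfl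
    have e1 : coordProj S u = θ := by
      ext j
      rw [coordProj_apply, hu']
      by_cases h : j ∈ S
      · simp [h]
      · have := mt (h2 j).2 h
        simp only [ne_eq, not_not] at this
        simp [h, this]
    have e2 : chartGrad D.lam S u = g := by
      ext j
      rw [chartGrad_apply, hu']
      by_cases h : j ∈ S
      · simp [h, (hk j).1 ((h2 j).1 h)]
      · simp [h]
    refine ⟨u, ⟨fun j hj => ?_, ?_⟩, ?_⟩
    · rw [hu', if_pos hj]; exact (h2 j).1 hj
    · rw [e1, e2]; exact ⟨w, hθdef, h1, hg⟩
    · simp only [e1, e2]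
      exact ((hD.eq_gradient_perturbedLoss_iff hσ hθ).1 hg).symm

include hσ in
-- The solver is a function: on feasible points w determines θ = θ̂(x, w), then g as the gradient
-- there, and the pair (θ, g) determines the chart coordinates.
lemma injOn_noiseOf (x : X) (S : Finset (Fin d)) :
    InjOn (fun u => D.noiseOf x (coordProj S u) (chartGrad D.lam S u))
      {u | u ∈ chartDomain S ∧ x ∈ D.feasibleSet (coordProj S u) (chartGrad D.lam S u)} := by
  rintro u ⟨hu, hx⟩ v ⟨hv, hy⟩ h
  obtain ⟨h1, h2⟩ := (hD.mem_feasibleSet_iff hσ).1 hx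
  obtain ⟨h3, h4⟩ := (hD.mem_feasibleSet_iff hσ).1 hy
  simp only at h
  have e1 : coordProj S u = coordProj S v := by rw [h1, h3, h]
  refine chart_injective e1 (lam := D.lam) ?_
  have a := (hD.eq_gradient_perturbedLoss_iff hσ h2.1 (x := x) (g := chartGrad D.lam S u)).2 rfl
  have b := (hD.eq_gradient_perturbedLoss_iff hσ h4.1 (x := x) (g := chartGrad D.lam S v)).2 rfl
  rw [a, b, h, e1]

end TwiceDifferentiable

end PenalizedModel

/-! ### The joint law of the data, the estimator and its gradient -/

namespace PenalizedModel

variable {d : ℕ} {X : Type*} [MeasurableSpace X] {D : PenalizedModel d X}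

variable (D) in
/-- The event that the solver returns a strict second-order stationary point. -/
def ssospEvent : Set (X × Vec d) := {q | D.IsSSOSP q.1 q.2 (D.θhat q.1 q.2)}

variable (D) in
/-- The density, in the coordinates of a chart, of the data together with the estimator and its
gradient. -/
def jointWeight (θ₀ : Vec d) (t : X × Vec d × Vec d) : ℝ≥0∞ :=
  ENNReal.ofReal (D.f t.1 θ₀) * ((ENNReal.ofReal (D.Θ.indicator (D.f t.1) t.2.1))⁻¹ *
    ENNReal.ofReal (D.unnormDensity t.2.1 t.2.2 t.1))

namespace TwiceDifferentiable

variable (hD : D.TwiceDifferentiable) (hlam : 0 ≤ D.lam) (hσ : 0 < D.σ) (hs : D.MeasurableSolver)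
include hD

include hlam hs in
lemma measurableSet_ssospEvent : MeasurableSet D.ssospEvent :=
  (hD.measurableSet_isSSOSP hlam).preimage
    (measurable_fst.prodMk (measurable_snd.prodMk hs.1))

include hs in
lemma measurable_ghat : Measurable fun q : X × Vec d => D.ghat q.1 q.2 := by
  have h : (fun q : X × Vec d => D.ghat q.1 q.2) = fun q =>
      D.Θ.indicator (gradient (D.loss q.1)) (D.θhat q.1 q.2) + D.σ • q.2 := by
    ext1 q
    rw [ghat, hD.gradient_perturbedLoss _ _ (hs.2 _ _), indicator_of_mem (hs.2 _ _)]
  rw [h]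
  exact (hD.measurable_gradient.comp (measurable_fst.prodMk hs.1)).add (by fun_prop)

include hs in
lemma measurable_estimates :
    Measurable fun q : X × Vec d => (q.1, D.θhat q.1 q.2, D.ghat q.1 q.2) :=
  measurable_fst.prodMk (hs.1.prodMk (hD.measurable_ghat hs))

include hlam hσ hs in
lemma measurable_jointWeight {θ₀ : Vec d} (hθ₀ : θ₀ ∈ D.Θ) : Measurable (D.jointWeight θ₀) := by
  have h1 : Measurable fun t : X × Vec d × Vec d => D.Θ.indicator (D.f t.1) t.2.1 :=
    hD.measurable_density.comp (by fun_prop : Measurable fun t : X × Vec d × Vec d => (t.1, t.2.1))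
  have h2 := hD.measurable_unnormDensity hlam hσ hs
  have h3 : Measurable fun t : X × Vec d × Vec d => D.f t.1 θ₀ :=
    (hD.measurable_f θ₀ hθ₀).comp measurable_fst
  exact (ENNReal.measurable_ofReal.comp h3).mul ((ENNReal.measurable_ofReal.comp h1).inv.mul
    (ENNReal.measurable_ofReal.comp h2))

/-- The base measure is recovered from the probability measure P_{θ₀} by the density 1/f(·; θ₀).
This makes Tonelli's theorem available, although nothing is assumed about the base measure itself.
-/
lemma sFinite_base {θ₀ : Vec d} (hθ₀ : θ₀ ∈ D.Θ) : SFinite D.base := by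
  have := hD.isProbabilityMeasure θ₀ hθ₀
  have hm : Measurable fun x => ENNReal.ofReal (D.f x θ₀) :=
    ENNReal.measurable_ofReal.comp (hD.measurable_f θ₀ hθ₀)
  have h := withDensity_inv_same (μ := D.base) hm
    (.of_forall fun x => (ENNReal.ofReal_pos.2 (hD.f_pos θ₀ hθ₀ x)).ne')
    (.of_forall fun x => ENNReal.ofReal_ne_top)
  have h2 : SFinite ((D.P θ₀).withDensity (fun x => ENNReal.ofReal (D.f x θ₀))⁻¹) := inferInstance
  rw [← h]
  exact h2

include hlam hσ in
-- Jacobian times Gaussian noise density equals the plug-in density without its factor f(x; θ), up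
-- to a constant. This is why the determinant and the exponential appear in p_θ(· | θ, g).
lemma jacobian_mul_density {c : ℝ} (hc : 0 < c) {x : X} {θ g : Vec d}
    (hx : x ∈ D.feasibleSet θ g) (K : ℝ≥0∞) :
    ENNReal.ofReal (D.σ⁻¹ ^ d * (suppSubmatrix θ (hessian (D.loss x) θ)).det) *
      (ENNReal.ofReal (c * Real.exp (-(d / 2) * ‖D.noiseOf x θ g‖ ^ 2)) * K) =
    K * (ENNReal.ofReal (c * D.σ⁻¹ ^ d) * ((ENNReal.ofReal (D.Θ.indicator (D.f x) θ))⁻¹ *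
          ENNReal.ofReal (D.unnormDensity θ g x))) := by
  obtain ⟨h1, h2⟩ := (hD.mem_feasibleSet_iff hσ).1 hx
  have hθ := h2.1
  have hpd := ((hD.isSSOSP_iff hlam _ _ _).1 h2).2.2
  have hf := hD.f_pos _ hθ x
  have hnorm : -((d : ℝ) / 2) * ‖D.noiseOf x θ g‖ ^ 2 =
      -(‖g - gradient (D.loss x) θ‖ ^ 2 / (2 * D.σ ^ 2 / d)) := by
    rw [noiseOf, norm_smul, mul_pow, norm_inv, Real.norm_of_nonneg hσ.le]
    field_simp
  rw [unnormDensity, indicator_of_mem hx, indicator_of_mem hθ, hnorm]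
  set e := Real.exp (-(‖g - gradient (D.loss x) θ‖ ^ 2 / (2 * D.σ ^ 2 / d)))
  set dt := (suppSubmatrix θ (hessian (D.loss x) θ)).det
  have hdt : 0 < dt := hpd.det_pos
  have he : 0 < e := Real.exp_pos _
  set f := D.f x θ
  rw [← ENNReal.ofReal_inv_of_pos hf, ← ENNReal.ofReal_mul (by positivity),
    ← ENNReal.ofReal_mul (by positivity), ← mul_assoc, mul_comm,
    ← ENNReal.ofReal_mul (by positivity)]
  congr 2
  field_simp

include hlam hs in
lemma measurableSet_isSSOSP_support (x : X) (S : Finset (Fin d)) :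
    MeasurableSet {w | D.IsSSOSP x w (D.θhat x w) ∧ ∀ j, j ∈ S ↔ D.θhat x w j ≠ 0} := by
  have hx : Measurable fun w : Vec d => (x, w) := measurable_const.prodMk measurable_id
  exact ((hD.measurableSet_ssospEvent hlam hs).preimage hx).inter
    (measurableSet_support_eq (hs.1.comp hx) S)

include hlam hσ hs in
-- The change of variables on the event that the estimator has support S. The factor 1/f(x; θ) is
-- inserted to compensate the likelihood inside the unnormalized plug-in density.
lemma setLIntegral_noiseLaw_chart {c : ℝ} (hc : 0 < c) (hlaw : noiseLaw d = volume.withDensity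
      fun w => ENNReal.ofReal (c * Real.exp (-(d / 2) * ‖w‖ ^ 2)))
    (x : X) {F : Vec d × Vec d → ℝ≥0∞} (hF : Measurable F) (S : Finset (Fin d)) :
    ∫⁻ w in {w | D.IsSSOSP x w (D.θhat x w) ∧ ∀ j, j ∈ S ↔ D.θhat x w j ≠ 0},
        F (D.θhat x w, D.ghat x w) ∂(noiseLaw d) =
      ∫⁻ u in chartDomain S, F (coordProj S u, chartGrad D.lam S u) *
        (ENNReal.ofReal (c * D.σ⁻¹ ^ d) *
          ((ENNReal.ofReal (D.Θ.indicator (D.f x) (coordProj S u)))⁻¹ *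
          ENNReal.ofReal (D.unnormDensity (coordProj S u) (chartGrad D.lam S u) x))) := by
  have hx : Measurable fun w : Vec d => (x, w) := measurable_const.prodMk measurable_id
  have hθm : Measurable fun w => D.θhat x w := hs.1.comp hx
  have hgm : Measurable fun w => D.ghat x w :=
    Measurable.of_uncurry_left (f := D.ghat) (hD.measurable_ghat hs)
  have hFm : Measurable fun w => F (D.θhat x w, D.ghat x w) := hF.comp (hθm.prodMk hgm)
  have hE := hD.measurableSet_isSSOSP_support hlam hs x S
  have hdens : Measurable fun w : Vec d =>
      ENNReal.ofReal (c * Real.exp (-(d / 2) * ‖w‖ ^ 2)) := by fun_prop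
  rw [hlaw, setLIntegral_withDensity_eq_setLIntegral_mul _ hdens hFm hE]
  have hA : MeasurableSet {u | u ∈ chartDomain S ∧
      x ∈ D.feasibleSet (coordProj S u) (chartGrad D.lam S u)} :=
    (measurableSet_chartDomain S).inter
      ((hD.measurableSet_feasible hlam hσ hs).preimage
        (measurable_const.prodMk ((coordProj S).continuous.measurable.prodMk
          (measurable_chartGrad D.lam S)) :
          Measurable fun u : Vec d => (x, coordProj S u, chartGrad D.lam S u)))
  rw [← hD.image_noiseOf hlam hσ x S, lintegral_image_eq_lintegral_abs_det_fderiv_mul volume hA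
    (fun u hu => (hD.hasFDerivAt_noiseOf x hu.1
      ((hD.mem_feasibleSet_iff hσ).1 hu.2).2.1).hasFDerivWithinAt) (hD.injOn_noiseOf hσ x S)]
  rw [← lintegral_indicator hA, ← lintegral_indicator (measurableSet_chartDomain S)]
  refine lintegral_congr fun u => ?_
  by_cases hu : u ∈ chartDomain S ∧ x ∈ D.feasibleSet (coordProj S u) (chartGrad D.lam S u)
  · rw [indicator_of_mem (by exact hu), indicator_of_mem hu.1]
    obtain ⟨h1, h2⟩ := (hD.mem_feasibleSet_iff hσ).1 hu.2
    have hθ := h2.1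
    have hg : D.ghat x (D.noiseOf x (coordProj S u) (chartGrad D.lam S u)) = chartGrad D.lam S u := by
      rw [ghat, ← h1]
      exact ((hD.eq_gradient_perturbedLoss_iff hσ hθ).2 rfl).symm
    have hpd := ((hD.isSSOSP_iff hlam _ _ _).1 h2).2.2
    rw [abs_det_chart _ _ _ hσ, ← det_suppSubmatrix (coordProj_support hu.1),
      abs_of_pos hpd.det_pos, Pi.mul_apply]
    simp only [← h1, hg]
    exact hD.jacobian_mul_density hlam hσ hc hu.2 _
  · rw [indicator_of_notMem (by exact hu)]
    by_cases hu' : u ∈ chartDomain S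
    · rw [indicator_of_mem hu', unnormDensity, indicator_of_notMem (fun h => hu ⟨hu', h⟩)]
      simp
    · rw [indicator_of_notMem hu']

include hlam hσ hs in
/-- The law of the estimator and its gradient, given the data, in chart coordinates. -/
lemma setLIntegral_noiseLaw {c : ℝ} (hc : 0 < c) (hlaw : noiseLaw d = volume.withDensity
      fun w => ENNReal.ofReal (c * Real.exp (-(d / 2) * ‖w‖ ^ 2)))
    (x : X) {F : Vec d × Vec d → ℝ≥0∞} (hF : Measurable F) :
    ∫⁻ w in {w | D.IsSSOSP x w (D.θhat x w)}, F (D.θhat x w, D.ghat x w) ∂(noiseLaw d) =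
      ∑ S : Finset (Fin d), ∫⁻ u in chartDomain S, F (coordProj S u, chartGrad D.lam S u) *
        (ENNReal.ofReal (c * D.σ⁻¹ ^ d) *
          ((ENNReal.ofReal (D.Θ.indicator (D.f x) (coordProj S u)))⁻¹ *
          ENNReal.ofReal (D.unnormDensity (coordProj S u) (chartGrad D.lam S u) x))) := by
  have hU : {w | D.IsSSOSP x w (D.θhat x w)} = ⋃ S : Finset (Fin d),
      {w | D.IsSSOSP x w (D.θhat x w) ∧ ∀ j, j ∈ S ↔ D.θhat x w j ≠ 0} := by
    ext w
    simp only [mem_iUnion, mem_ofPred_eq]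
    exact ⟨fun h => ⟨Finset.univ.filter fun j => D.θhat x w j ≠ 0, h, fun j => by simp⟩,
      fun ⟨_, h, _⟩ => h⟩
  have hdisj : Pairwise (Function.onFun Disjoint fun S : Finset (Fin d) =>
      {w | D.IsSSOSP x w (D.θhat x w) ∧ ∀ j, j ∈ S ↔ D.θhat x w j ≠ 0}) := by
    intro S T hne
    refine Set.disjoint_left.2 fun w hw hw' => hne ?_
    ext j
    exact (hw.2 j).trans (hw'.2 j).symm
  rw [hU, lintegral_iUnion (hD.measurableSet_isSSOSP_support hlam hs x) hdisj, tsum_fintype]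
  exact Finset.sum_congr rfl fun S _ => hD.setLIntegral_noiseLaw_chart hlam hσ hs hc hlaw x hF S

include hlam hσ hs in
/-- The joint law of the data, the estimator and its gradient, in chart coordinates. -/
lemma setLIntegral_dataLaw {c : ℝ} (hc : 0 < c) (hlaw : noiseLaw d = volume.withDensity
      fun w => ENNReal.ofReal (c * Real.exp (-(d / 2) * ‖w‖ ^ 2)))
    {θ₀ : Vec d} (hθ₀ : θ₀ ∈ D.Θ) {Φ : X × Vec d × Vec d → ℝ≥0∞} (hΦ : Measurable Φ) :
    ∫⁻ q in D.ssospEvent, Φ (q.1, D.θhat q.1 q.2, D.ghat q.1 q.2) ∂(D.dataLaw θ₀) =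
      ENNReal.ofReal (c * D.σ⁻¹ ^ d) * ∑ S : Finset (Fin d), ∫⁻ u in chartDomain S,
        ∫⁻ x, Φ (x, coordProj S u, chartGrad D.lam S u) *
          D.jointWeight θ₀ (x, coordProj S u, chartGrad D.lam S u) ∂D.base := by
  have hbase := hD.sFinite_base hθ₀
  have := hD.isProbabilityMeasure θ₀ hθ₀
  have hE := hD.measurableSet_ssospEvent hlam hs
  have hΦm : Measurable fun q : X × Vec d => Φ (q.1, D.θhat q.1 q.2, D.ghat q.1 q.2) :=
    hΦ.comp (hD.measurable_estimates hs)
  have hfm : Measurable fun x => ENNReal.ofReal (D.f x θ₀) :=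
    ENNReal.measurable_ofReal.comp (hD.measurable_f θ₀ hθ₀)
  set C := ENNReal.ofReal (c * D.σ⁻¹ ^ d)
  have hJ := hD.measurable_jointWeight hlam hσ hs hθ₀
  have hmeas : ∀ S, Measurable fun p : X × Vec d =>
      Φ (p.1, coordProj S p.2, chartGrad D.lam S p.2) *
          D.jointWeight θ₀ (p.1, coordProj S p.2, chartGrad D.lam S p.2) := by
    intro S
    have h : Measurable fun p : X × Vec d => (p.1, coordProj S p.2, chartGrad D.lam S p.2) :=
      measurable_fst.prodMk (((coordProj S).continuous.measurable.comp measurable_snd).prodMk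
        ((measurable_chartGrad D.lam S).comp measurable_snd))
    exact (hΦ.comp h).mul (hJ.comp h)
  have hin : Measurable fun x => ∫⁻ w, D.ssospEvent.indicator
      (fun q => Φ (q.1, D.θhat q.1 q.2, D.ghat q.1 q.2)) (x, w) ∂(noiseLaw d) :=
    (hΦm.indicator hE).lintegral_prod_right'
  rw [← lintegral_indicator hE, dataLaw, lintegral_prod _ (hΦm.indicator hE).aemeasurable, P,
    lintegral_withDensity_eq_lintegral_mul _ hfm hin]
  have key : ∀ x, ((fun x => ENNReal.ofReal (D.f x θ₀)) * fun x => ∫⁻ w, D.ssospEvent.indicator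
      (fun q => Φ (q.1, D.θhat q.1 q.2, D.ghat q.1 q.2)) (x, w) ∂(noiseLaw d)) x =
      C * ∑ S : Finset (Fin d), ∫⁻ u in chartDomain S,
        Φ (x, coordProj S u, chartGrad D.lam S u) *
          D.jointWeight θ₀ (x, coordProj S u, chartGrad D.lam S u) := by
    intro x
    have h1 : ∫⁻ w, D.ssospEvent.indicator
      (fun q => Φ (q.1, D.θhat q.1 q.2, D.ghat q.1 q.2)) (x, w) ∂(noiseLaw d) =
        ∫⁻ w in {w | D.IsSSOSP x w (D.θhat x w)}, Φ (x, D.θhat x w, D.ghat x w) ∂(noiseLaw d) := by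
      have hEx : MeasurableSet {w | D.IsSSOSP x w (D.θhat x w)} :=
        hE.preimage (measurable_const.prodMk measurable_id : Measurable fun w : Vec d => (x, w))
      rw [← lintegral_indicator hEx]
      rfl
    rw [Pi.mul_apply, h1, hD.setLIntegral_noiseLaw hlam hσ hs hc hlaw x
      (F := fun p => Φ (x, p)) (hΦ.comp (measurable_const.prodMk measurable_id)),
      Finset.mul_sum, Finset.mul_sum]
    refine Finset.sum_congr rfl fun S _ => ?_
    have hmx : Measurable fun u => Φ (x, coordProj S u, chartGrad D.lam S u) *
        D.jointWeight θ₀ (x, coordProj S u, chartGrad D.lam S u) := (hmeas S).comp (measurable_const.prodMk measurable_id :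
        Measurable fun w : Vec d => (x, w))
    rw [← lintegral_const_mul' _ _ ENNReal.ofReal_ne_top, ← lintegral_const_mul _ hmx]
    refine lintegral_congr fun u => ?_
    simp only [jointWeight]
    ring
  rw [lintegral_congr key, lintegral_const_mul]
  · congr 1
    rw [lintegral_finsetSum]
    · refine Finset.sum_congr rfl fun S _ => ?_
      rw [lintegral_lintegral_swap (hmeas S).aemeasurable]
    · intro S _
      exact (hmeas S).lintegral_prod_right'
  · refine Finset.measurable_sum _ fun S _ => ?_
    exact (hmeas S).lintegral_prod_right'

end TwiceDifferentiable

end PenalizedModel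

/-! ### The tilted law and its distance to the law of the procedure -/

section ConsLaw

variable {X Y : Type*} [MeasurableSpace X] [MeasurableSpace Y] {M : ℕ}

lemma measurable_fin_cons : Measurable fun p : X × (Fin M → X) =>
    (Fin.cons p.1 p.2 : Fin (M + 1) → X) := by
  refine measurable_pi_lambda _ fun i => ?_
  refine Fin.cases ?_ (fun j => ?_) i
  · simpa using measurable_fst
  · simp only [Fin.cons_succ]
    exact (measurable_pi_apply j).comp measurable_snd

lemma consLaw_apply (x : X) (q : Measure (Fin M → X)) {A : Set (Fin (M + 1) → X)}
    (hA : MeasurableSet A) : consLaw x q A = q {z | (Fin.cons x z : Fin (M + 1) → X) ∈ A} :=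
  Measure.map_apply (measurable_fin_cons.comp (measurable_const.prodMk measurable_id)) hA

lemma consLaw_dirac (x : X) :
    consLaw x (Measure.dirac fun _ : Fin M => x) = Measure.dirac fun _ : Fin (M + 1) => x := by
  have h : Measurable fun z : Fin M → X => (Fin.cons x z : Fin (M + 1) → X) :=
    measurable_fin_cons.comp (measurable_const.prodMk measurable_id)
  rw [consLaw, Measure.map_dirac' h]
  congr 1
  ext i
  refine Fin.cases rfl (fun j => rfl) i

lemma measurable_consLaw {t : Y → X} (ht : Measurable t) (κ : Kernel Y (Fin M → X))
    [IsSFiniteKernel κ] : Measurable fun y => consLaw (t y) (κ y) := by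
  refine Measure.measurable_of_measurable_coe _ fun A hA => ?_
  simp only [consLaw_apply _ _ hA]
  have hm : Measurable fun p : Y × (Fin M → X) => (Fin.cons (t p.1) p.2 : Fin (M + 1) → X) :=
    measurable_fin_cons.comp ((ht.comp measurable_fst).prodMk measurable_snd)
  exact Kernel.measurable_kernel_prodMk_left (κ := κ) (hm hA)

instance isProbabilityMeasure_consLaw (x : X) (q : Measure (Fin M → X)) [IsProbabilityMeasure q] :
    IsProbabilityMeasure (consLaw x q) :=
  Measure.isProbabilityMeasure_map
    (measurable_fin_cons.comp (measurable_const.prodMk measurable_id)).aemeasurable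

lemma measurable_permute {k : ℕ} (π : Equiv.Perm (Fin k)) :
    Measurable fun (z : Fin k → X) i => z (π i) :=
  measurable_pi_lambda _ fun _ => measurable_pi_apply _

end ConsLaw

namespace PenalizedModel

variable {d : ℕ} {X : Type*} [MeasurableSpace X] {D : PenalizedModel d X}

variable (D) in
/-- The likelihood ratio between the parameters `θ` and `θ₀`, times `exp (k θ g)`. -/
def tilt (θ₀ : Vec d) (k : Vec d × Vec d → ℝ) (t : X × Vec d × Vec d) : ℝ≥0∞ :=
  ENNReal.ofReal (D.Θ.indicator (D.f t.1) t.2.1) / ENNReal.ofReal (D.f t.1 θ₀) *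
    ENNReal.ofReal (Real.exp (k t.2))

variable (D) in
/-- The data together with the estimator and its gradient. -/
def estimates (q : X × Vec d) : X × Vec d × Vec d := (q.1, D.θhat q.1 q.2, D.ghat q.1 q.2)

variable (D) in
/-- The event that the solver returns a strict second-order stationary point in `G`. -/
def goodEvent (G : Set (Vec d)) : Set (X × Vec d) := D.ssospEvent ∩ {q | D.θhat q.1 q.2 ∈ G}

namespace TwiceDifferentiable

variable (hD : D.TwiceDifferentiable) (hlam : 0 ≤ D.lam) (hσ : 0 < D.σ) (hs : D.MeasurableSolver)
  {θ₀ : Vec d} (hθ₀ : θ₀ ∈ D.Θ) {k : Vec d × Vec d → ℝ} (hk : Measurable k)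
  {G : Set (Vec d)} (hG : MeasurableSet G) {M : ℕ} {κ : Kernel (X × Vec d × Vec d) (Fin M → X)}
include hD

include hs in
lemma measurable_estimates' : Measurable D.estimates := hD.measurable_estimates hs

include hlam hs hG in
lemma measurableSet_goodEvent : MeasurableSet (D.goodEvent G) :=
  (hD.measurableSet_ssospEvent hlam hs).inter (hs.1 hG)

include hθ₀ hk in
lemma measurable_tilt : Measurable (D.tilt θ₀ k) := by
  have h1 : Measurable fun t : X × Vec d × Vec d => D.Θ.indicator (D.f t.1) t.2.1 :=
    hD.measurable_density.comp (by fun_prop : Measurable fun t : X × Vec d × Vec d => (t.1, t.2.1))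
  have h2 : Measurable fun t : X × Vec d × Vec d => D.f t.1 θ₀ :=
    (hD.measurable_f θ₀ hθ₀).comp measurable_fst
  unfold tilt
  exact ((ENNReal.measurable_ofReal.comp h1).div (ENNReal.measurable_ofReal.comp h2)).mul
    (by fun_prop)

include hσ hθ₀ in
-- The likelihood ratios cancel, so after tilting the density in x at fixed (θ, g) is the plug-in
-- density times a factor that does not involve x.
lemma tilt_mul_jointWeight (t : X × Vec d × Vec d) :
    D.tilt θ₀ k t * D.jointWeight θ₀ t =
      ENNReal.ofReal (Real.exp (k t.2)) * ENNReal.ofReal (D.unnormDensity t.2.1 t.2.2 t.1) := by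
  by_cases hθ : t.2.1 ∈ D.Θ
  · have h0 := hD.f_pos _ hθ₀ t.1
    have h1 := hD.f_pos _ hθ t.1
    rw [tilt, jointWeight, indicator_of_mem hθ]
    set a := ENNReal.ofReal (D.f t.1 t.2.1) with ha
    set b := ENNReal.ofReal (D.f t.1 θ₀) with hb
    have ha0 : a ≠ 0 := (ENNReal.ofReal_pos.2 h1).ne'
    have hb0 : b ≠ 0 := (ENNReal.ofReal_pos.2 h0).ne'
    have ha' : a * a⁻¹ = 1 := ENNReal.mul_inv_cancel ha0 ENNReal.ofReal_ne_top
    have hb' : b * b⁻¹ = 1 := ENNReal.mul_inv_cancel hb0 ENNReal.ofReal_ne_top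
    rw [div_eq_mul_inv]
    calc _ = (a * a⁻¹) * (b * b⁻¹) * (ENNReal.ofReal (Real.exp (k t.2)) *
          ENNReal.ofReal (D.unnormDensity t.2.1 t.2.2 t.1)) := by ring
      _ = _ := by rw [ha', hb', one_mul, one_mul]
  · have h0 : D.unnormDensity t.2.1 t.2.2 t.1 = 0 := by
      rw [unnormDensity, indicator_of_notMem]
      exact fun h => hθ ((hD.mem_feasibleSet_iff hσ).1 h).2.1
    rw [jointWeight, h0]
    simp

include hlam hσ hs in
/-- Exchangeability of the unnormalized plug-in law. -/
lemma lintegral_unnormDensity_permute [IsMarkovKernel κ] (hκ : D.ValidSampler κ) {θ g : Vec d}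
    (hθ : θ ∈ D.Θ) (hfin : D.normConst θ g ≠ ∞) (π : Equiv.Perm (Fin (M + 1)))
    {A : Set (Fin (M + 1) → X)} (hA : MeasurableSet A) :
    ∫⁻ x, ENNReal.ofReal (D.unnormDensity θ g x) *
      consLaw x (κ (x, θ, g)) ((fun z i => z (π i)) ⁻¹' A) ∂D.base =
    ∫⁻ x, ENNReal.ofReal (D.unnormDensity θ g x) * consLaw x (κ (x, θ, g)) A ∂D.base := by
  have hx : Measurable fun x : X => (x, θ, g) := measurable_id.prodMk measurable_const
  have hu : Measurable fun x => ENNReal.ofReal (D.unnormDensity θ g x) :=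
    ENNReal.measurable_ofReal.comp ((hD.measurable_unnormDensity hlam hσ hs).comp hx)
  have hc : Measurable fun x => consLaw x (κ (x, θ, g)) :=
    (measurable_consLaw measurable_fst κ).comp hx
  by_cases h0 : D.normConst θ g = 0
  · have hz : (fun x => ENNReal.ofReal (D.unnormDensity θ g x)) =ᵐ[D.base] 0 :=
      (lintegral_eq_zero_iff hu).1 h0
    refine lintegral_congr_ae ?_
    filter_upwards [hz] with x hx
    simp only [Pi.zero_apply] at hx
    rw [hx, zero_mul, zero_mul]
  · have hex := hκ θ hθ g h0 hfin π
    have hπ := measurable_permute (X := X) π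
    have h1 : ∀ A : Set (Fin (M + 1) → X), MeasurableSet A →
        ((D.condLaw θ g).bind fun x => consLaw x (κ (x, θ, g))) A = (D.normConst θ g)⁻¹ *
        ∫⁻ x, ENNReal.ofReal (D.unnormDensity θ g x) * consLaw x (κ (x, θ, g)) A ∂D.base := by
      intro A hA
      have hcA : Measurable fun x => consLaw x (κ (x, θ, g)) A :=
        (Measure.measurable_coe hA).comp hc
      rw [Measure.bind_apply hA hc.aemeasurable, condLaw, lintegral_smul_measure,
        lintegral_withDensity_eq_lintegral_mul _ hu hcA]
      rfl
    have h2 := congrArg (fun m : Measure (Fin (M + 1) → X) => m A) hex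
    rw [Measure.map_apply hπ hA, h1 _ (hπ hA), h1 _ hA] at h2
    exact (ENNReal.mul_right_inj (ENNReal.inv_ne_zero.2 hfin) (ENNReal.inv_ne_top.2 h0)).1 h2

include hlam hσ hs hθ₀ hk hG in
/-- Exchangeability of the tilted law on the good event. -/
lemma setLIntegral_tilt_permute (hd : 1 ≤ d) [IsMarkovKernel κ] (hκ : D.ValidSampler κ)
    (hfin : ∫⁻ q in D.goodEvent G, D.tilt θ₀ k (D.estimates q) ∂(D.dataLaw θ₀) ≠ ∞)
    (π : Equiv.Perm (Fin (M + 1))) {A : Set (Fin (M + 1) → X)} (hA : MeasurableSet A) :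
    ∫⁻ q in D.goodEvent G, D.tilt θ₀ k (D.estimates q) *
      consLaw q.1 (κ (D.estimates q)) ((fun z i => z (π i)) ⁻¹' A) ∂(D.dataLaw θ₀) =
    ∫⁻ q in D.goodEvent G, D.tilt θ₀ k (D.estimates q) *
      consLaw q.1 (κ (D.estimates q)) A ∂(D.dataLaw θ₀) := by
  obtain ⟨c, hc, hlaw⟩ := exists_noiseLaw_eq_withDensity hd
  have hπ := measurable_permute (X := X) π
  have htilt := hD.measurable_tilt hθ₀ hk
  have hGm : MeasurableSet {t : X × Vec d × Vec d | t.2.1 ∈ G} :=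
    (measurable_fst.comp measurable_snd) hG
  have hcons : ∀ B : Set (Fin (M + 1) → X), MeasurableSet B →
      Measurable fun t : X × Vec d × Vec d => consLaw t.1 (κ t) B := fun B hB =>
    (Measure.measurable_coe hB).comp (measurable_consLaw measurable_fst κ)
  have hΦ : ∀ B : Set (Fin (M + 1) → X), MeasurableSet B →
      Measurable ({t : X × Vec d × Vec d | t.2.1 ∈ G}.indicator fun t =>
        D.tilt θ₀ k t * consLaw t.1 (κ t) B) := fun B hB =>
    (htilt.mul (hcons B hB)).indicator hGm
  have hrep : ∀ B : Set (Fin (M + 1) → X), MeasurableSet B →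
      ∫⁻ q in D.goodEvent G, D.tilt θ₀ k (D.estimates q) *
        consLaw q.1 (κ (D.estimates q)) B ∂(D.dataLaw θ₀) =
      ENNReal.ofReal (c * D.σ⁻¹ ^ d) * ∑ S : Finset (Fin d), ∫⁻ u in chartDomain S,
        G.indicator (fun _ => ENNReal.ofReal (Real.exp (k (coordProj S u, chartGrad D.lam S u))) *
          ∫⁻ x, ENNReal.ofReal (D.unnormDensity (coordProj S u) (chartGrad D.lam S u) x) *
            consLaw x (κ (x, coordProj S u, chartGrad D.lam S u)) B ∂D.base) (coordProj S u) := by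
    intro B hB
    have e1 : ∫⁻ q in D.goodEvent G, D.tilt θ₀ k (D.estimates q) *
        consLaw q.1 (κ (D.estimates q)) B ∂(D.dataLaw θ₀) =
        ∫⁻ q in D.ssospEvent, ({t : X × Vec d × Vec d | t.2.1 ∈ G}.indicator fun t =>
        D.tilt θ₀ k t * consLaw t.1 (κ t) B) (q.1, D.θhat q.1 q.2, D.ghat q.1 q.2)
          ∂(D.dataLaw θ₀) := by
      have hGe : MeasurableSet {q : X × Vec d | D.θhat q.1 q.2 ∈ G} := hs.1 hG
      rw [goodEvent, inter_comm, ← Measure.restrict_restrict hGe, ← lintegral_indicator hGe]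
      rfl
    rw [e1, hD.setLIntegral_dataLaw hlam hσ hs hc hlaw hθ₀ (hΦ B hB)]
    congr 1
    refine Finset.sum_congr rfl fun S _ => lintegral_congr fun u => ?_
    by_cases hu : coordProj S u ∈ G
    · rw [indicator_of_mem hu, ← lintegral_const_mul' _ _ ENNReal.ofReal_ne_top]
      refine lintegral_congr fun x => ?_
      rw [indicator_of_mem (by exact hu), mul_right_comm, hD.tilt_mul_jointWeight hσ hθ₀]
      simp only
      ring
    · rw [indicator_of_notMem hu]
      refine (lintegral_congr fun x => ?_).trans lintegral_zero
      rw [indicator_of_notMem (by exact hu), zero_mul]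
  rw [hrep _ (hπ hA), hrep _ hA]
  have hC : ENNReal.ofReal (c * D.σ⁻¹ ^ d) ≠ 0 := (ENNReal.ofReal_pos.2 (by positivity)).ne'
  have hbase := hD.sFinite_base hθ₀
  have htot := hrep univ MeasurableSet.univ
  simp only [measure_univ, mul_one] at htot
  rw [htot] at hfin
  congr 1
  refine Finset.sum_congr rfl fun S _ => ?_
  have hsum : ∫⁻ u in chartDomain S,
        G.indicator (fun _ => ENNReal.ofReal (Real.exp (k (coordProj S u, chartGrad D.lam S u))) *
          ∫⁻ x, ENNReal.ofReal (D.unnormDensity (coordProj S u) (chartGrad D.lam S u) x) ∂D.base)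
          (coordProj S u) ≠ ∞ := by
    intro htop
    refine hfin ?_
    rw [ENNReal.mul_eq_top]
    left
    refine ⟨hC, ENNReal.sum_eq_top.2 ⟨S, Finset.mem_univ _, htop⟩⟩
  have hmap : Measurable fun u : Vec d => (coordProj S u, chartGrad D.lam S u) :=
    (coordProj S).continuous.measurable.prodMk (measurable_chartGrad D.lam S)
  have hmeas : Measurable fun u : Vec d =>
        G.indicator (fun _ => ENNReal.ofReal (Real.exp (k (coordProj S u, chartGrad D.lam S u))) *
          ∫⁻ x, ENNReal.ofReal (D.unnormDensity (coordProj S u) (chartGrad D.lam S u) x) ∂D.base)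
          (coordProj S u) := by
    have h1 : Measurable fun p : Vec d × X =>
        ENNReal.ofReal (D.unnormDensity (coordProj S p.1) (chartGrad D.lam S p.1) p.2) :=
      ENNReal.measurable_ofReal.comp ((hD.measurable_unnormDensity hlam hσ hs).comp
        (measurable_snd.prodMk (hmap.comp measurable_fst)))
    have h2 := h1.lintegral_prod_right' (ν := D.base)
    have h3 : Measurable fun u : Vec d =>
        ENNReal.ofReal (Real.exp (k (coordProj S u, chartGrad D.lam S u))) :=
      ENNReal.measurable_ofReal.comp (Real.measurable_exp.comp (hk.comp hmap))
    exact (h3.mul h2).indicator ((coordProj S).continuous.measurable hG)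
  -- The sampler is only constrained where the normalizing constant is finite. Finiteness of the
  -- total tilted mass provides this for almost every chart point with θ in G, since the factor exp
  -- k is positive.
  have hae := ae_lt_top hmeas hsum
  refine lintegral_congr_ae ?_
  filter_upwards [hae] with u hu
  by_cases huG : coordProj S u ∈ G
  · rw [indicator_of_mem huG] at hu
    rw [indicator_of_mem huG, indicator_of_mem huG]
    by_cases hθ : coordProj S u ∈ D.Θ
    · congr 1
      refine hD.lintegral_unnormDensity_permute hlam hσ hs hκ hθ (fun htop => ?_) π hA
      rw [normConst] at htop
      rw [htop, ENNReal.mul_top (ENNReal.ofReal_pos.2 (Real.exp_pos _)).ne'] at hu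
      exact lt_irrefl _ hu
    · have h0 : ∀ x, D.unnormDensity (coordProj S u) (chartGrad D.lam S u) x = 0 := by
        intro x
        rw [unnormDensity, indicator_of_notMem]
        exact fun h => hθ ((hD.mem_feasibleSet_iff hσ).1 h).2.1
      simp [h0]
  · rw [indicator_of_notMem huG, indicator_of_notMem huG]

end TwiceDifferentiable

end PenalizedModel

/-! ### From a tilt to the error bound -/

namespace PenalizedModel

variable {d : ℕ} {X : Type*} [MeasurableSpace X] {D : PenalizedModel d X}

namespace TwiceDifferentiable

variable (hD : D.TwiceDifferentiable) (hlam : 0 ≤ D.lam) (hσ : 0 < D.σ) (hs : D.MeasurableSolver)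
  {θ₀ : Vec d} (hθ₀ : θ₀ ∈ D.Θ) {k : Vec d × Vec d → ℝ} (hk : Measurable k)
  {G : Set (Vec d)} (hG : MeasurableSet G) {M : ℕ} {κ : Kernel (X × Vec d × Vec d) (Fin M → X)}
include hD

include hθ₀ in
lemma isProbabilityMeasure_dataLaw : IsProbabilityMeasure (D.dataLaw θ₀) := by
  have := hD.isProbabilityMeasure θ₀ hθ₀
  rw [dataLaw]; infer_instance

include hs in
lemma measurable_consLaw_estimates [IsMarkovKernel κ] :
    Measurable fun q : X × Vec d => consLaw q.1 (κ (D.estimates q)) :=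
  (measurable_consLaw measurable_fst κ).comp (hD.measurable_estimates' hs)

omit hD in
lemma consLaw_copyLaw (q : X × Vec d) : consLaw q.1 (D.copyLaw κ q.1 q.2) =
    open Classical in if q ∈ D.ssospEvent then consLaw q.1 (κ (D.estimates q))
      else Measure.dirac fun _ => q.1 := by
  by_cases h : q ∈ D.ssospEvent
  · rw [if_pos h, copyLaw, if_pos (by exact h)]; rfl
  · rw [if_neg h, copyLaw, if_neg (by exact h), consLaw_dirac]

omit hD in
lemma measurable_dirac_const : Measurable fun q : X × Vec d =>
    Measure.dirac (fun _ : Fin (M + 1) => q.1) :=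
  Measure.measurable_dirac.comp (measurable_pi_lambda _ fun _ => measurable_fst)

include hlam hs in
lemma measurable_consLaw_copyLaw [IsMarkovKernel κ] :
    Measurable fun q : X × Vec d => consLaw q.1 (D.copyLaw κ q.1 q.2) := by
  classical
  rw [show (fun q : X × Vec d => consLaw q.1 (D.copyLaw κ q.1 q.2)) = _ from
    funext consLaw_copyLaw]
  exact Measurable.ite (hD.measurableSet_ssospEvent hlam hs) (hD.measurable_consLaw_estimates hs)
    measurable_dirac_const

instance isProbabilityMeasure_copyLaw [IsMarkovKernel κ] (x : X) (w : Vec d) :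
    IsProbabilityMeasure (D.copyLaw κ x w) := by
  rw [copyLaw]; split_ifs <;> infer_instance

include hlam hs hθ₀ in
lemma isProbabilityMeasure_acssLaw [IsMarkovKernel κ] :
    IsProbabilityMeasure (D.acssLaw κ θ₀) := by
  have := hD.isProbabilityMeasure_dataLaw hθ₀
  refine ⟨?_⟩
  rw [acssLaw, Measure.bind_apply MeasurableSet.univ
    (hD.measurable_consLaw_copyLaw hlam hs).aemeasurable]
  simp

include hσ hs hlam hθ₀ hk hG in
/-- The law of the procedure is close to exchangeable as soon as some tilt, by a function of the
estimator and its gradient, of the likelihood ratio is nearly constant. -/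
theorem errorBound_of_tilt (hd : 1 ≤ d) [IsMarkovKernel κ] (hκ : D.ValidSampler κ) {B : ℝ}
    (hB0 : 0 ≤ B) {Z : ℝ≥0∞}
    (hZ : Z = ∫⁻ q in D.goodEvent G, D.tilt θ₀ k (D.estimates q) ∂(D.dataLaw θ₀) +
      D.dataLaw θ₀ (D.goodEvent G)ᶜ) (hfin : Z ≠ ∞)
    (hB : ∫⁻ q in D.goodEvent G, (1 - D.tilt θ₀ k (D.estimates q) / Z) ∂(D.dataLaw θ₀) +
      D.dataLaw θ₀ (D.goodEvent G)ᶜ ≤ ENNReal.ofReal B) :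
    ErrorBound (D.acssLaw κ θ₀) B := by
  classical
  have hprob := hD.isProbabilityMeasure_dataLaw hθ₀
  have := hD.isProbabilityMeasure_acssLaw hlam hs hθ₀ (κ := κ)
  have hE := hD.measurableSet_goodEvent hlam hs hG
  set E := D.goodEvent G with hEdef
  set μ := D.dataLaw θ₀ with hμ
  set τ : X × Vec d → ℝ≥0∞ := fun q => D.tilt θ₀ k (D.estimates q) with hτ
  have hτm : Measurable τ := (hD.measurable_tilt hθ₀ hk).comp (hD.measurable_estimates' hs)
  have hτpos : ∀ q, τ q ≠ 0 := by
    intro q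
    have h1 : D.θhat q.1 q.2 ∈ D.Θ := hs.2 _ _
    simp only [hτ, tilt, estimates, indicator_of_mem h1]
    refine mul_ne_zero (ENNReal.div_ne_zero.2 ⟨(ENNReal.ofReal_pos.2 (hD.f_pos _ h1 _)).ne',
      ENNReal.ofReal_ne_top⟩) (ENNReal.ofReal_pos.2 (Real.exp_pos _)).ne'
  have hτfin : ∫⁻ q in E, τ q ∂μ ≠ ∞ := fun h => hfin (by rw [hZ, h]; simp)
  have hZ0 : Z ≠ 0 := by
    intro h0
    rw [h0] at hZ
    have hsum := add_eq_zero.1 hZ.symm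
    have hμE : μ E = 0 := by
      have h2 := (lintegral_eq_zero_iff hτm).1 hsum.1
      rw [Filter.EventuallyEq, ae_iff] at h2
      have h3 : {a | ¬ τ a = (0 : X × Vec d → ℝ≥0∞) a} = univ := by
        ext q; simp [hτpos q]
      rw [h3, Measure.restrict_apply_univ] at h2
      exact h2
    have : μ univ = 0 := by
      rw [← measure_add_measure_compl hE, hμE, hsum.2, add_zero]
    simp at this
  have hcm : Measurable fun q : X × Vec d => consLaw q.1 (κ (D.estimates q)) :=
    hD.measurable_consLaw_estimates hs
  have hdm := measurable_dirac_const (d := d) (X := X) (M := M)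
  -- The exchangeable reference law: the tilted law on the good event and the repeated data point
  -- off it, normalized by Z. Off the good event the repetition is used even where the solver found
  -- an SSOSP outside G; only the mass of that event enters the bound.
  set ρ : Measure (Fin (M + 1) → X) :=
    Z⁻¹ • (((μ.restrict E).withDensity τ).bind (fun q => consLaw q.1 (κ (D.estimates q))) +
      (μ.restrict Eᶜ).bind fun q => Measure.dirac fun _ => q.1) with hρ
  have hρA : ∀ A, MeasurableSet A → ρ A = Z⁻¹ * (∫⁻ q in E, τ q *
      consLaw q.1 (κ (D.estimates q)) A ∂μ +
      ∫⁻ q in Eᶜ, Measure.dirac (fun _ : Fin (M + 1) => q.1) A ∂μ) := by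
    intro A hA
    have hcA : Measurable fun q : X × Vec d => consLaw q.1 (κ (D.estimates q)) A :=
      (Measure.measurable_coe hA).comp hcm
    rw [hρ, Measure.smul_apply, Measure.add_apply, Measure.bind_apply hA hcm.aemeasurable,
      Measure.bind_apply hA hdm.aemeasurable,
      lintegral_withDensity_eq_lintegral_mul _ hτm hcA]
    rfl
  have hρprob : IsProbabilityMeasure ρ := by
    refine ⟨?_⟩
    rw [hρA _ MeasurableSet.univ]
    simp only [measure_univ, mul_one, lintegral_const, Measure.restrict_apply_univ, one_mul]
    rw [← hZ]
    exact ENNReal.inv_mul_cancel hZ0 hfin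
  have hρex : IsExchangeableLaw ρ := by
    intro π
    have hπ := measurable_permute (X := X) π
    refine Measure.ext fun A hA => ?_
    rw [Measure.map_apply hπ hA, hρA _ (hπ hA), hρA _ hA]
    congr 2
    · exact hD.setLIntegral_tilt_permute hlam hσ hs hθ₀ hk hG hd hκ hτfin π hA
    · refine lintegral_congr fun q => ?_
      rw [Measure.dirac_apply' _ (hπ hA), Measure.dirac_apply' _ hA]
      rfl
  refine errorBound_of_exchangeable hρex fun A hA => ?_
  have hcA : Measurable fun q : X × Vec d => consLaw q.1 (κ (D.estimates q)) A :=
    (Measure.measurable_coe hA).comp hcm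
  have hle1 : ∀ q : X × Vec d, consLaw q.1 (κ (D.estimates q)) A ≤ 1 := fun q => prob_le_one
  have hmain : D.acssLaw κ θ₀ A ≤ ρ A + ENNReal.ofReal B := by
    rw [acssLaw, Measure.bind_apply hA (hD.measurable_consLaw_copyLaw hlam hs).aemeasurable,
      ← lintegral_add_compl _ hE]
    have h1 : ∫⁻ q in E, consLaw q.1 (D.copyLaw κ q.1 q.2) A ∂μ ≤
        Z⁻¹ * ∫⁻ q in E, τ q * consLaw q.1 (κ (D.estimates q)) A ∂μ +
          ∫⁻ q in E, (1 - τ q / Z) ∂μ := by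
      have hm : Measurable fun q => τ q * consLaw q.1 (κ (D.estimates q)) A := hτm.mul hcA
      rw [← lintegral_const_mul _ hm, ← lintegral_add_left (hm.const_mul _)]
      refine setLIntegral_mono' hE fun q hq => ?_
      rw [consLaw_copyLaw, if_pos hq.1]
      set a := consLaw q.1 (κ (D.estimates q)) A
      -- Splitting 1 ≤ τ/Z + (1 - τ/Z), with truncated subtraction: the first part reproduces the
      -- reference law, and the second is the loss, where a ≤ 1 is discarded.
      calc a = a * 1 := (mul_one a).symm
        _ ≤ a * (τ q / Z + (1 - τ q / Z)) := by gcongr; exact le_add_tsub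
        _ = Z⁻¹ * (τ q * a) + a * (1 - τ q / Z) := by rw [mul_add, div_eq_mul_inv]; ring
        _ ≤ Z⁻¹ * (τ q * a) + 1 * (1 - τ q / Z) := by gcongr; exact hle1 q
        _ = _ := by rw [one_mul]
    have h2 : ∫⁻ q in Eᶜ, consLaw q.1 (D.copyLaw κ q.1 q.2) A ∂μ ≤ μ Eᶜ := by
      calc _ ≤ ∫⁻ _q in Eᶜ, 1 ∂μ := lintegral_mono fun q => prob_le_one
        _ = μ Eᶜ := by simp
    calc _ ≤ (Z⁻¹ * ∫⁻ q in E, τ q * consLaw q.1 (κ (D.estimates q)) A ∂μ +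
          ∫⁻ q in E, (1 - τ q / Z) ∂μ) + μ Eᶜ := add_le_add h1 h2
      _ = Z⁻¹ * ∫⁻ q in E, τ q * consLaw q.1 (κ (D.estimates q)) A ∂μ +
          (∫⁻ q in E, (1 - τ q / Z) ∂μ + μ Eᶜ) := by rw [add_assoc]
      _ ≤ ρ A + ENNReal.ofReal B := by
          refine add_le_add ?_ hB
          rw [hρA _ hA]
          gcongr
          exact le_self_add
  have h3 := ENNReal.toReal_mono (by finiteness) hmain
  rwa [ENNReal.toReal_add (by finiteness) (by finiteness), ENNReal.toReal_ofReal hB0] at h3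

end TwiceDifferentiable

end PenalizedModel

/-! ### Quadratic forms, largest eigenvalues and Taylor's formula -/

section Quadratic

variable {d : ℕ}

/-- The quadratic form of a matrix. -/
def quadForm (A : Matrix (Fin d) (Fin d) ℝ) (v : Vec d) : ℝ := ∑ i, ∑ j, v i * v j * A i j

lemma quadForm_sub (A B : Matrix (Fin d) (Fin d) ℝ) (v : Vec d) :
    quadForm (A - B) v = quadForm A v - quadForm B v := by
  simp only [quadForm, Matrix.sub_apply, mul_sub, Finset.sum_sub_distrib]

lemma fderiv_fderiv_eq_quadForm (F : Vec d → ℝ) (θ v : Vec d) :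
    fderiv ℝ (fderiv ℝ F) θ v v = quadForm (hessian F θ) v := by
  have hv : v = ∑ i, v i • EuclideanSpace.single i (1 : ℝ) := by
    conv_lhs => rw [← (EuclideanSpace.basisFun (Fin d) ℝ).sum_repr v]
    simp
  conv_lhs => rw [hv]
  simp only [map_sum, map_smul, FunLike.coe_sum, Finset.sum_apply, FunLike.coe_smul, Pi.smul_apply,
    smul_eq_mul, quadForm, hessian, Matrix.of_apply, Finset.mul_sum]
  rw [Finset.sum_comm]
  refine Finset.sum_congr rfl fun i _ => Finset.sum_congr rfl fun j _ => by ring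

/-- The spectrum of λ_max·1 - A is the shifted reflection of the spectrum of A and hence
nonnegative, so this Hermitian matrix is positive semidefinite. -/
lemma quadForm_le_lambdaMax [NeZero d] {A : Matrix (Fin d) (Fin d) ℝ} (hA : A.IsHermitian)
    (v : Vec d) : quadForm A v ≤ lambdaMax A * ‖v‖ ^ 2 := by
  have hspec : spectrum ℝ A = range hA.eigenvalues := hA.spectrum_real_eq_range_eigenvalues
  have hmax : ∀ i, hA.eigenvalues i ≤ lambdaMax A := fun i => by
    rw [lambdaMax, hspec]
    exact le_csSup (finite_range _).bddAbove (mem_range_self i)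
  have hps : (lambdaMax A • (1 : Matrix (Fin d) (Fin d) ℝ) - A).PosSemidef := by
    have hherm : (lambdaMax A • (1 : Matrix (Fin d) (Fin d) ℝ) - A).IsHermitian := by
      refine Matrix.IsHermitian.sub ?_ hA
      rw [Matrix.IsHermitian, Matrix.conjTranspose_smul, Matrix.conjTranspose_one]; simp
    rw [hherm.posSemidef_iff_eigenvalues_nonneg]
    have hnn : ∀ e ∈ spectrum ℝ (lambdaMax A • (1 : Matrix (Fin d) (Fin d) ℝ) - A), 0 ≤ e := by
      intro e he
      rw [← Algebra.algebraMap_eq_smul_one, ← spectrum.singleton_sub_eq, hspec] at he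
      obtain ⟨a, ha, b, ⟨j, rfl⟩, hab⟩ := he
      rw [mem_singleton_iff] at ha
      simp only at hab
      rw [← hab, ha]
      linarith [hmax j]
    intro i
    refine hnn _ ?_
    rw [hherm.spectrum_real_eq_range_eigenvalues]
    exact mem_range_self i
  have h := hps.dotProduct_mulVec_nonneg (v.ofLp)
  have e1 : star v.ofLp ⬝ᵥ ((lambdaMax A • (1 : Matrix (Fin d) (Fin d) ℝ) - A).mulVec v.ofLp) =
      lambdaMax A * ‖v‖ ^ 2 - quadForm A v := by
    rw [Matrix.sub_mulVec, dotProduct_sub, Matrix.smul_mulVec, Matrix.one_mulVec, dotProduct_smul,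
      EuclideanSpace.norm_sq_eq]
    congr 1
    · simp [dotProduct, sq]
    · simp only [dotProduct, Matrix.mulVec, quadForm, Finset.mul_sum]
      refine Finset.sum_congr rfl fun i _ => Finset.sum_congr rfl fun j _ => ?_
      simp; ring
  rw [e1] at h
  linarith

lemma isHermitian_hessian {F : Vec d → ℝ} {Θ : Set (Vec d)} (hΘ : IsOpen Θ)
    (hF : DifferentiableOn ℝ F Θ) (hF' : DifferentiableOn ℝ (fderiv ℝ F) Θ) {θ : Vec d}
    (hθ : θ ∈ Θ) : (hessian F θ).IsHermitian := by
  refine Matrix.IsHermitian.ext fun i j => ?_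
  simp only [hessian, Matrix.of_apply, star_trivial]
  refine second_derivative_symmetric_of_eventually (𝕜 := ℝ) (f := F) (f' := fderiv ℝ F) (x := θ) ?_
    ((hF'.differentiableAt (hΘ.mem_nhds hθ)).hasFDerivAt) _ _
  filter_upwards [hΘ.mem_nhds hθ] with η hη
  exact (hF.differentiableAt (hΘ.mem_nhds hη)).hasFDerivAt

lemma hessian_sub {F G : Vec d → ℝ} {Θ : Set (Vec d)} (hΘ : IsOpen Θ)
    (hF : DifferentiableOn ℝ F Θ) (hF' : DifferentiableOn ℝ (fderiv ℝ F) Θ)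
    (hG : DifferentiableOn ℝ G Θ) (hG' : DifferentiableOn ℝ (fderiv ℝ G) Θ) {θ : Vec d}
    (hθ : θ ∈ Θ) : hessian (fun η => F η - G η) θ = hessian F θ - hessian G θ := by
  have h : fderiv ℝ (fun η => F η - G η) =ᶠ[nhds θ] fun η => fderiv ℝ F η - fderiv ℝ G η := by
    filter_upwards [hΘ.mem_nhds hθ] with η hη
    exact fderiv_fun_sub (hF.differentiableAt (hΘ.mem_nhds hη))
      (hG.differentiableAt (hΘ.mem_nhds hη))
  ext i j
  simp only [hessian, Matrix.of_apply, Matrix.sub_apply]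
  rw [h.fderiv_eq, fderiv_fun_sub (hF'.differentiableAt (hΘ.mem_nhds hθ))
    (hG'.differentiableAt (hΘ.mem_nhds hθ))]
  rfl

lemma segment_mem {Θ : Set (Vec d)} (hc : Convex ℝ Θ) {θ θ₀ : Vec d} (h : θ ∈ Θ) (h₀ : θ₀ ∈ Θ)
    {t : ℝ} (ht : t ∈ Icc (0 : ℝ) 1) : θ + t • (θ₀ - θ) ∈ Θ :=
  hc.add_smul_sub_mem h h₀ ht

lemma continuousOn_quadForm_hessian {F : Vec d → ℝ} {Θ : Set (Vec d)} (hΘ : IsOpen Θ)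
    (hc : Convex ℝ Θ) (hF : ContDiffOn ℝ 2 F Θ) {θ θ₀ : Vec d} (h : θ ∈ Θ) (h₀ : θ₀ ∈ Θ) :
    ContinuousOn (fun t : ℝ => quadForm (hessian F (θ + t • (θ₀ - θ))) (θ₀ - θ)) (Icc 0 1) := by
  have h1 : ContDiffOn ℝ 1 (fderiv ℝ F) Θ := hF.fderiv_of_isOpen hΘ (by norm_num)
  have h2 : ContinuousOn (fderiv ℝ (fderiv ℝ F)) Θ :=
    h1.continuousOn_fderiv_of_isOpen hΘ (by norm_num)
  simp only [← fderiv_fderiv_eq_quadForm]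
  have h3 : ContinuousOn (fun t : ℝ => fderiv ℝ (fderiv ℝ F) (θ + t • (θ₀ - θ))) (Icc 0 1) :=
    h2.comp (by fun_prop) fun t ht => segment_mem hc h h₀ ht
  exact (h3.clm_apply continuousOn_const).clm_apply continuousOn_const

/-- Second-order Taylor formula with integral remainder along a segment. -/
lemma taylor_segment {F : Vec d → ℝ} {Θ : Set (Vec d)} (hΘ : IsOpen Θ)
    (hc : Convex ℝ Θ) (hF : ContDiffOn ℝ 2 F Θ) {θ θ₀ : Vec d} (h : θ ∈ Θ) (h₀ : θ₀ ∈ Θ) :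
    F θ₀ - F θ - fderiv ℝ F θ (θ₀ - θ) =
      ∫ t in (0 : ℝ)..1, (1 - t) * quadForm (hessian F (θ + t • (θ₀ - θ))) (θ₀ - θ) := by
  set v := θ₀ - θ with hv
  have hFd : DifferentiableOn ℝ F Θ := hF.differentiableOn (by norm_num)
  have hFd' : DifferentiableOn ℝ (fderiv ℝ F) Θ :=
    (hF.fderiv_of_isOpen hΘ (m := 1) (by norm_num)).differentiableOn (by norm_num)
  have hline : ∀ t : ℝ, HasDerivAt (fun t : ℝ => θ + t • v) v t := fun t => by
    simpa using ((hasDerivAt_id t).smul_const v).const_add θ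
  have hder : ∀ t ∈ uIcc (0 : ℝ) 1, HasDerivAt
      (fun t : ℝ => F (θ + t • v) + (1 - t) * fderiv ℝ F (θ + t • v) v)
      ((1 - t) * quadForm (hessian F (θ + t • v)) v) t := by
    intro t ht
    rw [uIcc_of_le zero_le_one] at ht
    have hmem : θ + t • v ∈ Θ := segment_mem hc h h₀ ht
    have h1 : HasDerivAt (fun t : ℝ => F (θ + t • v)) (fderiv ℝ F (θ + t • v) v) t :=
      ((hFd.differentiableAt (hΘ.mem_nhds hmem)).hasFDerivAt).comp_hasDerivAt t (hline t)
    have h2 : HasDerivAt (fun t : ℝ => fderiv ℝ F (θ + t • v))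
        (fderiv ℝ (fderiv ℝ F) (θ + t • v) v) t :=
      ((hFd'.differentiableAt (hΘ.mem_nhds hmem)).hasFDerivAt).comp_hasDerivAt t (hline t)
    have h3 : HasDerivAt (fun t : ℝ => fderiv ℝ F (θ + t • v) v)
        (fderiv ℝ (fderiv ℝ F) (θ + t • v) v v) t := by
      simpa using h2.clm_apply (hasDerivAt_const t v)
    have h4 : HasDerivAt (fun t : ℝ => 1 - t) (-1) t := by
      simpa using (hasDerivAt_id t).const_sub 1
    refine (h1.add (h4.mul h3)).congr_deriv ?_
    rw [fderiv_fderiv_eq_quadForm]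
    ring
  have hint : IntervalIntegrable (fun t : ℝ => (1 - t) * quadForm (hessian F (θ + t • v)) v)
      volume 0 1 := by
    refine ContinuousOn.intervalIntegrable ?_
    rw [uIcc_of_le zero_le_one]
    exact (by fun_prop : Continuous fun t : ℝ => 1 - t).continuousOn.mul
      (continuousOn_quadForm_hessian hΘ hc hF h h₀)
  rw [intervalIntegral.integral_eq_sub_of_hasDerivAt hder hint]
  simp only [one_smul, zero_smul, add_zero, sub_self, zero_mul, sub_zero, one_mul, hv]
  rw [add_sub_cancel]
  ring

end Quadratic

/-! ### The centred Taylor remainder of the loss -/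

namespace PenalizedModel

variable {d : ℕ} {X : Type*} [MeasurableSpace X] {D : PenalizedModel d X}

variable (D) in
/-- The second derivative of the loss along the segment from `θ` to `θ₀`, at time `t`. -/
def segmentHess (θ₀ : Vec d) (x : X) (θ : Vec d) (t : ℝ) : ℝ :=
  D.Θ.indicator (fun η => quadForm (hessian (D.loss x) η) (θ₀ - θ)) (θ + t • (θ₀ - θ))

variable (D) in
/-- The mean of `segmentHess` under `P_{θ₀}`. -/
def meanSegmentHess (θ₀ θ : Vec d) (t : ℝ) : ℝ := ∫ x, D.segmentHess θ₀ x θ t ∂(D.P θ₀)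

variable (D) in
/-- The mean of the second-order Taylor remainder of the loss at `θ`, evaluated at `θ₀`. -/
def meanRemainder (θ₀ θ : Vec d) : ℝ :=
  ∫ t in (0 : ℝ)..1, (1 - t) * D.meanSegmentHess θ₀ θ t

variable (D) in
/-- The centred second-order Taylor remainder of the loss at `θ`, evaluated at `θ₀`. -/
def centredRemainder (θ₀ : Vec d) (x : X) (θ : Vec d) : ℝ :=
  D.loss x θ₀ - D.loss x θ - fderiv ℝ (D.loss x) θ (θ₀ - θ) - D.meanRemainder θ₀ θ

lemma meanRemainder_self (θ₀ : Vec d) : D.meanRemainder θ₀ θ₀ = 0 := by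
  simp [meanRemainder, meanSegmentHess, segmentHess, quadForm]

lemma centredRemainder_self (θ₀ : Vec d) (x : X) : D.centredRemainder θ₀ x θ₀ = 0 := by
  simp [centredRemainder, meanRemainder_self]

namespace TwiceDifferentiable

variable (hD : D.TwiceDifferentiable)
include hD

lemma measurable_segmentHess (θ₀ : Vec d) {α : Type*} [MeasurableSpace α] {a : α → X}
    (ha : Measurable a) {b : α → Vec d} (hb : Measurable b) {c : α → ℝ} (hc : Measurable c) :
    Measurable fun q => D.segmentHess θ₀ (a q) (b q) (c q) := by
  have h : (fun q => D.segmentHess θ₀ (a q) (b q) (c q)) = fun q =>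
      ∑ i, ∑ j, (θ₀ - b q) i * (θ₀ - b q) j *
        D.Θ.indicator (fun η => hessian (D.loss (a q)) η i j) (b q + c q • (θ₀ - b q)) := by
    ext1 q
    by_cases hq : b q + c q • (θ₀ - b q) ∈ D.Θ
    · simp only [segmentHess, indicator_of_mem hq, quadForm]
    · simp [segmentHess, indicator_of_notMem hq]
  rw [h]
  refine Finset.measurable_sum _ fun i _ => Finset.measurable_sum _ fun j _ => ?_
  have h1 : Measurable fun q => (a q, b q + c q • (θ₀ - b q)) := by fun_prop
  have h2 : Measurable fun q => (θ₀ - b q) i * (θ₀ - b q) j := by fun_prop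
  have h3 := (hD.measurable_hessian i j).comp h1
  exact h2.mul h3

lemma measurable_meanSegmentHess {θ₀ : Vec d} (hθ₀ : θ₀ ∈ D.Θ) {α : Type*} [MeasurableSpace α]
    {b : α → Vec d} (hb : Measurable b) {c : α → ℝ} (hc : Measurable c) :
    Measurable fun q => D.meanSegmentHess θ₀ (b q) (c q) := by
  have := hD.isProbabilityMeasure θ₀ hθ₀
  have h : Measurable fun p : α × X => D.segmentHess θ₀ p.2 (b p.1) (c p.1) :=
    hD.measurable_segmentHess θ₀ measurable_snd (hb.comp measurable_fst) (hc.comp measurable_fst)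
  exact (h.stronglyMeasurable.integral_prod_right' (ν := D.P θ₀)).measurable

lemma measurable_meanRemainder {θ₀ : Vec d} (hθ₀ : θ₀ ∈ D.Θ) :
    Measurable (D.meanRemainder θ₀) := by
  have h : Measurable fun p : Vec d × ℝ => (1 - p.2) * D.meanSegmentHess θ₀ p.1 p.2 :=
    (by fun_prop : Measurable fun p : Vec d × ℝ => 1 - p.2).mul
      (hD.measurable_meanSegmentHess hθ₀ measurable_fst measurable_snd)
  have h2 := (h.stronglyMeasurable.integral_prod_right'
    (ν := volume.restrict (Ioc (0 : ℝ) 1))).measurable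
  have h3 : D.meanRemainder θ₀ = fun θ => ∫ t in Ioc (0 : ℝ) 1,
      (1 - t) * D.meanSegmentHess θ₀ θ t := by
    ext1 θ; rw [meanRemainder, intervalIntegral.integral_of_le zero_le_one]
  rw [h3]
  exact h2

end TwiceDifferentiable

variable (D) in
/-- The supremum in the upper concentration condition on the Hessian. -/
def upperDev (θ₀ : Vec d) (r : ℝ) (x : X) : ℝ≥0∞ :=
  ⨆ θ ∈ Metric.closedBall θ₀ r ∩ D.Θ, ENNReal.ofReal
    (Real.exp (r ^ 2 * max (lambdaMax (D.hessNLL θ x - D.meanHess θ₀ θ)) 0))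

variable (D) in
/-- The supremum in the lower concentration condition on the Hessian. -/
def lowerDev (θ₀ : Vec d) (r : ℝ) (x : X) : ℝ≥0∞ :=
  ⨆ θ ∈ Metric.closedBall θ₀ r ∩ D.Θ, ENNReal.ofReal
    (r ^ 2 * max (lambdaMax (D.meanHess θ₀ θ - D.hessNLL θ x)) 0)

lemma quadForm_le_of_norm_le [NeZero d] {A : Matrix (Fin d) (Fin d) ℝ} (hA : A.IsHermitian)
    {v : Vec d} {r : ℝ} (hv : ‖v‖ ≤ r) : quadForm A v ≤ r ^ 2 * max (lambdaMax A) 0 := by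
  calc quadForm A v ≤ lambdaMax A * ‖v‖ ^ 2 := quadForm_le_lambdaMax hA v
    _ ≤ max (lambdaMax A) 0 * ‖v‖ ^ 2 := by gcongr; exact le_max_left _ _
    _ ≤ max (lambdaMax A) 0 * r ^ 2 := by gcongr
    _ = _ := mul_comm _ _

/-! ### Bounding the centred remainder by the Hessian deviations -/

section Regular

variable (hR : D.Regular) {θ₀ : Vec d} (hθ₀ : θ₀ ∈ D.Θ) {r ε : ℝ}
  (hH : D.HessianConcentration θ₀ r ε) {θ : Vec d} (hθ : θ ∈ Metric.closedBall θ₀ r ∩ D.Θ)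
include hR

lemma Regular.hessNLL_eq (x : X) {η : Vec d} (hη : η ∈ D.Θ) :
    D.hessNLL η x = hessian (D.loss x) η - hessian D.R η := by
  have hD := hR.twiceDifferentiable
  rw [← hessian_sub hR.isOpen (hD.differentiableOn_loss x) (hD.differentiableOn_fderiv_loss x)
    hR.differentiable_R hR.twice_differentiable_R hη, hessNLL]
  simp [loss]

lemma Regular.isHermitian_hessNLL (x : X) {η : Vec d} (hη : η ∈ D.Θ) :
    (D.hessNLL η x).IsHermitian := by
  have hD := hR.twiceDifferentiable
  rw [hR.hessNLL_eq x hη]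
  exact (isHermitian_hessian hR.isOpen (hD.differentiableOn_loss x)
    (hD.differentiableOn_fderiv_loss x) hη).sub
    (isHermitian_hessian hR.isOpen hR.differentiable_R hR.twice_differentiable_R hη)

lemma Regular.isHermitian_meanHess (θ₀ : Vec d) {η : Vec d} (hη : η ∈ D.Θ) :
    (D.meanHess θ₀ η).IsHermitian := by
  refine Matrix.IsHermitian.ext fun i j => ?_
  simp only [meanHess, Matrix.of_apply, star_trivial]
  refine integral_congr_ae (.of_forall fun x => ?_)
  simpa using (hR.isHermitian_hessNLL x hη).apply i j

include hθ₀ hθ in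
lemma Regular.segment_mem_inter {t : ℝ} (ht : t ∈ Icc (0 : ℝ) 1) :
    θ + t • (θ₀ - θ) ∈ Metric.closedBall θ₀ r ∩ D.Θ :=
  segment_mem ((convex_closedBall θ₀ r).inter hR.convex) hθ
    ⟨Metric.mem_closedBall_self (dist_nonneg.trans hθ.1), hθ₀⟩ ht

include hθ₀ hH hθ in
-- The Hessian of the regularizer is deterministic and disappears on centring, so only the Hessian
-- of the negative log-likelihood matters, as in the concentration assumption.
lemma Regular.segmentHess_sub_mean (x : X) {t : ℝ} (ht : t ∈ Icc (0 : ℝ) 1) :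
    D.segmentHess θ₀ x θ t - D.meanSegmentHess θ₀ θ t =
      quadForm (D.hessNLL (θ + t • (θ₀ - θ)) x - D.meanHess θ₀ (θ + t • (θ₀ - θ))) (θ₀ - θ) := by
  have := hR.isProbabilityMeasure θ₀ hθ₀
  have hm := hR.segment_mem_inter hθ₀ hθ ht
  set η := θ + t • (θ₀ - θ) with hη
  have h1 : ∀ x, D.segmentHess θ₀ x θ t =
      quadForm (D.hessNLL η x) (θ₀ - θ) + quadForm (hessian D.R η) (θ₀ - θ) := fun x => by
    rw [segmentHess, ← hη, indicator_of_mem hm.2, hR.hessNLL_eq x hm.2, quadForm_sub]; ring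
  have h2 : ∫ x, quadForm (D.hessNLL η x) (θ₀ - θ) ∂(D.P θ₀) =
      quadForm (D.meanHess θ₀ η) (θ₀ - θ) := by
    simp only [quadForm, meanHess, Matrix.of_apply]
    rw [integral_finsetSum _ fun i _ => integrable_finsetSum _ fun j _ =>
      (hH.integrable η hm i j).const_mul _]
    refine Finset.sum_congr rfl fun i _ => ?_
    rw [integral_finsetSum _ fun j _ => (hH.integrable η hm i j).const_mul _]
    exact Finset.sum_congr rfl fun j _ => integral_const_mul _ _
  have h3 : Integrable (fun x => quadForm (D.hessNLL η x) (θ₀ - θ)) (D.P θ₀) :=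
    integrable_finsetSum _ fun i _ => integrable_finsetSum _ fun j _ =>
      (hH.integrable η hm i j).const_mul _
  have h4 : D.meanSegmentHess θ₀ θ t =
      quadForm (D.meanHess θ₀ η) (θ₀ - θ) + quadForm (hessian D.R η) (θ₀ - θ) := by
    simp only [meanSegmentHess, h1]
    rw [integral_add h3 (integrable_const _), h2]
    simp
  rw [h1, h4, quadForm_sub]
  ring

variable [NeZero d]

include hθ₀ hH hθ in
lemma Regular.ofReal_exp_dev_le (x : X) {t : ℝ} (ht : t ∈ Icc (0 : ℝ) 1) :
    ENNReal.ofReal (Real.exp (D.segmentHess θ₀ x θ t - D.meanSegmentHess θ₀ θ t)) ≤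
      D.upperDev θ₀ r x := by
  have hm := hR.segment_mem_inter hθ₀ hθ ht
  rw [hR.segmentHess_sub_mean hθ₀ hH hθ x ht]
  refine le_trans ?_ (le_iSup₂ (f := fun η (_ : η ∈ Metric.closedBall θ₀ r ∩ D.Θ) =>
    ENNReal.ofReal (Real.exp (r ^ 2 * max (lambdaMax (D.hessNLL η x - D.meanHess θ₀ η)) 0))) _ hm)
  refine ENNReal.ofReal_le_ofReal (Real.exp_le_exp.2 (quadForm_le_of_norm_le
    ((hR.isHermitian_hessNLL x hm.2).sub (hR.isHermitian_meanHess θ₀ hm.2)) ?_))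
  simpa [dist_eq_norm, norm_sub_rev] using hθ.1

include hθ₀ hH hθ in
lemma Regular.ofReal_neg_dev_le (x : X) {t : ℝ} (ht : t ∈ Icc (0 : ℝ) 1) :
    ENNReal.ofReal (-(D.segmentHess θ₀ x θ t - D.meanSegmentHess θ₀ θ t)) ≤
      D.lowerDev θ₀ r x := by
  have hm := hR.segment_mem_inter hθ₀ hθ ht
  rw [hR.segmentHess_sub_mean hθ₀ hH hθ x ht, quadForm_sub, neg_sub, ← quadForm_sub]
  refine le_trans ?_ (le_iSup₂ (f := fun η (_ : η ∈ Metric.closedBall θ₀ r ∩ D.Θ) =>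
    ENNReal.ofReal (r ^ 2 * max (lambdaMax (D.meanHess θ₀ η - D.hessNLL η x)) 0)) _ hm)
  refine ENNReal.ofReal_le_ofReal (quadForm_le_of_norm_le
    ((hR.isHermitian_meanHess θ₀ hm.2).sub (hR.isHermitian_hessNLL x hm.2)) ?_)
  simpa [dist_eq_norm, norm_sub_rev] using hθ.1

omit [NeZero d] in
include hθ₀ hθ in
lemma Regular.continuousOn_segmentHess (x : X) :
    ContinuousOn (D.segmentHess θ₀ x θ) (Icc 0 1) := by
  refine (continuousOn_quadForm_hessian hR.isOpen hR.convex (hR.contDiff_loss x) hθ.2 hθ₀).congr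
    fun t ht => ?_
  rw [segmentHess, indicator_of_mem (segment_mem hR.convex hθ.2 hθ₀ ht)]

include hθ₀ hH hθ in
-- Continuity of the mean Hessian along the segment is not assumed. The deviation from the mean is
-- integrable in t for almost every x, by the two concentration bounds, and the sample Hessian is
-- continuous in t, so their difference is integrable.
lemma Regular.intervalIntegrable_meanSegmentHess :
    IntervalIntegrable (D.meanSegmentHess θ₀ θ) volume 0 1 := by
  have := hR.isProbabilityMeasure θ₀ hθ₀
  have hD := hR.twiceDifferentiable
  set lam := (volume : Measure ℝ).restrict (Ioc 0 1) with hlam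
  have hlam1 : IsProbabilityMeasure lam := ⟨by simp [hlam]⟩
  set ω : X × ℝ → ℝ := fun p => D.segmentHess θ₀ p.1 θ p.2 - D.meanSegmentHess θ₀ θ p.2 with hω
  have hωm : Measurable ω := by
    exact (hD.measurable_segmentHess θ₀ measurable_fst measurable_const measurable_snd).sub
      (hD.measurable_meanSegmentHess hθ₀ measurable_const measurable_snd)
  have hmem : ∀ᵐ t ∂lam, t ∈ Icc (0 : ℝ) 1 := by
    filter_upwards [ae_restrict_mem measurableSet_Ioc] with t ht using Ioc_subset_Icc_self ht
  have h1 : ∀ᵐ x ∂(D.P θ₀), ∫⁻ t, ENNReal.ofReal (ω (x, t)) ∂lam < ∞ := by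
    refine ae_lt_top (hωm.ennreal_ofReal.lintegral_prod_right') (ne_of_lt ?_)
    refine lt_of_le_of_lt (lintegral_mono (g := D.upperDev θ₀ r) fun x => ?_)
      (hH.upper.trans_lt ENNReal.ofReal_lt_top)
    calc ∫⁻ t, ENNReal.ofReal (ω (x, t)) ∂lam ≤ ∫⁻ _t, D.upperDev θ₀ r x ∂lam := by
          refine lintegral_mono_ae ?_
          filter_upwards [hmem] with t ht
          refine le_trans (ENNReal.ofReal_le_ofReal ?_) (hR.ofReal_exp_dev_le hθ₀ hH hθ x ht)
          linarith [Real.add_one_le_exp (D.segmentHess θ₀ x θ t - D.meanSegmentHess θ₀ θ t)]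
      _ = _ := by simp
  have h2 : ∀ᵐ x ∂(D.P θ₀), ∫⁻ t, ENNReal.ofReal (-ω (x, t)) ∂lam < ∞ := by
    refine ae_lt_top (hωm.neg.ennreal_ofReal.lintegral_prod_right') (ne_of_lt ?_)
    refine lt_of_le_of_lt (lintegral_mono (g := D.lowerDev θ₀ r) fun x => ?_)
      (hH.lower.trans_lt ENNReal.ofReal_lt_top)
    calc ∫⁻ t, ENNReal.ofReal (-ω (x, t)) ∂lam ≤ ∫⁻ _t, D.lowerDev θ₀ r x ∂lam := by
          refine lintegral_mono_ae ?_
          filter_upwards [hmem] with t ht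
          exact hR.ofReal_neg_dev_le hθ₀ hH hθ x ht
      _ = _ := by simp
  -- A single sample point suffices, because the mean does not depend on x.
  obtain ⟨x, hx1, hx2⟩ := (h1.and h2).exists
  have hωx : Measurable fun t => ω (x, t) := hωm.comp measurable_prodMk_left
  have hint : Integrable (fun t => ω (x, t)) lam := by
    refine ⟨hωx.aestronglyMeasurable, ?_⟩
    rw [hasFiniteIntegral_iff_norm]
    calc ∫⁻ t, ENNReal.ofReal ‖ω (x, t)‖ ∂lam
        ≤ ∫⁻ t, (ENNReal.ofReal (ω (x, t)) + ENNReal.ofReal (-ω (x, t))) ∂lam := by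
          refine lintegral_mono fun t => ?_
          rcases abs_choice (ω (x, t)) with h | h <;> rw [Real.norm_eq_abs, h]
          exacts [le_self_add, le_add_self]
      _ < ∞ := by
          rw [lintegral_add_left hωx.ennreal_ofReal]
          exact ENNReal.add_lt_top.2 ⟨hx1, hx2⟩
  have hseg : IntervalIntegrable (D.segmentHess θ₀ x θ) volume 0 1 :=
    (by simpa [uIcc_of_le] using hR.continuousOn_segmentHess hθ₀ hθ x :
      ContinuousOn (D.segmentHess θ₀ x θ) (uIcc 0 1)).intervalIntegrable
  have hω' : IntervalIntegrable (fun t => ω (x, t)) volume 0 1 := by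
    rwa [intervalIntegrable_iff_integrableOn_Ioc_of_le zero_le_one]
  refine (hseg.sub hω').congr fun t _ => ?_
  simp [hω]

include hθ₀ hH hθ in
lemma Regular.centredRemainder_eq (x : X) : IntervalIntegrable (fun t => (1 - t) *
      (D.segmentHess θ₀ x θ t - D.meanSegmentHess θ₀ θ t)) volume 0 1 ∧
    D.centredRemainder θ₀ x θ = ∫ t in (0 : ℝ)..1, (1 - t) *
      (D.segmentHess θ₀ x θ t - D.meanSegmentHess θ₀ θ t) := by
  have hc : ContinuousOn (fun t : ℝ => 1 - t) (uIcc 0 1) := by fun_prop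
  have h1 : IntervalIntegrable (fun t => (1 - t) * D.segmentHess θ₀ x θ t) volume 0 1 := by
    refine IntervalIntegrable.continuousOn_mul ?_ hc
    exact (by simpa [uIcc_of_le] using hR.continuousOn_segmentHess hθ₀ hθ x :
      ContinuousOn (D.segmentHess θ₀ x θ) (uIcc 0 1)).intervalIntegrable
  have h2 : IntervalIntegrable (fun t => (1 - t) * D.meanSegmentHess θ₀ θ t) volume 0 1 :=
    (hR.intervalIntegrable_meanSegmentHess hθ₀ hH hθ).continuousOn_mul hc
  simp only [mul_sub]
  refine ⟨h1.sub h2, ?_⟩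
  rw [intervalIntegral.integral_sub h1 h2, centredRemainder,
    taylor_segment hR.isOpen hR.convex (hR.contDiff_loss x) hθ.2 hθ₀, meanRemainder]
  congr 1
  refine intervalIntegral.integral_congr fun t ht => ?_
  rw [uIcc_of_le zero_le_one] at ht
  simp only [segmentHess, indicator_of_mem (segment_mem hR.convex hθ.2 hθ₀ ht)]

omit hR [NeZero d] in
-- The weight 1 - t has integral 1/2 on [0, 1]; this is the source of the factor 1/2 in front of
-- each Hessian deviation.
lemma integral_one_sub_mul_le {w : ℝ → ℝ} {a : ℝ}
    (hw : IntervalIntegrable (fun t => (1 - t) * w t) volume 0 1)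
    (h : ∀ t ∈ Icc (0 : ℝ) 1, w t ≤ a) : ∫ t in (0 : ℝ)..1, (1 - t) * w t ≤ a / 2 := by
  have h1 : ∫ t in (0 : ℝ)..1, (1 - t) * a = a / 2 := by
    rw [intervalIntegral.integral_mul_const, intervalIntegral.integral_sub (by simp) (by simp)]
    simp; ring
  rw [← h1]
  refine intervalIntegral.integral_mono_on zero_le_one hw
    ((by fun_prop : Continuous fun t : ℝ => (1 - t) * a).intervalIntegrable _ _) fun t ht => ?_
  exact mul_le_mul_of_nonneg_left (h t ht) (by linarith [ht.2])

include hθ₀ hH hθ in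
-- The remainder is at most half the logarithm of the deviation u, so its exponential is at most √u.
-- Replacing √u by its tangent line at u = exp e gives a bound affine in u, which can be integrated
-- without knowing that the supremum u is measurable. The optimal choice is e = ε.
lemma Regular.ofReal_exp_centredRemainder_le (x : X) (e : ℝ) :
    ENNReal.ofReal (Real.exp (D.centredRemainder θ₀ x θ)) ≤
      D.upperDev θ₀ r x * ENNReal.ofReal (Real.exp (-(e / 2)) / 2) +
        ENNReal.ofReal (Real.exp (e / 2) / 2) := by
  obtain ⟨hi, he⟩ := hR.centredRemainder_eq hθ₀ hH hθ x
  rcases eq_or_ne (D.upperDev θ₀ r x) ∞ with htop | htop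
  · rw [htop, ENNReal.top_mul (ENNReal.ofReal_pos.2 (by positivity)).ne']
    simp
  · set u := (D.upperDev θ₀ r x).toReal with hu
    have hle : ∀ t ∈ Icc (0 : ℝ) 1, Real.exp (D.segmentHess θ₀ x θ t -
        D.meanSegmentHess θ₀ θ t) ≤ u := fun t ht => by
      rw [hu, ← ENNReal.ofReal_le_iff_le_toReal htop]
      exact hR.ofReal_exp_dev_le hθ₀ hH hθ x ht
    have hu0 : 0 < u := (Real.exp_pos _).trans_le (hle 0 (by simp))
    have h1 : D.centredRemainder θ₀ x θ ≤ Real.log u / 2 := by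
      rw [he]
      exact integral_one_sub_mul_le hi fun t ht => (Real.le_log_iff_exp_le hu0).2 (hle t ht)
    rw [← ENNReal.ofReal_toReal htop, ← ENNReal.ofReal_mul hu0.le,
      ← ENNReal.ofReal_add (by positivity) (by positivity)]
    refine ENNReal.ofReal_le_ofReal ((Real.exp_le_exp.2 h1).trans ?_)
    have h2 : u = Real.exp (Real.log u / 2) ^ 2 := by
      rw [← Real.exp_nat_mul]; push_cast; rw [mul_div_cancel₀ _ two_ne_zero, Real.exp_log hu0]
    set a := Real.exp (Real.log u / 2)
    have h3 : Real.exp (e / 2) * Real.exp (-(e / 2)) = 1 := by rw [← Real.exp_add]; simp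
    have h4 := Real.exp_pos (-(e / 2))
    set p := Real.exp (e / 2)
    set q := Real.exp (-(e / 2))
    rw [h2]
    -- Here u = a² and pq = 1, so the tangent-line inequality a ≤ (a²q + p)/2 is a square.
    have h5 : q * (a - p) ^ 2 = a ^ 2 * q - 2 * a + p := by linear_combination (p - 2 * a) * h3
    linarith [mul_nonneg h4.le (sq_nonneg (a - p))]

include hθ₀ hH hθ in
lemma Regular.ofReal_neg_centredRemainder_le (x : X) :
    ENNReal.ofReal (-D.centredRemainder θ₀ x θ) ≤ D.lowerDev θ₀ r x * ENNReal.ofReal (1 / 2) := by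
  obtain ⟨hi, he⟩ := hR.centredRemainder_eq hθ₀ hH hθ x
  rcases eq_or_ne (D.lowerDev θ₀ r x) ∞ with htop | htop
  · rw [htop, ENNReal.top_mul (ENNReal.ofReal_pos.2 (by positivity)).ne']
    simp
  · have hle : ∀ t ∈ Icc (0 : ℝ) 1, -(D.segmentHess θ₀ x θ t -
        D.meanSegmentHess θ₀ θ t) ≤ (D.lowerDev θ₀ r x).toReal := fun t ht => by
      rw [← ENNReal.ofReal_le_iff_le_toReal htop]
      exact hR.ofReal_neg_dev_le hθ₀ hH hθ x ht
    rw [← ENNReal.ofReal_toReal htop, ← ENNReal.ofReal_mul ENNReal.toReal_nonneg]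
    refine ENNReal.ofReal_le_ofReal ?_
    have h1 := integral_one_sub_mul_le (w := fun t => -(D.segmentHess θ₀ x θ t -
        D.meanSegmentHess θ₀ θ t)) (hi.neg.congr fun t _ => (mul_neg _ _).symm) hle
    simp only [mul_neg, intervalIntegral.integral_neg, ← he] at h1
    linarith

end Regular

end PenalizedModel

/-! ### The error bound under concentration of the Hessian -/

namespace PenalizedModel

variable {d : ℕ} {X : Type*} [MeasurableSpace X] {D : PenalizedModel d X}

variable (D) in
/-- The exponent which turns the likelihood ratio between `θ` and `θ₀`, at the gradient `g`, into
the exponential of the centred Taylor remainder. -/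
def taylorExponent (θ₀ : Vec d) (p : Vec d × Vec d) : ℝ :=
  -inner ℝ p.2 (θ₀ - p.1) - D.meanRemainder θ₀ p.1 + D.R θ₀ - D.Θ.indicator D.R p.1

namespace TwiceDifferentiable

variable (hD : D.TwiceDifferentiable)
include hD

lemma measurable_indicator_R : Measurable (D.Θ.indicator D.R) :=
  Measurable.comp (g := fun p : Unit × Vec d => D.Θ.indicator D.R p.2)
    (measurable_indicator_of_continuousOn (F := fun _ : Unit => D.R) hD.isOpen.measurableSet
      (fun _ _ => measurable_const) fun _ => hD.continuousOn_R)
    (by fun_prop : Measurable fun θ : Vec d => ((), θ))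

lemma measurable_taylorExponent {θ₀ : Vec d} (hθ₀ : θ₀ ∈ D.Θ) :
    Measurable (D.taylorExponent θ₀) := by
  have h1 : Measurable fun p : Vec d × Vec d => D.meanRemainder θ₀ p.1 :=
    (hD.measurable_meanRemainder hθ₀).comp measurable_fst
  have h2 : Measurable fun p : Vec d × Vec d => D.Θ.indicator D.R p.1 :=
    hD.measurable_indicator_R.comp measurable_fst
  have h3 : Measurable fun p : Vec d × Vec d => -inner ℝ p.2 (θ₀ - p.1) := by fun_prop
  exact ((h3.sub h1).add_const _).sub h2

/-- Substituting ∇𝓛(θ̂; x) = ĝ - σw in the Taylor expansion, everything that depends on (θ̂, ĝ)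
alone is cancelled by the exponent, leaving the centred remainder and the noise term. -/
lemma tilt_taylorExponent (hs : D.MeasurableSolver) {θ₀ : Vec d} (hθ₀ : θ₀ ∈ D.Θ)
    (q : X × Vec d) : D.tilt θ₀ (D.taylorExponent θ₀) (D.estimates q) =
      ENNReal.ofReal (Real.exp (D.centredRemainder θ₀ q.1 (D.θhat q.1 q.2) -
        D.σ * inner ℝ q.2 (θ₀ - D.θhat q.1 q.2))) := by
  have hθ : D.θhat q.1 q.2 ∈ D.Θ := hs.2 _ _
  have h0 := hD.f_pos _ hθ₀ q.1
  simp only [tilt, estimates, indicator_of_mem hθ, taylorExponent]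
  rw [← ENNReal.ofReal_div_of_pos h0, ← ENNReal.ofReal_mul
    (div_nonneg (hD.f_pos _ hθ q.1).le h0.le), f_eq_exp h0, f_eq_exp (hD.f_pos _ hθ q.1),
    ← Real.exp_sub, ← Real.exp_add, ghat, hD.gradient_perturbedLoss _ _ hθ, inner_add_left,
    inner_gradient_left, real_inner_smul_left, centredRemainder]
  ring_nf

end TwiceDifferentiable

/-- Integrating the noise out first requires measurability of F alone; the dominating function g may
be one of the suprema over θ, for which measurability is not assumed. -/
lemma lintegral_dataLaw_le {θ₀ : Vec d} {F : X × Vec d → ℝ≥0∞} (hF : Measurable F)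
    {g : X → ℝ≥0∞} (h : ∀ x, ∫⁻ w, F (x, w) ∂(noiseLaw d) ≤ g x) :
    ∫⁻ q, F q ∂(D.dataLaw θ₀) ≤ ∫⁻ x, g x ∂(D.P θ₀) := by
  rw [dataLaw, lintegral_prod _ hF.aemeasurable]
  exact lintegral_mono h

namespace Regular

variable (hR : D.Regular) {θ₀ : Vec d} (hθ₀ : θ₀ ∈ D.Θ) {r ε : ℝ}
  (hH : D.HessianConcentration θ₀ r ε) (hr : 0 ≤ r)
include hR hθ₀ hH hr

/-- The upper condition bounds the expectation of a quantity that is at least 1. -/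
lemma nonneg_of_hessianConcentration : 0 ≤ ε := by
  have := hR.isProbabilityMeasure θ₀ hθ₀
  have h1 : ENNReal.ofReal 1 ≤ ENNReal.ofReal (Real.exp ε) := by
    refine le_trans ?_ hH.upper
    calc ENNReal.ofReal 1 = ∫⁻ _x, ENNReal.ofReal 1 ∂(D.P θ₀) := by simp
      _ ≤ _ := by
        refine lintegral_mono fun x => ?_
        refine le_trans ?_ (le_iSup₂ (f := fun η (_ : η ∈ Metric.closedBall θ₀ r ∩ D.Θ) =>
          ENNReal.ofReal (Real.exp (r ^ 2 * max (lambdaMax (D.hessNLL η x - D.meanHess θ₀ η)) 0)))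
          θ₀ ⟨Metric.mem_closedBall_self hr, hθ₀⟩)
        exact ENNReal.ofReal_le_ofReal (Real.one_le_exp (by positivity))
  exact Real.one_le_exp_iff.1 ((ENNReal.ofReal_le_ofReal_iff (Real.exp_pos _).le).1 h1)

omit hR hθ₀ hr in
lemma lintegral_upperDev_le : ∫⁻ x, (D.upperDev θ₀ r x * ENNReal.ofReal (Real.exp (-(ε / 2)) / 2) +
    ENNReal.ofReal (Real.exp (ε / 2) / 2)) ∂(D.P θ₀) ≤
    ENNReal.ofReal (Real.exp ε * (Real.exp (-(ε / 2)) / 2)) +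
      ENNReal.ofReal (Real.exp (ε / 2) / 2) * D.P θ₀ univ := by
  rw [lintegral_add_right _ measurable_const, lintegral_mul_const' _ _ ENNReal.ofReal_ne_top,
    lintegral_const]
  gcongr
  rw [ENNReal.ofReal_mul (Real.exp_pos _).le]
  gcongr
  exact hH.upper

/-- The general error bound, for a seminorm of the noise controlling its inner products with the
estimation error. -/
theorem errorBound_of_seminorm (hd : 1 ≤ d) (hlam : 0 ≤ D.lam) (hσ : 0 < D.σ)
    (hs : D.MeasurableSolver) {M : ℕ} {κ : Kernel (X × Vec d × Vec d) (Fin M → X)}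
    [IsMarkovKernel κ] (hκ : D.ValidSampler κ) {N : Seminorm ℝ (Vec d)} (hN : Continuous N) {η : ℝ}
    (hη : 0 ≤ η) (h2 : ∫ z, N z ^ 2 ∂(noiseLaw d) ≤ η ^ 2) {G : Set (Vec d)} (hG : MeasurableSet G)
    (hGr : G ⊆ Metric.closedBall θ₀ r)
    (hGN : ∀ θ ∈ G, ∀ w, |inner ℝ w (θ₀ - θ)| ≤ r * N w) {β : ℝ} (hβ0 : 0 ≤ β)
    (hβ : D.dataLaw θ₀ (D.goodEvent G)ᶜ ≤ ENNReal.ofReal β) :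
    ErrorBound (D.acssLaw κ θ₀) (3 * D.σ * r * η + ε + β) := by
  classical
  have hD := hR.twiceDifferentiable
  have : NeZero d := ⟨by omega⟩
  have hPprob := hR.isProbabilityMeasure θ₀ hθ₀
  have hprob := hD.isProbabilityMeasure_dataLaw hθ₀
  have := hD.isProbabilityMeasure_acssLaw hlam hs hθ₀ (κ := κ)
  have hε := hR.nonneg_of_hessianConcentration hθ₀ hH hr
  have ht0 : 0 ≤ D.σ * r := by positivity
  -- The exponential moment bound needs σrη ≤ 1/3; otherwise the claimed bound exceeds 1 and is
  -- trivial.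
  rcases lt_or_ge 1 (3 * D.σ * r * η) with hbig | hsmall
  · exact ErrorBound.of_one_le (by linarith)
  have htη : D.σ * r * η ≤ 1 / 3 := by linarith
  have htη0 : 0 ≤ D.σ * r * η := by positivity
  set t := D.σ * r with ht
  set k := D.taylorExponent θ₀ with hk
  have hkm : Measurable k := hD.measurable_taylorExponent hθ₀
  have hE := hD.measurableSet_goodEvent hlam hs hG
  set E := D.goodEvent G with hEdef
  set τ : X × Vec d → ℝ≥0∞ := fun q => D.tilt θ₀ k (D.estimates q) with hτ
  have hτm : Measurable τ := (hD.measurable_tilt hθ₀ hkm).comp (hD.measurable_estimates' hs)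
  set V : X → ℝ≥0∞ := fun x => D.upperDev θ₀ r x * ENNReal.ofReal (Real.exp (-(ε / 2)) / 2) +
    ENNReal.ofReal (Real.exp (ε / 2) / 2) with hV
  -- The centred remainder vanishes at θ₀ itself. The bound V ≥ 1 lets V also dominate the weight 1
  -- carried by the complement of the good event.
  have hV1 : ∀ x, 1 ≤ V x := fun x => by
    have := hR.ofReal_exp_centredRemainder_le hθ₀ hH
      ⟨Metric.mem_closedBall_self hr, hθ₀⟩ x ε
    simpa [centredRemainder_self] using this
  have hVint : ∫⁻ x, V x ∂(D.P θ₀) ≤ ENNReal.ofReal (Real.exp (ε / 2)) := by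
    refine (lintegral_upperDev_le hH).trans ?_
    rw [measure_univ, mul_one, ← ENNReal.ofReal_add (by positivity) (by positivity)]
    refine ENNReal.ofReal_le_ofReal (le_of_eq ?_)
    have : Real.exp ε = Real.exp (ε / 2) * Real.exp (ε / 2) := by rw [← Real.exp_add]; ring_nf
    have h3 : Real.exp (ε / 2) * Real.exp (-(ε / 2)) = 1 := by rw [← Real.exp_add]; simp
    rw [this]; linear_combination (Real.exp (ε / 2) / 2) * h3
  have hmem : ∀ q ∈ E, D.θhat q.1 q.2 ∈ Metric.closedBall θ₀ r ∩ D.Θ := fun q hq =>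
    ⟨hGr hq.2, hs.2 _ _⟩
  have hinner : ∀ q ∈ E, |D.σ * inner ℝ q.2 (θ₀ - D.θhat q.1 q.2)| ≤ t * N q.2 := fun q hq => by
    rw [abs_mul, abs_of_pos hσ, ht, mul_assoc]
    exact mul_le_mul_of_nonneg_left (hGN _ hq.2 _) hσ.le
  have hNm : Measurable fun w => N w := hN.measurable
  set C := Real.exp (2 * (t * η)) * Real.exp (ε / 2) with hC
  have hC0 : 0 < C := by positivity
  obtain ⟨Z, hZ⟩ : ∃ Z, Z = ∫⁻ q in E, τ q ∂(D.dataLaw θ₀) + D.dataLaw θ₀ Eᶜ := ⟨_, rfl⟩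
  -- The noise is independent of the data, so the exponential moment of N and the expectation of V
  -- multiply, giving exp(2tη) · exp(ε/2).
  have hZC : Z ≤ ENNReal.ofReal C := by
    have hpw : Measurable (E.piecewise τ 1) := hτm.piecewise hE measurable_const
    have h1 : Z = ∫⁻ q, E.piecewise τ 1 q ∂(D.dataLaw θ₀) := by
      rw [hZ, lintegral_piecewise hE]; simp
    rw [h1]
    refine (lintegral_dataLaw_le hpw
      (g := fun x => ENNReal.ofReal (Real.exp (2 * (t * η))) * V x) fun x => ?_).trans ?_
    · calc ∫⁻ w, E.piecewise τ 1 (x, w) ∂(noiseLaw d)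
          ≤ ∫⁻ w, ENNReal.ofReal (Real.exp (t * N w)) * V x ∂(noiseLaw d) := by
            refine lintegral_mono fun w => ?_
            by_cases hq : (x, w) ∈ E
            · simp only [piecewise, hq, if_true, hτ, hk]
              rw [hD.tilt_taylorExponent hs hθ₀, sub_eq_neg_add, Real.exp_add,
                ENNReal.ofReal_mul (Real.exp_pos _).le]
              refine mul_le_mul' (ENNReal.ofReal_le_ofReal (Real.exp_le_exp.2 ?_))
                (hR.ofReal_exp_centredRemainder_le hθ₀ hH (hmem _ hq) x ε)
              exact (neg_le_abs _).trans (hinner _ hq)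
            · simp only [piecewise, hq, if_false, Pi.one_apply]
              calc (1 : ℝ≥0∞) = 1 * 1 := (one_mul 1).symm
                _ ≤ _ := by
                  refine mul_le_mul' ?_ (hV1 x)
                  rw [← ENNReal.ofReal_one]
                  exact ENNReal.ofReal_le_ofReal (Real.one_le_exp
                    (mul_nonneg ht0 (apply_nonneg N w)))
        _ = (∫⁻ w, ENNReal.ofReal (Real.exp (t * N w)) ∂(noiseLaw d)) * V x :=
            lintegral_mul_const _ (by fun_prop)
        _ ≤ _ := by
            gcongr
            exact lintegral_exp_seminorm_le integral_strongDual_noiseLaw hN hη h2 ht0 htη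
    · rw [lintegral_const_mul' _ _ ENNReal.ofReal_ne_top, hC, ENNReal.ofReal_mul (Real.exp_pos _).le]
      gcongr
  have hZfin : Z ≠ ∞ := ne_top_of_le_ne_top ENNReal.ofReal_ne_top hZC
  refine hD.errorBound_of_tilt hlam hσ hs hθ₀ hkm hG hd hκ (by positivity) hZ hZfin ?_
  have hNint : ∫⁻ w, ENNReal.ofReal (t * N w) ∂(noiseLaw d) ≤ ENNReal.ofReal (t * η) := by
    rw [← ofReal_integral_eq_lintegral_ofReal
      ((by simpa using integrable_seminorm_pow (μ := noiseLaw d) hN 1 :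
        Integrable (fun w => N w) (noiseLaw d)).const_mul t)
      (.of_forall fun w => mul_nonneg ht0 (apply_nonneg N w)), integral_const_mul]
    exact ENNReal.ofReal_le_ofReal
      (mul_le_mul_of_nonneg_left (moment_one_le hN hη h2) ht0)
  -- Z is replaced by its upper bound C = exp(2tη + ε/2), and 1 - exp x ≤ -x makes the loss linear
  -- in the remainder and the noise.
  have hpoint : ∀ q ∈ E, 1 - τ q / Z ≤ ENNReal.ofReal (2 * (t * η) + ε / 2) +
      ENNReal.ofReal (t * N q.2) + D.lowerDev θ₀ r q.1 * ENNReal.ofReal (1 / 2) := by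
    intro q hq
    set y := D.centredRemainder θ₀ q.1 (D.θhat q.1 q.2) -
      D.σ * inner ℝ q.2 (θ₀ - D.θhat q.1 q.2) with hy
    have hτq : τ q = ENNReal.ofReal (Real.exp y) := hD.tilt_taylorExponent hs hθ₀ q
    calc 1 - τ q / Z ≤ 1 - τ q / ENNReal.ofReal C := by gcongr
      _ = ENNReal.ofReal (1 - Real.exp (y - (2 * (t * η) + ε / 2))) := by
          rw [hτq, ← ENNReal.ofReal_div_of_pos hC0, ← ENNReal.ofReal_one,
            ← ENNReal.ofReal_sub _ (by positivity), hC, ← Real.exp_add, ← Real.exp_sub]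
      _ ≤ ENNReal.ofReal ((2 * (t * η) + ε / 2) + D.σ * inner ℝ q.2 (θ₀ - D.θhat q.1 q.2) +
            -D.centredRemainder θ₀ q.1 (D.θhat q.1 q.2)) := by
          refine ENNReal.ofReal_le_ofReal ?_
          linarith [Real.add_one_le_exp (y - (2 * (t * η) + ε / 2))]
      _ ≤ _ := by
          refine ENNReal.ofReal_add_le.trans (add_le_add (ENNReal.ofReal_add_le.trans ?_)
            (hR.ofReal_neg_centredRemainder_le hθ₀ hH (hmem _ hq) q.1))
          exact add_le_add le_rfl (ENNReal.ofReal_le_ofReal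
            ((le_abs_self _).trans (hinner _ hq)))
  -- After integration tN(w) contributes another tη and the lower deviation another ε/2; together
  -- with the logarithm of C this is 3tη + ε.
  have hmain : ∫⁻ q in E, (1 - τ q / Z) ∂(D.dataLaw θ₀) ≤
      ENNReal.ofReal (3 * (t * η) + ε) := by
    rw [← lintegral_indicator hE]
    have hm : Measurable (E.indicator fun q => 1 - τ q / Z) :=
      (measurable_const.sub (hτm.div_const Z)).indicator hE
    refine (lintegral_dataLaw_le hm (g := fun x => D.lowerDev θ₀ r x * ENNReal.ofReal (1 / 2) +
      ENNReal.ofReal (3 * (t * η) + ε / 2)) fun x => ?_).trans ?_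
    · calc ∫⁻ w, E.indicator (fun q => 1 - τ q / Z) (x, w) ∂(noiseLaw d)
          ≤ ∫⁻ w, (ENNReal.ofReal (2 * (t * η) + ε / 2) + ENNReal.ofReal (t * N w) +
            D.lowerDev θ₀ r x * ENNReal.ofReal (1 / 2)) ∂(noiseLaw d) := by
            refine lintegral_mono fun w => ?_
            exact indicator_le (fun q hq => hpoint q hq) (x, w)
        _ = ENNReal.ofReal (2 * (t * η) + ε / 2) +
              ∫⁻ w, ENNReal.ofReal (t * N w) ∂(noiseLaw d) +
              D.lowerDev θ₀ r x * ENNReal.ofReal (1 / 2) := by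
            rw [lintegral_add_right _ measurable_const, lintegral_add_left measurable_const]
            simp
        _ ≤ ENNReal.ofReal (2 * (t * η) + ε / 2) + ENNReal.ofReal (t * η) +
              D.lowerDev θ₀ r x * ENNReal.ofReal (1 / 2) := by gcongr
        _ = _ := by
            rw [← ENNReal.ofReal_add (by positivity) (by positivity), add_comm]
            congr 2; ring
    · rw [lintegral_add_right _ measurable_const, lintegral_mul_const' _ _ ENNReal.ofReal_ne_top,
        lintegral_const, measure_univ, mul_one]
      calc _ ≤ ENNReal.ofReal ε * ENNReal.ofReal (1 / 2) +
            ENNReal.ofReal (3 * (t * η) + ε / 2) := by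
            gcongr
            exact hH.lower
        _ = _ := by
            rw [← ENNReal.ofReal_mul hε, ← ENNReal.ofReal_add (by positivity) (by positivity)]
            congr 1; ring
  calc _ ≤ ENNReal.ofReal (3 * (t * η) + ε) + ENNReal.ofReal β := add_le_add hmain hβ
    _ = _ := by
      rw [← ENNReal.ofReal_add (by positivity) hβ0, ht]
      congr 1; ring

end Regular

end PenalizedModel

/-! ### The bounds for general models and under sparse structure -/

section Sparsity

variable {d p : ℕ} (v : Fin p → Vec d) (k : ℕ)

/-- The largest norm of a projection onto the span of `k` of the vectors `v i`. -/
def sparseSeminorm : Seminorm ℝ (Vec d) :=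
  (Finset.univ : Finset {S : Finset (Fin p) // S.card ≤ k}).sup fun S =>
    (normSeminorm ℝ (Vec d)).comp
      (Submodule.span ℝ (v '' (S.1 : Set (Fin p)))).starProjection.toLinearMap

lemma continuous_sparseSeminorm : Continuous (sparseSeminorm v k) := by
  refine Seminorm.continuous_of_le (q := normSeminorm ℝ (Vec d)) continuous_norm
    (Finset.sup_le fun S _ z => ?_)
  exact Submodule.norm_starProjection_apply_le _ z

lemma norm_starProjection_le_sparseSeminorm (S : {S : Finset (Fin p) // S.card ≤ k}) (z : Vec d) :
    ‖(Submodule.span ℝ (v '' (S.1 : Set (Fin p)))).starProjection z‖ ≤ sparseSeminorm v k z :=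
  Seminorm.le_finset_sup_apply (p := fun S : {S : Finset (Fin p) // S.card ≤ k} =>
    (normSeminorm ℝ (Vec d)).comp
      (Submodule.span ℝ (v '' (S.1 : Set (Fin p)))).starProjection.toLinearMap)
    (Finset.mem_univ S)

/-- There are finitely many subsets, so the supremum is attained and squaring commutes with it. This
identifies the second moment of the seminorm with the effective dimension. -/
lemma sparseSeminorm_sq (z : Vec d) : sparseSeminorm v k z ^ 2 =
    ⨆ S : {S : Finset (Fin p) // S.card ≤ k},
      ‖(Submodule.span ℝ (v '' (S.1 : Set (Fin p)))).starProjection z‖ ^ 2 := by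
  have : Nonempty {S : Finset (Fin p) // S.card ≤ k} := ⟨⟨∅, by simp⟩⟩
  refine le_antisymm ?_ (ciSup_le fun S => ?_)
  · obtain ⟨S, -, hS⟩ := Seminorm.exists_apply_eq_finset_sup
      (fun S : {S : Finset (Fin p) // S.card ≤ k} => (normSeminorm ℝ (Vec d)).comp
        (Submodule.span ℝ (v '' (S.1 : Set (Fin p)))).starProjection.toLinearMap)
      Finset.univ_nonempty z
    rw [sparseSeminorm, hS]
    exact le_ciSup (f := fun S : {S : Finset (Fin p) // S.card ≤ k} =>
      ‖(Submodule.span ℝ (v '' (S.1 : Set (Fin p)))).starProjection z‖ ^ 2)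
      (Set.finite_range _).bddAbove S
  · exact pow_le_pow_left₀ (norm_nonneg _) (norm_starProjection_le_sparseSeminorm v k S z) 2

lemma integral_sparseSeminorm_sq :
    ∫ z, sparseSeminorm v k z ^ 2 ∂(noiseLaw d) = effectiveDim v k / d := by
  rw [integral_seminorm_sq_noiseLaw _ (continuous_sparseSeminorm v k), effectiveDim]
  simp only [sparseSeminorm_sq]

lemma effectiveDim_nonneg : 0 ≤ effectiveDim v k :=
  integral_nonneg fun z => by rw [← sparseSeminorm_sq]; positivity

lemma vSparsity_le_iff (w : Vec d) : vSparsity v w ≤ (k : ℕ∞) ↔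
    ∃ S : Finset (Fin p), S.card ≤ k ∧ w ∈ Submodule.span ℝ (v '' (S : Set (Fin p))) := by
  constructor
  · intro h
    by_contra! hcon
    have h1 : ((k + 1 : ℕ) : ℕ∞) ≤ vSparsity v w := by
      refine le_iInf₂ fun S hS => ?_
      have := mt (hcon S) (not_not.2 hS)
      exact_mod_cast not_le.1 this
    have := h1.trans h
    norm_cast at this
    omega
  · rintro ⟨S, hS, hw⟩
    exact (iInf₂_le S hw).trans (by exact_mod_cast hS)

lemma measurableSet_vSparsity_le (θ₀ : Vec d) :
    MeasurableSet {θ : Vec d | vSparsity v (θ - θ₀) ≤ (k : ℕ∞)} := by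
  have h : {θ : Vec d | vSparsity v (θ - θ₀) ≤ (k : ℕ∞)} =
      ⋃ S : Finset (Fin p), {θ | S.card ≤ k ∧
        θ - θ₀ ∈ (Submodule.span ℝ (v '' (S : Set (Fin p))) : Set (Vec d))} := by
    ext θ
    simp only [vSparsity_le_iff, mem_ofPred_eq, mem_iUnion, SetLike.mem_coe]
  rw [h]
  refine MeasurableSet.iUnion fun S => MeasurableSet.inter (MeasurableSet.const _) ?_
  exact (Submodule.closed_of_finiteDimensional _).measurableSet.preimage
    (by fun_prop : Measurable fun θ : Vec d => θ - θ₀)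

/-- The vector u lies in the span of at most k of the vectors, so only the projection of w onto that
span contributes to the inner product. -/
lemma abs_inner_le_sparseSeminorm {w u : Vec d} (hu : vSparsity v u ≤ (k : ℕ∞)) {r : ℝ}
    (hr : ‖u‖ ≤ r) : |inner ℝ w u| ≤ r * sparseSeminorm v k w := by
  obtain ⟨S, hS, hmem⟩ := (vSparsity_le_iff v k u).1 hu
  set K := Submodule.span ℝ (v '' (S : Set (Fin p))) with hK
  have h1 : inner ℝ w u = inner ℝ (K.starProjection w) u := by
    rw [Submodule.inner_starProjection_left_eq_right, Submodule.starProjection_eq_self_iff.2 hmem]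
  calc |inner ℝ w u| = |inner ℝ (K.starProjection w) u| := by rw [h1]
    _ ≤ ‖K.starProjection w‖ * ‖u‖ := abs_real_inner_le_norm _ _
    _ ≤ sparseSeminorm v k w * r := by
        exact mul_le_mul (norm_starProjection_le_sparseSeminorm v k ⟨S, hS⟩ w) hr
          (norm_nonneg _) (apply_nonneg (sparseSeminorm v k) w)
    _ = _ := mul_comm _ _

end Sparsity

namespace PenalizedModel

variable {d : ℕ} {X : Type*} [MeasurableSpace X] {D : PenalizedModel d X}

lemma measure_compl_le {Y : Type*} [MeasurableSpace Y] {μ : Measure Y} [IsProbabilityMeasure μ]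
    {A : Set Y} (hA : MeasurableSet A) {δ : ℝ} (h : 1 - δ ≤ μ.real A) :
    μ Aᶜ ≤ ENNReal.ofReal δ := by
  rw [← ofReal_measureReal, probReal_compl_eq_one_sub hA]
  exact ENNReal.ofReal_le_ofReal (by linarith)

lemma nonneg_of_one_sub_le {Y : Type*} [MeasurableSpace Y] {μ : Measure Y} [IsProbabilityMeasure μ]
    {A : Set Y} {δ : ℝ} (h : 1 - δ ≤ μ.real A) : 0 ≤ δ := by
  linarith [measureReal_le_one (μ := μ) (s := A)]

namespace Regular

variable (hR : D.Regular) {θ₀ : Vec d} (hθ₀ : θ₀ ∈ D.Θ) {r ε δ : ℝ} (hr : 0 ≤ r)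
  (hA : D.AccurateSSOSP θ₀ r δ) (hH : D.HessianConcentration θ₀ r ε)
  (hd : 1 ≤ d) (hlam : 0 ≤ D.lam) (hσ : 0 < D.σ) (hs : D.MeasurableSolver) {M : ℕ}
  {κ : Kernel (X × Vec d × Vec d) (Fin M → X)} [IsMarkovKernel κ] (hκ : D.ValidSampler κ)
include hR hθ₀ hr hA hH hd hlam hσ hs hκ

omit hR hr hθ₀ hH hd hlam hσ hs hκ in
lemma _root_.PenalizedModel.AccurateSSOSP.le_goodEvent :
    1 - δ ≤ (D.dataLaw θ₀).real (D.goodEvent (Metric.closedBall θ₀ r)) := by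
  have h : D.goodEvent (Metric.closedBall θ₀ r) =
      {q | D.IsSSOSP q.1 q.2 (D.θhat q.1 q.2) ∧ ‖D.θhat q.1 q.2 - θ₀‖ ≤ r} := by
    ext q
    simp [goodEvent, ssospEvent, dist_eq_norm]
  rw [h]
  exact hA

/-- The seminorm is the Euclidean norm, and the noise has E‖W‖² = 1, so η = 1. -/
theorem errorBound_general : ErrorBound (D.acssLaw κ θ₀) (3 * D.σ * r + ε + δ) := by
  have hD := hR.twiceDifferentiable
  have hprob := hD.isProbabilityMeasure_dataLaw hθ₀
  have hE := hD.measurableSet_goodEvent hlam hs (G := Metric.closedBall θ₀ r)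
    Metric.isClosed_closedBall.measurableSet
  have h2 : ∫ z, normSeminorm ℝ (Vec d) z ^ 2 ∂(noiseLaw d) ≤ 1 ^ 2 := by
    rw [integral_seminorm_sq_noiseLaw _ continuous_norm]
    simp only [coe_normSeminorm, integral_norm_sq_stdGaussian]
    rw [div_self (by positivity), one_pow]
  have h := hR.errorBound_of_seminorm hθ₀ hH hr hd hlam hσ hs hκ
    (N := normSeminorm ℝ (Vec d)) continuous_norm zero_le_one h2
    Metric.isClosed_closedBall.measurableSet le_rfl (fun θ hθ w => ?_)
    (nonneg_of_one_sub_le hA.le_goodEvent) (measure_compl_le hE hA.le_goodEvent)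
  · rwa [mul_one] at h
  · refine (abs_real_inner_le_norm _ _).trans ?_
    rw [mul_comm]
    refine mul_le_mul_of_nonneg_right ?_ (norm_nonneg w)
    rw [norm_sub_rev, ← dist_eq_norm]
    exact hθ

/-- The good event asks in addition that θ̂ - θ₀ be k-sparse, which costs δ'. In return the noise is
measured by its sparse projections, whose mean square is h_v(k)/d. -/
theorem errorBound_sparse {p : ℕ} (v : Fin p → Vec d) (k : ℕ) {δ' : ℝ}
    (hv : 1 - δ' ≤ (D.dataLaw θ₀).real {q | vSparsity v (D.θhat q.1 q.2 - θ₀) ≤ (k : ℕ∞)}) :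
    ErrorBound (D.acssLaw κ θ₀) (3 * D.σ * r * √(effectiveDim v k / d) + ε + δ + δ') := by
  have hD := hR.twiceDifferentiable
  have hprob := hD.isProbabilityMeasure_dataLaw hθ₀
  have hB : MeasurableSet (Metric.closedBall θ₀ r) := Metric.isClosed_closedBall.measurableSet
  have hE := hD.measurableSet_goodEvent hlam hs hB
  have hS := measurableSet_vSparsity_le v k θ₀
  have hSq : MeasurableSet {q : X × Vec d | vSparsity v (D.θhat q.1 q.2 - θ₀) ≤ (k : ℕ∞)} :=
    hs.1 hS
  have hδ := nonneg_of_one_sub_le hA.le_goodEvent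
  have hδ' := nonneg_of_one_sub_le hv
  have h2 : ∫ z, sparseSeminorm v k z ^ 2 ∂(noiseLaw d) ≤ √(effectiveDim v k / d) ^ 2 := by
    rw [integral_sparseSeminorm_sq, Real.sq_sqrt
      (div_nonneg (effectiveDim_nonneg v k) (Nat.cast_nonneg d))]
  rw [add_assoc _ δ δ']
  refine hR.errorBound_of_seminorm hθ₀ hH hr hd hlam hσ hs hκ
    (N := sparseSeminorm v k) (continuous_sparseSeminorm v k) (Real.sqrt_nonneg _) h2
    (hB.inter hS) inter_subset_left (fun θ hθ w => ?_) (add_nonneg hδ hδ') ?_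
  · have h3 : ‖θ - θ₀‖ ≤ r := by rw [← dist_eq_norm]; exact hθ.1
    have := abs_inner_le_sparseSeminorm v k (w := w) hθ.2 h3
    rwa [← neg_sub θ θ₀, inner_neg_right, abs_neg]
  · have hsub : (D.goodEvent (Metric.closedBall θ₀ r ∩
        {θ | vSparsity v (θ - θ₀) ≤ (k : ℕ∞)}))ᶜ ⊆ (D.goodEvent (Metric.closedBall θ₀ r))ᶜ ∪
          {q | vSparsity v (D.θhat q.1 q.2 - θ₀) ≤ (k : ℕ∞)}ᶜ := by
      intro q hq
      by_contra hcon
      simp only [mem_union, mem_compl_iff, not_or, not_not] at hcon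
      exact hq ⟨hcon.1.1, hcon.1.2, hcon.2⟩
    calc _ ≤ _ := measure_mono hsub
      _ ≤ _ := measure_union_le _ _
      _ ≤ ENNReal.ofReal δ + ENNReal.ofReal δ' :=
          add_le_add (measure_compl_le hE hA.le_goodEvent) (measure_compl_le hSq hv)
      _ = _ := (ENNReal.ofReal_add hδ hδ').symm

end Regular

end PenalizedModel

/-! ### The Gaussian linear model: regularity -/

section GaussianModel

variable {n d : ℕ} (Z : Matrix (Fin n) (Fin d) ℝ)

/-- The design matrix as a continuous linear map between Euclidean spaces. -/
def designMap : Vec d →L[ℝ] Vec n := LinearMap.toContinuousLinearMap (Matrix.toLpLin 2 2 Z)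

lemma designMap_apply (θ : Vec d) : designMap Z θ = WithLp.toLp 2 (Z.mulVec θ.ofLp) := rfl

lemma inner_designMap_single (i j : Fin d) :
    inner ℝ (designMap Z (EuclideanSpace.single i 1)) (designMap Z (EuclideanSpace.single j 1)) =
      (Z.transpose * Z) i j := by
  simp [designMap_apply, Matrix.mul_apply, PiLp.inner_apply, mul_comm]

/-- The bilinear form `(u, v) ↦ ⟪Z u, Z v⟫`. -/
def gramForm : Vec d →L[ℝ] Vec d →L[ℝ] ℝ :=
  ((ContinuousLinearMap.compL ℝ (Vec d) (Vec n) ℝ).flip (designMap Z)).comp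
    ((innerSL ℝ).comp (designMap Z))

lemma gramForm_apply (u v : Vec d) :
    gramForm Z u v = inner ℝ (designMap Z u) (designMap Z v) := rfl

variable {ν : ℝ} (hν : 0 < ν) {R : Vec d → ℝ} (σ lam : ℝ) (θhat : Vec n → Vec d → Vec d)

include hν in
lemma gaussianModel_f_eq (x : Vec n) (θ : Vec d) : (gaussianModel Z ν R σ lam θhat).f x θ =
    (√(2 * Real.pi * ν ^ 2))⁻¹ ^ n * Real.exp (-(1 / (2 * ν ^ 2)) * ‖x - designMap Z θ‖ ^ 2) := by
  simp only [gaussianModel, designMap_apply]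
  congr 2
  field_simp

include hν in
lemma gaussianModel_loss_eq (x : Vec n) (θ : Vec d) :
    (gaussianModel Z ν R σ lam θhat).loss x θ =
      -Real.log ((√(2 * Real.pi * ν ^ 2))⁻¹ ^ n) + 1 / (2 * ν ^ 2) * ‖x - designMap Z θ‖ ^ 2
        + R θ := by
  have h : 0 < (√(2 * Real.pi * ν ^ 2))⁻¹ ^ n := by positivity
  rw [PenalizedModel.loss, gaussianModel_f_eq Z hν, Real.log_mul h.ne' (Real.exp_pos _).ne',
    Real.log_exp]
  change _ + R θ = _
  ring

include hν in
lemma isProbabilityMeasure_gaussianModel (θ : Vec d) :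
    IsProbabilityMeasure ((gaussianModel Z ν R σ lam θhat).P θ) := by
  refine ⟨?_⟩
  have hb : (0 : ℝ) < 1 / (2 * ν ^ 2) := by positivity
  have hc : 0 ≤ (√(2 * Real.pi * ν ^ 2))⁻¹ ^ n := by positivity
  rw [PenalizedModel.P, withDensity_apply _ MeasurableSet.univ, Measure.restrict_univ]
  simp only [gaussianModel_f_eq Z hν]
  change ∫⁻ x : Vec n, _ ∂volume = 1
  rw [lintegral_sub_right_eq_self (fun x : Vec n => ENNReal.ofReal ((√(2 * Real.pi * ν ^ 2))⁻¹ ^ n *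
    Real.exp (-(1 / (2 * ν ^ 2)) * ‖x‖ ^ 2))) (designMap Z θ),
    ← ofReal_integral_eq_lintegral_ofReal ((integrable_exp_neg_mul_sq_norm hb).const_mul _)
      (.of_forall fun x => by positivity), integral_const_mul,
    GaussianFourier.integral_rexp_neg_mul_sq_norm hb]
  have h1 : Real.pi / (1 / (2 * ν ^ 2)) = 2 * Real.pi * ν ^ 2 := by field_simp
  have h2 : (2 * Real.pi * ν ^ 2) ^ ((n : ℝ) / 2) = √(2 * Real.pi * ν ^ 2) ^ n := by
    rw [Real.sqrt_eq_rpow, ← Real.rpow_mul_natCast (by positivity)]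
    congr 1; ring
  have h3 : √(2 * Real.pi * ν ^ 2) ≠ 0 := by positivity
  rw [finrank_euclideanSpace_fin, h1, h2, inv_pow, inv_mul_cancel₀ (pow_ne_zero _ h3),
    ENNReal.ofReal_one]

variable (hR : Differentiable ℝ R) (hR' : Differentiable ℝ (fderiv ℝ R))

include hν hR in
lemma hasFDerivAt_gaussianModel_loss (x : Vec n) (θ : Vec d) :
    HasFDerivAt ((gaussianModel Z ν R σ lam θhat).loss x)
      ((1 / ν ^ 2) • (gramForm Z θ - (innerSL ℝ x).comp (designMap Z)) + fderiv ℝ R θ) θ := by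
  have h1 : HasFDerivAt (fun θ => x - designMap Z θ) (-(designMap Z)) θ :=
    (designMap Z).hasFDerivAt.const_sub x
  have h2 := ((h1.norm_sq.const_mul (1 / (2 * ν ^ 2))).const_add
    (-Real.log ((√(2 * Real.pi * ν ^ 2))⁻¹ ^ n))).add (hR θ).hasFDerivAt
  refine (h2.congr_of_eventuallyEq (.of_forall fun η => ?_)).congr_fderiv ?_
  · rw [gaussianModel_loss_eq Z hν]
    rfl
  · ext v
    simp [gramForm_apply]
    field_simp

include hν hR hR' in
lemma hasFDerivAt_fderiv_gaussianModel_loss (x : Vec n) (θ : Vec d) :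
    HasFDerivAt (fderiv ℝ ((gaussianModel Z ν R σ lam θhat).loss x))
      ((1 / ν ^ 2) • gramForm Z + fderiv ℝ (fderiv ℝ R) θ) θ := by
  have h1 : HasFDerivAt (fun θ => (1 / ν ^ 2) • (gramForm Z θ - (innerSL ℝ x).comp (designMap Z)) +
      fderiv ℝ R θ) ((1 / ν ^ 2) • gramForm Z + fderiv ℝ (fderiv ℝ R) θ) θ :=
    (((gramForm Z).hasFDerivAt.sub_const ((innerSL ℝ x).comp (designMap Z))).const_smul
      (1 / ν ^ 2)).add (hR' θ).hasFDerivAt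
  exact h1.congr_of_eventuallyEq (.of_forall fun η =>
    (hasFDerivAt_gaussianModel_loss Z hν σ lam θhat hR x η).fderiv)

include hν hR hR' in
lemma hessian_gaussianModel_loss (x : Vec n) (θ : Vec d) :
    hessian ((gaussianModel Z ν R σ lam θhat).loss x) θ =
      (1 / ν ^ 2) • (Z.transpose * Z) + hessian R θ := by
  ext i j
  simp only [hessian, Matrix.of_apply, Matrix.add_apply, Matrix.smul_apply]
  rw [(hasFDerivAt_fderiv_gaussianModel_loss Z hν σ lam θhat hR hR' x θ).fderiv,
    ← inner_designMap_single]
  rfl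

include hν hR hR' in
lemma twiceDifferentiable_gaussianModel :
    (gaussianModel Z ν R σ lam θhat).TwiceDifferentiable where
  isOpen := isOpen_univ
  measurable_f θ _ := by
    simp only [gaussianModel_f_eq Z hν]
    exact (by fun_prop : Measurable fun x : Vec n => (√(2 * Real.pi * ν ^ 2))⁻¹ ^ n *
      Real.exp (-(1 / (2 * ν ^ 2)) * ‖x - designMap Z θ‖ ^ 2))
  f_pos θ _ x := by
    rw [gaussianModel_f_eq Z hν]; positivity
  isProbabilityMeasure θ _ := isProbabilityMeasure_gaussianModel Z hν σ lam θhat θ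
  continuousOn_R := hR.continuous.continuousOn
  differentiableOn_loss x θ _ :=
    (hasFDerivAt_gaussianModel_loss Z hν σ lam θhat hR x θ).differentiableAt.differentiableWithinAt
  differentiableOn_fderiv_loss x θ _ := (hasFDerivAt_fderiv_gaussianModel_loss Z hν σ lam θhat hR
    hR' x θ).differentiableAt.differentiableWithinAt

include hν hR in
lemma gradient_gaussianModel_loss (x : Vec n) (θ : Vec d) :
    gradient ((gaussianModel Z ν R σ lam θhat).loss x) θ =
      (1 / ν ^ 2) • (designMap Z).adjoint (designMap Z θ - x) + gradient R θ := by
  refine ext_inner_right ℝ fun v => ?_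
  rw [inner_gradient_left, (hasFDerivAt_gaussianModel_loss Z hν σ lam θhat hR x θ).fderiv,
    inner_add_left, inner_gradient_left, real_inner_smul_left,
    ContinuousLinearMap.adjoint_inner_left, inner_sub_left]
  rfl

end GaussianModel

/-! ### Minimizers of strictly convex penalized problems -/

/-- The one-dimensional first-order conditions for a penalized problem. -/
lemma first_order_of_forall_le {φ : ℝ → ℝ} {a lam y : ℝ} (hφ : HasDerivAt φ a 0)
    (h : ∀ t, φ 0 + lam * |y| ≤ φ t + lam * |y + t|) :
    (y ≠ 0 → a = -(lam * Real.sign y)) ∧ (y = 0 → |a| ≤ lam) := by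
  constructor
  · intro hy
    have hs : Real.sign y * y = |y| := by
      rcases lt_or_gt_of_ne hy with h0 | h0
      · rw [Real.sign_of_neg h0, abs_of_neg h0]; ring
      · rw [Real.sign_of_pos h0, abs_of_pos h0]; ring
    have hloc : ∀ᶠ t in nhds (0 : ℝ), |y + t| = Real.sign y * (y + t) := by
      rcases lt_or_gt_of_ne hy with h0 | h0
      · filter_upwards [Iio_mem_nhds (show (0 : ℝ) < -y by linarith)] with t ht
        rw [Real.sign_of_neg h0, abs_of_neg (by linarith [mem_Iio.1 ht])]; ring
      · filter_upwards [Ioi_mem_nhds (show -y < (0 : ℝ) by linarith)] with t ht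
        rw [Real.sign_of_pos h0, abs_of_pos (by linarith [mem_Ioi.1 ht])]; ring
    have hd : HasDerivAt (fun t => φ t + lam * (Real.sign y * (y + t)))
        (a + lam * (Real.sign y * 1)) 0 :=
      hφ.add ((((hasDerivAt_id (0 : ℝ)).const_add y).const_mul _).const_mul _)
    have hmin : IsLocalMin (fun t => φ t + lam * (Real.sign y * (y + t))) 0 := by
      filter_upwards [hloc] with t ht
      have := h t
      rw [ht] at this
      rw [add_zero, hs]
      exact this
    have := hmin.hasDerivAt_eq_zero hd
    linarith
  · rintro rfl
    -- At the kink, slopes from the right are at least -λ and slopes from the left are at most λ;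
    -- both converge to the derivative a.
    have hlim := hasDerivAt_iff_tendsto_slope_zero.1 hφ
    simp only [abs_zero, mul_zero, add_zero, zero_add, smul_eq_mul] at h hlim
    rw [abs_le]
    constructor
    · refine ge_of_tendsto (hlim.mono_left (nhdsGT_le_nhdsNE 0)) ?_
      filter_upwards [self_mem_nhdsWithin] with t ht
      have ht : 0 < t := ht
      have := h t
      rw [abs_of_pos ht] at this
      rw [inv_mul_eq_div, le_div_iff₀ ht]
      linarith
    · refine le_of_tendsto (hlim.mono_left (nhdsLT_le_nhdsNE 0)) ?_
      filter_upwards [self_mem_nhdsWithin] with t ht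
      have ht : t < 0 := ht
      have := h t
      rw [abs_of_neg ht] at this
      rw [inv_mul_eq_div, div_le_iff_of_neg ht]
      linarith

/-- A function with positive second derivative lies strictly above its tangents. -/
lemma add_fderiv_lt {d : ℕ} {F : Vec d → ℝ} (hF : Differentiable ℝ F)
    (hF' : Differentiable ℝ (fderiv ℝ F))
    (hpos : ∀ θ v, v ≠ 0 → 0 < fderiv ℝ (fderiv ℝ F) θ v v) {θ η : Vec d} (hne : η ≠ θ) :
    F θ + fderiv ℝ F θ (η - θ) < F η := by
  set v := η - θ with hv
  have hv0 : v ≠ 0 := sub_ne_zero.2 hne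
  have hline : ∀ t : ℝ, HasDerivAt (fun t : ℝ => θ + t • v) v t := fun t => by
    simpa using ((hasDerivAt_id t).smul_const v).const_add θ
  have h1 : ∀ t : ℝ, HasDerivAt (fun t : ℝ => F (θ + t • v)) (fderiv ℝ F (θ + t • v) v) t :=
    fun t => (hF _).hasFDerivAt.comp_hasDerivAt t (hline t)
  have h2 : ∀ t : ℝ, HasDerivAt (fun t : ℝ => fderiv ℝ F (θ + t • v) v)
      (fderiv ℝ (fderiv ℝ F) (θ + t • v) v v) t := fun t => by
    have h := (hF' _).hasFDerivAt.comp_hasDerivAt t (hline t)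
    simpa using h.clm_apply (hasDerivAt_const t v)
  -- The second derivative is not assumed continuous, so the argument uses strict monotonicity of
  -- the derivative along the line and the mean value theorem instead of an integral remainder.
  have hmono : StrictMono fun t : ℝ => fderiv ℝ F (θ + t • v) v :=
    strictMono_of_deriv_pos fun t => by rw [(h2 t).deriv]; exact hpos _ _ hv0
  obtain ⟨s, hs, hs'⟩ := exists_hasDerivAt_eq_slope (fun t : ℝ => F (θ + t • v)) _
    zero_lt_one (fun t _ => (h1 t).continuousAt.continuousWithinAt) fun t _ => h1 t
  have h3 := hmono hs.1
  simp only [one_smul, zero_smul, add_zero, sub_zero, div_one] at hs' h3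
  rw [show θ + v = η by rw [hv]; abel] at hs'
  linarith

namespace PenalizedModel

variable {d : ℕ} {X : Type*} [MeasurableSpace X] {D : PenalizedModel d X}
  (hD : D.TwiceDifferentiable) (hΘ : D.Θ = univ) (hlam : 0 ≤ D.lam)
include hD hΘ

/-- Varying one coordinate at a time suffices: the ℓ¹ norm is separable, and the conditions concern
each coordinate separately. -/
lemma TwiceDifferentiable.kkt_of_isMinOn {x : X} {w θ : Vec d}
    (h : IsMinOn (D.objective x w) univ θ) : D.KKT θ (gradient (D.loss x) θ + D.σ • w) := by
  intro j
  have hθ : θ ∈ D.Θ := hΘ ▸ mem_univ θ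
  have hdiff : DifferentiableAt ℝ (D.perturbedLoss x w) θ := by
    refine ((hD.differentiableOn_loss x).differentiableAt (hD.isOpen.mem_nhds hθ)).add ?_
    exact ((innerSL ℝ w).differentiableAt).const_mul D.σ
  have hline : HasDerivAt (fun t : ℝ => θ + t • EuclideanSpace.single j (1 : ℝ))
      (EuclideanSpace.single j (1 : ℝ)) 0 := by
    simpa using ((hasDerivAt_id (0 : ℝ)).smul_const (EuclideanSpace.single j (1 : ℝ))).const_add θ
  have hφ : HasDerivAt (fun t : ℝ => D.perturbedLoss x w (θ + t • EuclideanSpace.single j (1 : ℝ)))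
      ((gradient (D.loss x) θ + D.σ • w) j) 0 := by
    rw [← hD.gradient_perturbedLoss x w hθ, gradient_apply]
    have h0 : HasFDerivAt (D.perturbedLoss x w) (fderiv ℝ (D.perturbedLoss x w) θ)
        (θ + (0 : ℝ) • EuclideanSpace.single j (1 : ℝ)) := by simpa using hdiff.hasFDerivAt
    exact h0.comp_hasDerivAt 0 hline
  refine first_order_of_forall_le hφ fun t => ?_
  have hmin : D.objective x w θ ≤ D.objective x w (θ + t • EuclideanSpace.single j (1 : ℝ)) :=
    h (mem_univ _)
  simp only [objective] at hmin
  have hsum : ∀ s : ℝ, ∑ i, |(θ + s • EuclideanSpace.single j (1 : ℝ)) i| =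
      |θ j + s| + ∑ i ∈ Finset.univ.erase j, |θ i| := fun s => by
    rw [← Finset.add_sum_erase _ _ (Finset.mem_univ j)]
    congr 1
    · simp
    · refine Finset.sum_congr rfl fun i hi => ?_
      simp [Finset.ne_of_mem_erase hi]
  rw [hsum t, ← Finset.add_sum_erase _ _ (Finset.mem_univ j)] at hmin
  simp only [zero_smul, add_zero]
  linarith

include hlam in
-- If θ ≠ η, the strict tangent inequality for the smooth part and the subgradient inequality for
-- the ℓ¹ norm would make the objective strictly larger at η than at θ.
lemma TwiceDifferentiable.eq_of_kkt_of_isMinOn {x : X} {w θ η : Vec d}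
    (hpos : ∀ θ v, v ≠ 0 → 0 < fderiv ℝ (fderiv ℝ (D.loss x)) θ v v)
    (h : D.KKT θ (gradient (D.loss x) θ + D.σ • w)) (hη : IsMinOn (D.objective x w) univ η) :
    θ = η := by
  by_contra hne
  have hF : Differentiable ℝ (D.loss x) := by
    rw [← differentiableOn_univ, ← hΘ]; exact hD.differentiableOn_loss x
  have hF' : Differentiable ℝ (fderiv ℝ (D.loss x)) := by
    rw [← differentiableOn_univ, ← hΘ]; exact hD.differentiableOn_fderiv_loss x
  have h1 := add_fderiv_lt hF hF' hpos (Ne.symm hne)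
  have h2 : D.objective x w η ≤ D.objective x w θ := hη (mem_univ θ)
  set g := gradient (D.loss x) θ + D.σ • w with hg
  have h3 : inner ℝ g (η - θ) = fderiv ℝ (D.loss x) θ (η - θ) +
      D.σ * (inner ℝ w η - inner ℝ w θ) := by
    rw [hg, inner_add_left, inner_gradient_left, real_inner_smul_left, inner_sub_right]
  -- Since -g is λ times a subgradient of the ℓ¹ norm at θ, this is its subgradient inequality,
  -- checked coordinate by coordinate.
  have h4 : 0 ≤ D.lam * ∑ j, |η j| - D.lam * ∑ j, |θ j| + inner ℝ g (η - θ) := by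
    have h5 : inner ℝ g (η - θ) = ∑ j, g j * (η j - θ j) := by
      simp [PiLp.inner_apply, mul_comm]
    rw [h5, Finset.mul_sum, Finset.mul_sum, ← Finset.sum_sub_distrib, ← Finset.sum_add_distrib]
    refine Finset.sum_nonneg fun j _ => ?_
    by_cases h0 : θ j = 0
    · have hgj := (h j).2 h0
      have : |g j * η j| ≤ D.lam * |η j| := by
        rw [abs_mul]; exact mul_le_mul_of_nonneg_right hgj (abs_nonneg _)
      rw [h0, abs_zero]
      linarith [neg_le_of_abs_le this]
    · rw [(h j).1 h0]
      rcases lt_or_gt_of_ne h0 with hs | hs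
      · rw [Real.sign_of_neg hs, abs_of_neg hs]
        nlinarith [mul_nonneg hlam (show 0 ≤ |η j| + η j by linarith [neg_abs_le (η j)])]
      · rw [Real.sign_of_pos hs, abs_of_pos hs]
        nlinarith [mul_nonneg hlam (show 0 ≤ |η j| - η j by linarith [le_abs_self (η j)])]
  simp only [objective, perturbedLoss] at h2
  linarith

end PenalizedModel

/-! ### Stationary points in the Gaussian linear model -/

section GaussianModel

variable {n d : ℕ} (Z : Matrix (Fin n) (Fin d) ℝ) {ν c : ℝ} (hν : 0 < ν) {R : Vec d → ℝ}
  {σ lam : ℝ} {θhat : Vec n → Vec d → Vec d} (hσ : 0 < σ) (hlam : 0 ≤ lam) (hc : 0 < c)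
  (hR : Differentiable ℝ R) (hR' : Differentiable ℝ (fderiv ℝ R))
  (hpd : ∀ θ, ((1 / ν ^ 2) • (Z.transpose * Z) + hessian R θ
    - c • (1 : Matrix (Fin d) (Fin d) ℝ)).PosDef)
  (hmin : ∀ x w, IsMinOn ((gaussianModel Z ν R σ lam θhat).objective x w) Set.univ (θhat x w))

lemma dotProduct_mulVec_eq_quadForm (A : Matrix (Fin d) (Fin d) ℝ) (v : Vec d) :
    star v.ofLp ⬝ᵥ A.mulVec v.ofLp = quadForm A v := by
  simp only [dotProduct, Matrix.mulVec, quadForm, Finset.mul_sum]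
  refine Finset.sum_congr rfl fun i _ => Finset.sum_congr rfl fun j _ => ?_
  simp; ring

include hν hc hR hR' hpd in
lemma posDef_hessian_gaussianModel (x : Vec n) (θ : Vec d) :
    (hessian ((gaussianModel Z ν R σ lam θhat).loss x) θ).PosDef := by
  rw [hessian_gaussianModel_loss Z hν σ lam θhat hR hR']
  have h : (c • (1 : Matrix (Fin d) (Fin d) ℝ)).PosDef := Matrix.PosDef.one.smul hc
  simpa using (hpd θ).add h

include hν hc hR hR' hpd in
lemma fderiv_fderiv_gaussianModel_pos (x : Vec n) (θ v : Vec d) (hv : v ≠ 0) :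
    0 < fderiv ℝ (fderiv ℝ ((gaussianModel Z ν R σ lam θhat).loss x)) θ v v := by
  rw [fderiv_fderiv_eq_quadForm, ← dotProduct_mulVec_eq_quadForm]
  exact (posDef_hessian_gaussianModel Z hν hc hR hR' hpd x θ).dotProduct_mulVec_pos
    (by simpa using hv)

include hν hlam hc hR hR' hpd hmin in
-- Uniform convexity makes the minimizer the only stationary point, and every principal submatrix of
-- the positive definite Hessian is positive definite.
lemma isSSOSP_gaussianModel_iff (x : Vec n) (w θ : Vec d) :
    (gaussianModel Z ν R σ lam θhat).IsSSOSP x w θ ↔ θ = θhat x w := by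
  have hD := twiceDifferentiable_gaussianModel Z hν σ lam θhat hR hR'
  rw [hD.isSSOSP_iff hlam]
  constructor
  · rintro ⟨-, h, -⟩
    exact hD.eq_of_kkt_of_isMinOn rfl hlam
      (fun θ v hv => fderiv_fderiv_gaussianModel_pos Z hν hc hR hR' hpd x θ v hv) h (hmin x w)
  · rintro rfl
    exact ⟨mem_univ _, hD.kkt_of_isMinOn rfl (hmin x w),
      (posDef_hessian_gaussianModel Z hν hc hR hR' hpd x _).submatrix Subtype.val_injective⟩

include hν hσ hlam hc hR hR' hpd hmin in
-- Feasibility does not depend on x: if (θ, g) satisfies the stationarity conditions, then for every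
-- x the noise determined by (x, θ, g) makes θ stationary, hence equal to the minimizer. The
-- indicator in the plug-in density is therefore constant in x.
lemma mem_feasibleSet_gaussianModel_iff (x : Vec n) (θ g : Vec d) :
    x ∈ (gaussianModel Z ν R σ lam θhat).feasibleSet θ g ↔
      (gaussianModel Z ν R σ lam θhat).KKT θ g := by
  have hD := twiceDifferentiable_gaussianModel Z hν σ lam θhat hR hR'
  have hσ' : (gaussianModel Z ν R σ lam θhat).σ ≠ 0 := hσ.ne'
  have hg : gradient ((gaussianModel Z ν R σ lam θhat).loss x) θ +
      (gaussianModel Z ν R σ lam θhat).σ • (gaussianModel Z ν R σ lam θhat).noiseOf x θ g = g := by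
    rw [PenalizedModel.noiseOf, smul_inv_smul₀ hσ', add_sub_cancel]
  have key := isSSOSP_gaussianModel_iff Z hν hlam hc hR hR' hpd hmin x
    ((gaussianModel Z ν R σ lam θhat).noiseOf x θ g) θ
  rw [hD.mem_feasibleSet_iff hσ]
  constructor
  · rintro ⟨-, h⟩
    have := ((hD.isSSOSP_iff hlam _ _ _).1 h).2.1
    rwa [hg] at this
  · intro h
    have h1 : (gaussianModel Z ν R σ lam θhat).IsSSOSP x
        ((gaussianModel Z ν R σ lam θhat).noiseOf x θ g) θ := by
      rw [hD.isSSOSP_iff hlam, hg]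
      exact ⟨mem_univ _, h, (posDef_hessian_gaussianModel Z hν hc hR hR' hpd x _).submatrix
        Subtype.val_injective⟩
    exact ⟨key.1 h1, h1⟩

end GaussianModel

/-! ### Translations of Gaussian weights -/

section Shift

variable {n : ℕ}

/-- The positive part of the difference between a Gaussian weight and its translate. -/
lemma lintegral_exp_sub_shift_le {q : Vec n → ℝ}
    (hint : Integrable fun x => Real.exp (-q x)) {u : Vec n} {s s₀ : ℝ}
    (hmid : ∀ x, (q x + q (x + u)) / 2 = q (x + (1 / 2 : ℝ) • u) + s ^ 2 / 8) (hs : 0 ≤ s)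
    (hs₀ : s ≤ s₀) (hu : s₀ = 0 → u = 0) :
    ∫⁻ x, ENNReal.ofReal (Real.exp (-q x) - Real.exp (-q (x + u))) ≤
      ENNReal.ofReal (s₀ / 2) * ∫⁻ x, ENNReal.ofReal (Real.exp (-q x)) := by
  -- The argument below divides by s₀; for s₀ = 0 the translation is trivial and the difference
  -- vanishes.
  rcases (hs.trans hs₀).eq_or_lt with h0 | h0
  · simp [hu h0.symm]
  have hint1 : Integrable fun x => Real.exp (-q (x + u)) := hint.comp_add_right u
  have hint2 : Integrable fun x => Real.exp (-q (x + (1 / 2 : ℝ) • u)) := hint.comp_add_right _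
  have hI1 : ∫ x, Real.exp (-q (x + u)) = ∫ x, Real.exp (-q x) :=
    integral_add_right_eq_self (fun x => Real.exp (-q x)) u
  have hI2 : ∫ x, Real.exp (-q (x + (1 / 2 : ℝ) • u)) = ∫ x, Real.exp (-q x) :=
    integral_add_right_eq_self (fun x => Real.exp (-q x)) ((1 / 2 : ℝ) • u)
  set I := ∫ x, Real.exp (-q x) with hI
  have hI0 : 0 ≤ I := integral_nonneg fun x => (Real.exp_pos _).le
  set e := Real.exp (-(s ^ 2 / 8)) with he
  have he1 : 1 - s ^ 2 / 8 ≤ e := by linarith [Real.add_one_le_exp (-(s ^ 2 / 8))]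
  have he2 : e ≤ 1 := Real.exp_le_one_iff.2 (by linarith [sq_nonneg s])
  -- With a² and b² the two weights, F is (a² - b²)/2 + (a - b)²/s₀ + (s₀/16)(a + b)², expanded so
  -- that each term integrates explicitly. The product ab is e times the weight at the midpoint, so
  -- the Hellinger affinity is e = exp(-s²/8).
  set F : Vec n → ℝ := fun x => (1 / 2 + 1 / s₀ + s₀ / 16) * Real.exp (-q x) +
    (-1 / 2 + 1 / s₀ + s₀ / 16) * Real.exp (-q (x + u)) +
    (-2 / s₀ + s₀ / 8) * e * Real.exp (-q (x + (1 / 2 : ℝ) • u)) with hF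
  have hFint : Integrable F := ((hint.const_mul _).add (hint1.const_mul _)).add (hint2.const_mul _)
  have hFI : ∫ x, F x ≤ s₀ / 2 * I := by
    have h1 : ∫ x, F x = (1 / 2 + 1 / s₀ + s₀ / 16) * I + (-1 / 2 + 1 / s₀ + s₀ / 16) * I +
        (-2 / s₀ + s₀ / 8) * e * I := by
      have hadd : Integrable fun x => (1 / 2 + 1 / s₀ + s₀ / 16) * Real.exp (-q x) +
          (-1 / 2 + 1 / s₀ + s₀ / 16) * Real.exp (-q (x + u)) :=
        (hint.const_mul _).add (hint1.const_mul _)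
      rw [hF, integral_add hadd (hint2.const_mul _), integral_add (hint.const_mul _) (hint1.const_mul _), integral_const_mul,
        integral_const_mul, integral_const_mul, hI1, hI2]
    rw [h1]
    have h2 : (1 - e) / s₀ ≤ s₀ / 8 := by
      rw [div_le_iff₀ h0]
      nlinarith
    have h3 : (1 / 2 + 1 / s₀ + s₀ / 16) * I + (-1 / 2 + 1 / s₀ + s₀ / 16) * I +
        (-2 / s₀ + s₀ / 8) * e * I = (2 * ((1 - e) / s₀) + s₀ / 8 * (1 + e)) * I := by ring
    rw [h3]
    refine mul_le_mul_of_nonneg_right ?_ hI0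
    nlinarith
  have hpt : ∀ x, Real.exp (-q x) - Real.exp (-q (x + u)) ≤ F x ∧ 0 ≤ F x := by
    intro x
    set a := Real.exp (-(q x) / 2) with ha
    set b := Real.exp (-(q (x + u)) / 2) with hb
    have h1 : Real.exp (-q x) = a ^ 2 := by rw [ha, ← Real.exp_nat_mul]; congr 1; push_cast; ring
    have h2 : Real.exp (-q (x + u)) = b ^ 2 := by
      rw [hb, ← Real.exp_nat_mul]; congr 1; push_cast; ring
    have h3 : e * Real.exp (-q (x + (1 / 2 : ℝ) • u)) = a * b := by
      rw [he, ha, hb, ← Real.exp_add, ← Real.exp_add]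
      congr 1
      linarith [hmid x]
    have h4 : F x = 1 / 2 * (a ^ 2 - b ^ 2) + (1 / s₀ * (a - b) ^ 2 + s₀ / 16 * (a + b) ^ 2) := by
      simp only [hF]
      rw [h1, h2, mul_assoc, h3]
      field_simp
      ring
    -- The arithmetic-geometric mean inequality for |a - b|(a + b), balanced so that each of the two
    -- terms integrates to at most s₀/4 times the total mass.
    have h5 : 1 / 2 * |a ^ 2 - b ^ 2| ≤ 1 / s₀ * (a - b) ^ 2 + s₀ / 16 * (a + b) ^ 2 := by
      have h6 : 1 / s₀ * (a - b) ^ 2 + s₀ / 16 * (a + b) ^ 2 - 1 / 2 * (a ^ 2 - b ^ 2) =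
          1 / s₀ * ((a - b) - s₀ / 4 * (a + b)) ^ 2 := by field_simp; ring
      have h7 : 1 / s₀ * (a - b) ^ 2 + s₀ / 16 * (a + b) ^ 2 + 1 / 2 * (a ^ 2 - b ^ 2) =
          1 / s₀ * ((a - b) + s₀ / 4 * (a + b)) ^ 2 := by field_simp; ring
      have h8 : 0 ≤ 1 / s₀ * ((a - b) - s₀ / 4 * (a + b)) ^ 2 := by positivity
      have h9 : 0 ≤ 1 / s₀ * ((a - b) + s₀ / 4 * (a + b)) ^ 2 := by positivity
      rcases abs_choice (a ^ 2 - b ^ 2) with h | h <;> rw [h] <;> linarith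
    rw [h1, h2, h4]
    constructor
    · linarith [le_abs_self (a ^ 2 - b ^ 2)]
    · linarith [neg_abs_le (a ^ 2 - b ^ 2)]
  calc _ ≤ ∫⁻ x, ENNReal.ofReal (F x) :=
        lintegral_mono fun x => ENNReal.ofReal_le_ofReal (hpt x).1
    _ = ENNReal.ofReal (∫ x, F x) :=
        (ofReal_integral_eq_lintegral_ofReal hFint (.of_forall fun x => (hpt x).2)).symm
    _ ≤ ENNReal.ofReal (s₀ / 2 * I) := ENNReal.ofReal_le_ofReal hFI
    _ = _ := by
        rw [ENNReal.ofReal_mul (by linarith), hI, ofReal_integral_eq_lintegral_ofReal hint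
          (.of_forall fun x => (Real.exp_pos _).le)]

/-- The operator a·1 + b B*B is positive definite and hence invertible; U is its inverse applied to
aA. -/
lemma exists_shift {d : ℕ} (A : Vec d →L[ℝ] Vec n) (B : Vec n →L[ℝ] Vec d) {a b : ℝ} (ha : 0 < a)
    (hb : 0 ≤ b) : ∃ U : Vec d →L[ℝ] Vec n, ∀ v x,
      a * inner ℝ (U v) x + b * inner ℝ (B (U v)) (B x) = a * inner ℝ (A v) x := by
  set P : Vec n →ₗ[ℝ] Vec n := (a • ContinuousLinearMap.id ℝ (Vec n) +
    b • (B.adjoint.comp B)).toLinearMap with hP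
  have hPi : ∀ y x, inner ℝ (P y) x = a * inner ℝ y x + b * inner ℝ (B y) (B x) := fun y x => by
    simp [hP, inner_add_left, real_inner_smul_left, ContinuousLinearMap.adjoint_inner_left]
  have hinj : Function.Injective P := by
    rw [injective_iff_map_eq_zero]
    intro y hy
    have h := hPi y y
    rw [hy, inner_zero_left, real_inner_self_eq_norm_sq, real_inner_self_eq_norm_sq] at h
    have h1 : a * ‖y‖ ^ 2 ≤ 0 := by nlinarith [sq_nonneg ‖B y‖]
    have h2 : ‖y‖ ^ 2 ≤ 0 := by
      by_contra hcon
      nlinarith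
    exact norm_eq_zero.1 (pow_eq_zero_iff two_ne_zero |>.1 (le_antisymm h2 (sq_nonneg _)))
  set e := LinearEquiv.ofInjectiveEndo P hinj with he
  refine ⟨LinearMap.toContinuousLinearMap (e.symm.toLinearMap ∘ₗ (a • A).toLinearMap),
    fun v x => ?_⟩
  rw [← hPi]
  have h1 : P (e.symm ((a • A) v)) = (a • A) v := e.apply_symm_apply _
  have h2 : P ((LinearMap.toContinuousLinearMap (e.symm.toLinearMap ∘ₗ (a • A).toLinearMap)) v) =
      a • A v := h1
  rw [h2, real_inner_smul_left]

end Shift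

/-! ### The error bound in the Gaussian linear model -/

namespace PenalizedModel

variable {d : ℕ} {X : Type*} [MeasurableSpace X] {D : PenalizedModel d X}

/-- Integrals over the good event can be compared at fixed estimator and gradient. -/
lemma TwiceDifferentiable.setLIntegral_goodEvent_le (hD : D.TwiceDifferentiable)
    (hlam : 0 ≤ D.lam) (hσ : 0 < D.σ) (hs : D.MeasurableSolver) (hd : 1 ≤ d) {θ₀ : Vec d}
    (hθ₀ : θ₀ ∈ D.Θ) {G : Set (Vec d)} (hG : MeasurableSet G) {Φ Ψ : X × Vec d × Vec d → ℝ≥0∞}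
    (hΦ : Measurable Φ) (hΨ : Measurable Ψ) {K : ℝ≥0∞} (hK : K ≠ ∞)
    (h : ∀ t : Vec d × Vec d, t.1 ∈ G → ∫⁻ x, Φ (x, t) * D.jointWeight θ₀ (x, t) ∂D.base ≤
      K * ∫⁻ x, Ψ (x, t) * D.jointWeight θ₀ (x, t) ∂D.base) :
    ∫⁻ q in D.goodEvent G, Φ (D.estimates q) ∂(D.dataLaw θ₀) ≤
      K * ∫⁻ q in D.goodEvent G, Ψ (D.estimates q) ∂(D.dataLaw θ₀) := by
  obtain ⟨c, hc, hlaw⟩ := exists_noiseLaw_eq_withDensity hd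
  have hGt : MeasurableSet {t : X × Vec d × Vec d | t.2.1 ∈ G} :=
    hG.preimage (measurable_fst.comp measurable_snd)
  have key : ∀ Φ : X × Vec d × Vec d → ℝ≥0∞, Measurable Φ →
      ∫⁻ q in D.goodEvent G, Φ (D.estimates q) ∂(D.dataLaw θ₀) =
      ENNReal.ofReal (c * D.σ⁻¹ ^ d) * ∑ S : Finset (Fin d), ∫⁻ u in chartDomain S,
        ∫⁻ x, {t : X × Vec d × Vec d | t.2.1 ∈ G}.indicator Φ
          (x, coordProj S u, chartGrad D.lam S u) *
          D.jointWeight θ₀ (x, coordProj S u, chartGrad D.lam S u) ∂D.base := by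
    intro Φ hΦ
    have hGq : MeasurableSet {q : X × Vec d | D.θhat q.1 q.2 ∈ G} := hs.1 hG
    rw [← hD.setLIntegral_dataLaw hlam hσ hs hc hlaw hθ₀ (hΦ.indicator hGt), goodEvent, inter_comm,
      ← Measure.restrict_restrict hGq, ← lintegral_indicator hGq]
    rfl
  rw [key Φ hΦ, key Ψ hΨ, mul_left_comm K, Finset.mul_sum _ _ K]
  refine mul_le_mul' le_rfl (Finset.sum_le_sum fun S _ => ?_)
  rw [← lintegral_const_mul' _ _ hK]
  refine lintegral_mono fun u => ?_
  by_cases hu : coordProj S u ∈ G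
  · simp only [indicator, mem_ofPred_eq, hu, if_true]
    exact h (coordProj S u, chartGrad D.lam S u) hu
  · simp [indicator, hu]

end PenalizedModel

section GaussianModel

variable {n d : ℕ} (Z : Matrix (Fin n) (Fin d) ℝ) {ν c : ℝ} (hν : 0 < ν) {R : Vec d → ℝ}
  {σ lam : ℝ} {θhat : Vec n → Vec d → Vec d} (hσ : 0 < σ) (hlam : 0 ≤ lam) (hc : 0 < c)
  (hR : Differentiable ℝ R) (hR' : Differentiable ℝ (fderiv ℝ R))
  (hpd : ∀ θ, ((1 / ν ^ 2) • (Z.transpose * Z) + hessian R θ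
    - c • (1 : Matrix (Fin d) (Fin d) ℝ)).PosDef)
  (hmin : ∀ x w, IsMinOn ((gaussianModel Z ν R σ lam θhat).objective x w) Set.univ (θhat x w))
  (θ₀ : Vec d)

variable (ν σ) in
/-- The linear part of the map from the data to the noise, at fixed estimator and gradient. -/
def noiseMap : Vec n →L[ℝ] Vec d := (σ⁻¹ * (1 / ν ^ 2)) • (designMap Z).adjoint

include hν hR in
lemma noiseOf_gaussianModel (x : Vec n) (t : Vec d × Vec d) :
    (gaussianModel Z ν R σ lam θhat).noiseOf x t.1 t.2 =
      noiseMap Z ν σ x + (gaussianModel Z ν R σ lam θhat).noiseOf 0 t.1 t.2 := by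
  simp only [PenalizedModel.noiseOf, gradient_gaussianModel_loss Z hν σ lam θhat hR, noiseMap]
  change σ⁻¹ • _ = _ + σ⁻¹ • _
  simp only [map_sub, map_zero, FunLike.coe_smul, Pi.smul_apply]
  module

variable (ν R σ lam θhat) in
/-- Minus the logarithm of the density of the data at fixed estimator and gradient, up to a
constant. -/
def condExponent (t : Vec d × Vec d) (x : Vec n) : ℝ :=
  1 / (2 * ν ^ 2) * ‖x - designMap Z θ₀‖ ^ 2 + d / 2 * ‖noiseMap Z ν σ x +
    (gaussianModel Z ν R σ lam θhat).noiseOf 0 t.1 t.2‖ ^ 2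

include hν hR hR' hσ hlam hc hpd hmin in
-- The feasible set and the Hessian do not depend on x, so at fixed (θ, g) only two exponentials of
-- quadratics remain: the likelihood at θ₀ and the density of the noise.
lemma jointWeight_gaussianModel : ∃ W : Vec d × Vec d → ℝ≥0∞, ∀ t x,
    (gaussianModel Z ν R σ lam θhat).jointWeight θ₀ (x, t) =
      W t * ENNReal.ofReal (Real.exp (-condExponent Z ν R σ lam θhat θ₀ t x)) := by
  classical
  have hD := twiceDifferentiable_gaussianModel Z hν σ lam θhat hR hR'
  set D := gaussianModel Z ν R σ lam θhat with hDdef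
  refine ⟨fun t => if D.KKT t.1 t.2 then ENNReal.ofReal ((√(2 * Real.pi * ν ^ 2))⁻¹ ^ n *
    (suppSubmatrix t.1 (hessian (D.loss 0) t.1)).det) else 0, fun t x => ?_⟩
  by_cases ht : D.KKT t.1 t.2
  · have hx : x ∈ D.feasibleSet t.1 t.2 := (mem_feasibleSet_gaussianModel_iff Z hν hσ hlam hc hR hR' hpd hmin x t.1 t.2).2 ht
    have hθ : t.1 ∈ D.Θ := mem_univ _
    have hf := hD.f_pos _ hθ x
    have hdet : 0 < (suppSubmatrix t.1 (hessian (D.loss 0) t.1)).det :=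
      ((posDef_hessian_gaussianModel Z hν hc hR hR' hpd 0 t.1).submatrix
        Subtype.val_injective).det_pos
    have hhess : hessian (D.loss x) t.1 = hessian (D.loss 0) t.1 := by
      rw [hessian_gaussianModel_loss Z hν σ lam θhat hR hR',
        hessian_gaussianModel_loss Z hν σ lam θhat hR hR']
    have hnorm : -(‖t.2 - gradient (D.loss x) t.1‖ ^ 2 / (2 * D.σ ^ 2 / d)) =
        -((d : ℝ) / 2 * ‖D.noiseOf x t.1 t.2‖ ^ 2) := by
      have hσ' : 0 < D.σ := hσ
      rw [PenalizedModel.noiseOf, norm_smul, mul_pow, norm_inv, Real.norm_of_nonneg hσ'.le]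
      field_simp
    simp only [if_pos ht, PenalizedModel.jointWeight, PenalizedModel.unnormDensity,
      indicator_of_mem hx, indicator_of_mem hθ]
    rw [hhess, hnorm, mul_assoc (D.f x t.1), ENNReal.ofReal_mul hf.le, ← mul_assoc (_⁻¹),
      ENNReal.inv_mul_cancel (ENNReal.ofReal_pos.2 hf).ne' ENNReal.ofReal_ne_top, one_mul,
      ← ENNReal.ofReal_mul (hD.f_pos θ₀ (mem_univ _) x).le, ← ENNReal.ofReal_mul (by positivity)]
    congr 1
    rw [gaussianModel_f_eq Z hν, noiseOf_gaussianModel Z hν hR, condExponent, neg_add, Real.exp_add]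
    ring_nf
  · have hx : x ∉ D.feasibleSet t.1 t.2 := fun h =>
      ht ((mem_feasibleSet_gaussianModel_iff Z hν hσ hlam hc hR hR' hpd hmin x t.1 t.2).1 h)
    simp [if_neg ht, PenalizedModel.jointWeight, PenalizedModel.unnormDensity,
      indicator_of_notMem hx]

lemma continuous_condExponent (t : Vec d × Vec d) :
    Continuous (condExponent Z ν R σ lam θhat θ₀ t) := by
  unfold condExponent; fun_prop

include hν in
lemma integrable_exp_condExponent (t : Vec d × Vec d) :
    Integrable fun x => Real.exp (-condExponent Z ν R σ lam θhat θ₀ t x) := by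
  have h : Integrable fun x : Vec n =>
      Real.exp (-(1 / (2 * ν ^ 2)) * ‖x - designMap Z θ₀‖ ^ 2) :=
    (integrable_exp_neg_mul_sq_norm (V := Vec n)
      (show (0 : ℝ) < 1 / (2 * ν ^ 2) by positivity)).comp_sub_right _
  refine h.mono' (continuous_condExponent Z θ₀ t).neg.rexp.aestronglyMeasurable
    (.of_forall fun x => ?_)
  rw [Real.norm_of_nonneg (Real.exp_pos _).le]
  refine Real.exp_le_exp.2 ?_
  rw [condExponent]
  have : 0 ≤ (d : ℝ) / 2 * ‖noiseMap Z ν σ x +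
    (gaussianModel Z ν R σ lam θhat).noiseOf 0 t.1 t.2‖ ^ 2 := by positivity
  linarith

lemma half_add_norm_sq {V : Type*} [NormedAddCommGroup V] [InnerProductSpace ℝ V] (y z : V) :
    (‖y‖ ^ 2 + ‖y + z‖ ^ 2) / 2 = ‖y + (1 / 2 : ℝ) • z‖ ^ 2 + ‖z‖ ^ 2 / 4 := by
  rw [norm_add_sq_real, norm_add_sq_real, norm_smul, real_inner_smul_right,
    Real.norm_of_nonneg (by norm_num)]
  ring

/-- The parallelogram identity for a quadratic function; the square root is the Mahalanobis length
of u for the Gaussian weight. -/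
lemma condExponent_midpoint (t : Vec d × Vec d) (u x : Vec n) :
    (condExponent Z ν R σ lam θhat θ₀ t x + condExponent Z ν R σ lam θhat θ₀ t (x + u)) / 2 =
      condExponent Z ν R σ lam θhat θ₀ t (x + (1 / 2 : ℝ) • u) +
        √(1 / ν ^ 2 * ‖u‖ ^ 2 + d * ‖noiseMap Z ν σ u‖ ^ 2) ^ 2 / 8 := by
  rw [Real.sq_sqrt (by positivity)]
  have h1 := half_add_norm_sq (x - designMap Z θ₀) u
  have h2 := half_add_norm_sq (noiseMap Z ν σ x +
    (gaussianModel Z ν R σ lam θhat).noiseOf 0 t.1 t.2) (noiseMap Z ν σ u)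
  simp only [condExponent, map_add, map_smul, add_sub_right_comm x, add_right_comm
    (noiseMap Z ν σ x)]
  linear_combination (1 / (2 * ν ^ 2)) * h1 + (d / 2 : ℝ) * h2

end GaussianModel

/-! ### The tilt as a translation, and its length -/

section GaussianModel

variable {n d : ℕ} (Z : Matrix (Fin n) (Fin d) ℝ) {ν c : ℝ} (hν : 0 < ν) {R : Vec d → ℝ}
  {σ lam : ℝ} {θhat : Vec n → Vec d → Vec d} (hσ : 0 < σ) (hlam : 0 ≤ lam) (hc : 0 < c)
  (hR : Differentiable ℝ R) (hR' : Differentiable ℝ (fderiv ℝ R))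
  (hpd : ∀ θ, ((1 / ν ^ 2) • (Z.transpose * Z) + hessian R θ
    - c • (1 : Matrix (Fin d) (Fin d) ℝ)).PosDef)
  (hmin : ∀ x w, IsMinOn ((gaussianModel Z ν R σ lam θhat).objective x w) Set.univ (θhat x w))
  (θ₀ : Vec d) {U : Vec d →L[ℝ] Vec n}
  (hU : ∀ v x, 1 / ν ^ 2 * inner ℝ (U v) x + d * inner ℝ (noiseMap Z ν σ (U v))
    (noiseMap Z ν σ x) = 1 / ν ^ 2 * inner ℝ (designMap Z v) x)

variable (ν R σ lam θhat U) in
/-- The exponent for which the tilted conditional density is a translate of the original one. -/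
def shiftExponent (t : Vec d × Vec d) : ℝ :=
  1 / (2 * ν ^ 2) * (‖designMap Z t.1‖ ^ 2 - ‖designMap Z θ₀‖ ^ 2) -
    (condExponent Z ν R σ lam θhat θ₀ t (U (θ₀ - t.1)) - condExponent Z ν R σ lam θhat θ₀ t 0)

include hν hR in
lemma measurable_shiftExponent : Measurable (shiftExponent Z ν R σ lam θhat θ₀ U) := by
  have hgR : Measurable (gradient R) :=
    (InnerProductSpace.toDual ℝ (Vec d)).symm.continuous.measurable.comp (measurable_fderiv ℝ R)
  have hg : Measurable (gradient ((gaussianModel Z ν R σ lam θhat).loss 0)) := by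
    have h : gradient ((gaussianModel Z ν R σ lam θhat).loss 0) = fun θ =>
        (1 / ν ^ 2) • (designMap Z).adjoint (designMap Z θ - 0) + gradient R θ :=
      funext fun θ => gradient_gaussianModel_loss Z hν σ lam θhat hR 0 θ
    rw [h]
    exact (by fun_prop : Measurable fun θ : Vec d =>
      (1 / ν ^ 2) • (designMap Z).adjoint (designMap Z θ - 0)).add hgR
  have hb : Measurable fun t : Vec d × Vec d =>
      (gaussianModel Z ν R σ lam θhat).noiseOf 0 t.1 t.2 :=
    Measurable.const_smul (measurable_snd.sub (hg.comp measurable_fst))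
      (gaussianModel Z ν R σ lam θhat).σ⁻¹
  have hA : Measurable fun t : Vec d × Vec d => designMap Z t.1 :=
    (designMap Z).continuous.measurable.comp measurable_fst
  have hu : Measurable fun t : Vec d × Vec d => U (θ₀ - t.1) :=
    U.continuous.measurable.comp (by fun_prop)
  have hBu : Measurable fun t : Vec d × Vec d => noiseMap Z ν σ (U (θ₀ - t.1)) :=
    (noiseMap Z ν σ).continuous.measurable.comp hu
  unfold shiftExponent condExponent
  fun_prop

include hU in
-- Translating a quadratic adds a linear form and a constant. The choice of U makes this linear form
-- the one by which the log-likelihoods at θ₀ and θ₀ - v differ.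
lemma condExponent_shift (t : Vec d × Vec d) (v : Vec d) (x : Vec n) :
    condExponent Z ν R σ lam θhat θ₀ t (x + U v) - condExponent Z ν R σ lam θhat θ₀ t x -
      (condExponent Z ν R σ lam θhat θ₀ t (U v) - condExponent Z ν R σ lam θhat θ₀ t 0) =
      1 / ν ^ 2 * inner ℝ (designMap Z v) x := by
  have key : ∀ {V : Type} [NormedAddCommGroup V] [InnerProductSpace ℝ V] (y z b : V),
      ‖y + z + b‖ ^ 2 - ‖y + b‖ ^ 2 - (‖z + b‖ ^ 2 - ‖b‖ ^ 2) = 2 * inner ℝ z y := by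
    intro V _ _ y z b
    rw [norm_add_sq_real, norm_add_sq_real, norm_add_sq_real, norm_add_sq_real, inner_add_left,
      real_inner_comm z y]
    ring
  have h1 := key x (U v) (-designMap Z θ₀)
  have h2 := key (noiseMap Z ν σ x) (noiseMap Z ν σ (U v))
    ((gaussianModel Z ν R σ lam θhat).noiseOf 0 t.1 t.2)
  rw [← hU v x]
  simp only [condExponent, map_add, map_zero, zero_add, sub_eq_add_neg] at h1 h2 ⊢
  linear_combination (1 / (2 * ν ^ 2)) * h1 + (d / 2 : ℝ) * h2

include hν hU in
lemma tilt_shiftExponent (t : Vec d × Vec d) (x : Vec n) :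
    (gaussianModel Z ν R σ lam θhat).tilt θ₀ (shiftExponent Z ν R σ lam θhat θ₀ U) (x, t) =
      ENNReal.ofReal (Real.exp (-(condExponent Z ν R σ lam θhat θ₀ t (x + U (θ₀ - t.1)) -
        condExponent Z ν R σ lam θhat θ₀ t x))) := by
  have hc : 0 < (√(2 * Real.pi * ν ^ 2))⁻¹ ^ n := by positivity
  have hθ : t.1 ∈ (gaussianModel Z ν R σ lam θhat).Θ := mem_univ _
  simp only [PenalizedModel.tilt, indicator_of_mem hθ, gaussianModel_f_eq Z hν]
  rw [← ENNReal.ofReal_div_of_pos (by positivity), ← ENNReal.ofReal_mul (by positivity),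
    mul_div_mul_left _ _ hc.ne', ← Real.exp_sub, ← Real.exp_add]
  congr 2
  have h := condExponent_shift Z (R := R) (lam := lam) (θhat := θhat) θ₀ hU t (θ₀ - t.1) x
  rw [map_sub (designMap Z), inner_sub_left, real_inner_comm x, real_inner_comm x] at h
  rw [shiftExponent, norm_sub_sq_real, norm_sub_sq_real]
  linear_combination h

include hU in
-- Testing the equation for U against Uv gives s² = σ⟨v, B(Uv)⟩ for B the noise map. This is at most
-- σr‖B(Uv)‖ ≤ σrs/√d, because d‖B(Uv)‖² is one of the two terms of s². Dividing by s gives the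
-- bound, with neither Z nor ν in it.
lemma shift_norm_le (hν : 0 < ν) (hσ : 0 < σ) (hd : 1 ≤ d) {v : Vec d} {r : ℝ} (hv : ‖v‖ ≤ r) :
    √(1 / ν ^ 2 * ‖U v‖ ^ 2 + d * ‖noiseMap Z ν σ (U v)‖ ^ 2) ≤ σ * r / √d := by
  have hd0 : (0 : ℝ) < d := by exact_mod_cast hd
  have hr : 0 ≤ r := (norm_nonneg v).trans hv
  have h1 := hU v (U v)
  rw [real_inner_self_eq_norm_sq, real_inner_self_eq_norm_sq] at h1
  have h2 : 1 / ν ^ 2 * inner ℝ (designMap Z v) (U v) =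
      σ * inner ℝ v (noiseMap Z ν σ (U v)) := by
    rw [noiseMap, FunLike.coe_smul, Pi.smul_apply, real_inner_smul_right,
      ContinuousLinearMap.adjoint_inner_right]
    field_simp
  set B := ‖noiseMap Z ν σ (U v)‖ with hB
  set s := 1 / ν ^ 2 * ‖U v‖ ^ 2 + d * B ^ 2 with hs
  have hs0 : 0 ≤ s := by positivity
  have h3 : s ≤ σ * (r * B) := by
    rw [h1, h2]
    refine mul_le_mul_of_nonneg_left ((real_inner_le_norm _ _).trans ?_) hσ.le
    exact mul_le_mul_of_nonneg_right hv (norm_nonneg _)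
  have h4 : d * B ^ 2 ≤ s := by
    have : 0 ≤ 1 / ν ^ 2 * ‖U v‖ ^ 2 := by positivity
    linarith
  have h5 : √d * B ≤ √s := by
    refine Real.le_sqrt_of_sq_le ?_
    rw [mul_pow, Real.sq_sqrt hd0.le]
    exact h4
  have hsd : 0 < √(d : ℝ) := Real.sqrt_pos.2 hd0
  rw [le_div_iff₀ hsd]
  rcases (Real.sqrt_nonneg s).eq_or_lt with h0 | h0
  · rw [← h0, zero_mul]; positivity
  · refine le_of_mul_le_mul_right ?_ h0
    calc √s * √d * √s = s * √d := by rw [mul_right_comm, Real.mul_self_sqrt hs0]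
      _ ≤ σ * (r * B) * √d := by gcongr
      _ = σ * r * (√d * B) := by ring
      _ ≤ σ * r * √s := by gcongr

include hν hR hR' hσ hlam hc hpd hmin in
-- Conditionally on (θ, g), tilting translates the Gaussian weight by a vector of Mahalanobis length
-- at most s₀ = σr/√d, so the loss on the good event is at most s₀/2.
theorem errorBound_gaussianModel (hd : 1 ≤ d)
    (hm : Measurable fun q : Vec n × Vec d => θhat q.1 q.2) {M : ℕ}
    {κ : Kernel (Vec n × Vec d × Vec d) (Fin M → Vec n)} [IsMarkovKernel κ]
    (hκ : (gaussianModel Z ν R σ lam θhat).ValidSampler κ) {r δ : ℝ} (hr : 0 ≤ r)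
    (hδ : 1 - δ ≤ ((gaussianModel Z ν R σ lam θhat).dataLaw θ₀).real
      {q | ‖θhat q.1 q.2 - θ₀‖ ≤ r}) :
    ErrorBound ((gaussianModel Z ν R σ lam θhat).acssLaw κ θ₀) (σ / (2 * √(d : ℝ)) * r + δ) := by
  have hD := twiceDifferentiable_gaussianModel Z hν σ lam θhat hR hR'
  obtain ⟨U, hU⟩ := exists_shift (designMap Z) (noiseMap Z ν σ)
    (show 0 < 1 / ν ^ 2 by positivity) (Nat.cast_nonneg d)
  obtain ⟨W, hW⟩ := jointWeight_gaussianModel Z hν hσ hlam hc hR hR' hpd hmin θ₀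
  have hiff := fun x w => isSSOSP_gaussianModel_iff Z hν hlam hc hR hR' hpd hmin x w
  have hk : Measurable (shiftExponent Z ν R σ lam θhat θ₀ U) :=
    measurable_shiftExponent Z hν hR θ₀
  have htilt := tilt_shiftExponent Z (R := R) (lam := lam) (θhat := θhat) hν θ₀ hU
  have hint := integrable_exp_condExponent Z (R := R) (σ := σ) (lam := lam) (θhat := θhat) hν θ₀
  have hcont := continuous_condExponent Z (ν := ν) (R := R) (σ := σ) (lam := lam)
    (θhat := θhat) θ₀
  have hmid := condExponent_midpoint Z (ν := ν) (R := R) (σ := σ) (lam := lam) (θhat := θhat) θ₀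
  set q := condExponent Z ν R σ lam θhat θ₀ with hq
  set k := shiftExponent Z ν R σ lam θhat θ₀ U with hkdef
  set D := gaussianModel Z ν R σ lam θhat with hDdef
  have hs : D.MeasurableSolver := ⟨hm, fun _ _ => mem_univ _⟩
  have hθ₀ : θ₀ ∈ D.Θ := mem_univ _
  have hσ' : 0 < D.σ := hσ
  have hlam' : 0 ≤ D.lam := hlam
  have hprob := hD.isProbabilityMeasure_dataLaw hθ₀
  set G := Metric.closedBall θ₀ r with hGdef
  have hG : MeasurableSet G := Metric.isClosed_closedBall.measurableSet
  have hE := hD.measurableSet_goodEvent hlam' hs hG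
  -- The estimator is always an SSOSP here, so the accuracy assumption alone describes the good
  -- event.
  have hEeq : D.goodEvent G = {q | ‖θhat q.1 q.2 - θ₀‖ ≤ r} := by
    ext p
    have : D.IsSSOSP p.1 p.2 (D.θhat p.1 p.2) := (hiff _ _ _).2 rfl
    simp only [PenalizedModel.goodEvent, PenalizedModel.ssospEvent, mem_inter_iff, mem_ofPred_eq,
      this, true_and, hGdef, mem_closedBall_iff_norm]
    rfl
  rw [← hEeq] at hδ
  have hδ0 : 0 ≤ δ := PenalizedModel.nonneg_of_one_sub_le hδ
  have hcompl := PenalizedModel.measure_compl_le hE hδ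
  have hτm : Measurable (D.tilt θ₀ k) := hD.measurable_tilt hθ₀ hk
  have hWm : ∀ t x, D.jointWeight θ₀ (x, t) = W t * ENNReal.ofReal (Real.exp (-q t x)) := hW
  have hqm : ∀ t, Measurable fun x => ENNReal.ofReal (Real.exp (-q t x)) := fun t =>
    (hcont t).neg.rexp.measurable.ennreal_ofReal
  obtain ⟨Y, hY⟩ : ∃ Y, Y = ∫⁻ p in D.goodEvent G, D.tilt θ₀ k (D.estimates p) ∂(D.dataLaw θ₀) +
      D.dataLaw θ₀ (D.goodEvent G)ᶜ := ⟨_, rfl⟩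
  -- Translation preserves Lebesgue measure, so the tilt preserves the mass at every fixed (θ, g)
  -- with θ in the ball; the normalization Y costs nothing.
  have hY1 : Y ≤ 1 := by
    have h := hD.setLIntegral_goodEvent_le hlam' hσ' hs hd hθ₀ hG (Φ := D.tilt θ₀ k) (Ψ := 1)
      (K := 1) hτm measurable_one ENNReal.one_ne_top fun t _ => ?_
    · rw [hY, ← prob_add_prob_compl (μ := D.dataLaw θ₀) hE]
      gcongr
      simpa using h
    · have hx : ∀ x, D.tilt θ₀ k (x, t) * D.jointWeight θ₀ (x, t) =
          W t * ENNReal.ofReal (Real.exp (-q t (x + U (θ₀ - t.1)))) := fun x => by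
        rw [hWm, htilt, mul_left_comm, ← ENNReal.ofReal_mul (Real.exp_pos _).le, ← Real.exp_add]
        congr 3; ring
      rw [lintegral_congr hx]
      simp only [Pi.one_apply, one_mul, hWm]
      change ∫⁻ x : Vec n, _ ∂volume ≤ ∫⁻ x : Vec n, _ ∂volume
      exact (lintegral_add_right_eq_self
        (fun x : Vec n => W t * ENNReal.ofReal (Real.exp (-q t x))) (U (θ₀ - t.1))).le
  set s₀ := σ * r / √(d : ℝ) with hs₀
  have hs₀0 : 0 ≤ s₀ := by positivity
  refine hD.errorBound_of_tilt hlam' hσ' hs hθ₀ hk hG hd hκ (by positivity) hY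
    (ne_top_of_le_ne_top ENNReal.one_ne_top hY1) ?_
  have hmain : ∫⁻ p in D.goodEvent G, (1 - D.tilt θ₀ k (D.estimates p) / Y) ∂(D.dataLaw θ₀) ≤
      ENNReal.ofReal (s₀ / 2) := by
    have h := hD.setLIntegral_goodEvent_le hlam' hσ' hs hd hθ₀ hG
      (Φ := fun t => 1 - D.tilt θ₀ k t) (Ψ := 1) (K := ENNReal.ofReal (s₀ / 2))
      (measurable_const.sub hτm) measurable_one ENNReal.ofReal_ne_top fun t ht => ?_
    -- Since Y ≤ 1, dropping the division by Y can only increase the loss; what remains is compared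
    -- at fixed (θ, g).
    · calc _ ≤ ∫⁻ p in D.goodEvent G, (1 - D.tilt θ₀ k (D.estimates p)) ∂(D.dataLaw θ₀) := by
            refine lintegral_mono fun p => tsub_le_tsub_left ?_ _
            rw [div_eq_mul_inv]
            exact le_mul_of_one_le_right' (ENNReal.one_le_inv.2 hY1)
        _ ≤ _ := h
        _ ≤ ENNReal.ofReal (s₀ / 2) * 1 := by
            gcongr
            simpa using prob_le_one
        _ = _ := mul_one _
    · set u := U (θ₀ - t.1) with hu
      have hv : ‖θ₀ - t.1‖ ≤ r := by
        rw [norm_sub_rev, ← dist_eq_norm]; exact ht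
      have hx : ∀ x, (1 - D.tilt θ₀ k (x, t)) * D.jointWeight θ₀ (x, t) =
          W t * ENNReal.ofReal (Real.exp (-q t x) - Real.exp (-q t (x + u))) := fun x => by
        rw [hWm, htilt, mul_left_comm, ← ENNReal.ofReal_one,
          ← ENNReal.ofReal_sub _ (Real.exp_pos _).le, ← ENNReal.ofReal_mul' (Real.exp_pos _).le,
          sub_mul, one_mul, ← Real.exp_add]
        congr 4; ring
      rw [lintegral_congr hx]
      simp only [Pi.one_apply, one_mul, hWm]
      change ∫⁻ x : Vec n, _ ∂volume ≤ _ * ∫⁻ x : Vec n, _ ∂volume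
      have hdm : Measurable fun x => ENNReal.ofReal (Real.exp (-q t x) - Real.exp (-q t (x + u))) :=
        ((hcont t).neg.rexp.sub ((hcont t).comp (continuous_add_const u)).neg.rexp
          ).measurable.ennreal_ofReal
      rw [lintegral_const_mul _ hdm, lintegral_const_mul _ (hqm t), mul_left_comm]
      gcongr
      refine lintegral_exp_sub_shift_le (hint t) (hmid t u) (Real.sqrt_nonneg _)
        (shift_norm_le Z hU hν hσ hd hv) fun h0 => ?_
      have hsd : √(d : ℝ) ≠ 0 := by positivity
      have hr0 : r = 0 := by
        rw [hs₀, div_eq_zero_iff, mul_eq_zero] at h0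
        exact (h0.resolve_right hsd).resolve_left hσ.ne'
      rw [hr0] at hv
      rw [hu, norm_le_zero_iff.1 hv, map_zero]
  calc _ ≤ ENNReal.ofReal (s₀ / 2) + ENNReal.ofReal δ := add_le_add hmain hcompl
    _ = _ := by
      rw [← ENNReal.ofReal_add (by positivity) hδ0, hs₀]
      congr 1
      field_simp

end GaussianModel

end

theorem theorem4 {d : ℕ} (hd : 1 ≤ d) :
    -- general models: the general bound and the bound under sparse structure
    (∀ {X : Type*} [MeasurableSpace X] (D : PenalizedModel d X),
      0 < D.σ → 0 ≤ D.lam → D.Regular → D.MeasurableSolver →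
      ∀ (r ε δ : Vec d → ℝ), (∀ θ₀ ∈ D.Θ, 0 ≤ r θ₀) →
      (∀ θ₀ ∈ D.Θ, D.AccurateSSOSP θ₀ (r θ₀) (δ θ₀)) →
      (∀ θ₀ ∈ D.Θ, D.HessianConcentration θ₀ (r θ₀) (ε θ₀)) →
      ∀ {M : ℕ} (κ : Kernel (X × Vec d × Vec d) (Fin M → X)) [IsMarkovKernel κ],
      D.ValidSampler κ → ∀ θ₀ ∈ D.Θ,
        ErrorBound (D.acssLaw κ θ₀) (3 * D.σ * r θ₀ + ε θ₀ + δ θ₀) ∧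
        ∀ {p : ℕ} (v : Fin p → Vec d) (k : ℕ) (δ' : ℝ),
          1 - δ' ≤ (D.dataLaw θ₀).real
            {q | vSparsity v (D.θhat q.1 q.2 - θ₀) ≤ (k : ℕ∞)} →
          ErrorBound (D.acssLaw κ θ₀)
            (3 * D.σ * r θ₀ * √(effectiveDim v k / d) + ε θ₀ + δ θ₀ + δ')) ∧
    -- the Gaussian linear model
    (∀ {n : ℕ} (Z : Matrix (Fin n) (Fin d) ℝ) (ν : ℝ) (R : Vec d → ℝ) (σ lam c : ℝ)
      (θhat : Vec n → Vec d → Vec d),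
      0 < ν → 0 < σ → 0 ≤ lam → 0 < c →
      Differentiable ℝ R → Differentiable ℝ (fderiv ℝ R) →
      (∀ θ, ((1 / ν ^ 2) • (Z.transpose * Z) + hessian R θ
        - c • (1 : Matrix (Fin d) (Fin d) ℝ)).PosDef) →
      Measurable (fun q : Vec n × Vec d => θhat q.1 q.2) →
      (∀ x w, IsMinOn ((gaussianModel Z ν R σ lam θhat).objective x w) Set.univ (θhat x w)) →
      ∀ {M : ℕ} (κ : Kernel (Vec n × Vec d × Vec d) (Fin M → Vec n)) [IsMarkovKernel κ],
      (gaussianModel Z ν R σ lam θhat).ValidSampler κ →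
      ∀ (θ₀ : Vec d) (r δ : ℝ), 0 ≤ r →
        1 - δ ≤ ((gaussianModel Z ν R σ lam θhat).dataLaw θ₀).real
          {q | ‖θhat q.1 q.2 - θ₀‖ ≤ r} →
        ErrorBound ((gaussianModel Z ν R σ lam θhat).acssLaw κ θ₀)
          (σ / (2 * √(d : ℝ)) * r + δ)) := by
  refine ⟨?_, ?_⟩
  · intro X _ D hσ hlam hR hs r ε δ hr hA hH M κ _ hκ θ₀ hθ₀
    exact ⟨hR.errorBound_general hθ₀ (hr θ₀ hθ₀) (hA θ₀ hθ₀) (hH θ₀ hθ₀) hd hlam hσ hs hκ,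
      fun v k _ hv => hR.errorBound_sparse hθ₀ (hr θ₀ hθ₀) (hA θ₀ hθ₀) (hH θ₀ hθ₀) hd hlam hσ hs hκ
        v k hv⟩
  · intro n Z ν R σ lam c θhat hν hσ hlam hc hR hR' hpd hm hmin M κ _ hκ θ₀ r δ hr hδ
    exact errorBound_gaussianModel Z hν hσ hlam hc hR hR' hpd hmin θ₀ hd hm hκ hr hδ
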